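/- **Notation.** Let $n\ge 1$, $N\ge 1$, $k\ge 1$ be integers and write $G_{4n}=\mathrm{GSp}_{4n}$, with Siegel parabolic subgroup $P_{4n}$ (lower left $2n\times 2n$ block zero). For $p=\begin{pmatrix}A&*\\0&v\,{}^tA^{-1}\end{pmatrix}\in P_{4n}$ put $d(p)=v^{-n}\det A$. Let $\mathbb H_{2n}$ be the Siegel upper half space of degree $2n$ (complex symmetric $2n\times 2n$ matrices $Z$ with $\mathrm{Im}\,Z>0$), $I=i1_{2n}$, and $j(g,Z)=\det(CZ+D)$ for $g=\begin{pmatrix}A&B\\C&D\end{pmatrix}\in\mathrm{Sp}_{4n}(\mathbb R)$. Let $\Gamma_{4n}(N)$ be the principal congruence subgroup of level $N$ of $\mathrm{Sp}_{4n}(\mathbb Z)$. Let $\chi=\otimes_v\chi_v$ be a character of $\mathbb Q^\times\backslash\mathbb A^\times$ with $\chi_\infty=\mathrm{sgn}^k$, such that $\chi_p$ is unramified for every prime $p\nmid N$, and $\chi_p$ is trivial on $(1+p^{m_p}\mathbb Z_p)\cap\mathbb Z_p^\times$ for every prime $p\mid N$, where $N=\prod_{p\mid N}p^{m_p}$. Let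 $$Q_n=\begin{pmatrix}1_n&0&0&0\\0&0&0&1_n\\0&0&1_n&1_n\\1_n&-1_n&0&0\end{pmatrix}.$$ For $s\in\mathbb C$ let $f(\cdot,s)=\otimes_v f_v(\cdot,s)$ be the function on $G_{4n}(\mathbb A)$ whose local components all satisfy $f_v(pg,s)=\chi_v(d(p))\,|d(p)|_v^{(2n+1)(s+\frac12)}f_v(g,s)$ for $p\in P_{4n}(\mathbb Q_v)$, $g\in G_{4n}(\mathbb Q_v)$, and moreover: * for $p\nmid N$, $f_p$ is right $G_{4n}(\mathbb Z_p)$-invariant with $f_p(1,s)=1$; * for $p\mid N$, $f_p$ is right invariant under $\Gamma_{4n}(p^{m_p})=\{g\in \mathrm{Sp}_{4n}(\mathbb Z_p): g\equiv 1 \bmod p^{m_p}\}$, supported on $P_{4n}(\mathbb Q_p)Q_n\Gamma_{4n}(p^{m_p})$, and $f_p(Q_n,s)=1$; * $f_\infty(\kappa,s)=j(\kappa,I)^{-k}$ for $\kappa\in\mathrm{Sp}_{4n}(\mathbb R)\cap\mathrm O(4n)$. Put $E(g,s,f)=\sum_{\gamma\in P_{4n}(\mathbb Q)\backslash G_{4n}(\mathbb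 Q)}f(\gamma g,s)$ wherever this series converges absolutely, and $$E^{\chi}_{k,N}(Z,s)=j(g,I)^k\,E\Big(g,\tfrac{2s}{2n+1}+\tfrac{k}{2n+1}-\tfrac12,f\Big),$$ where $g\in\mathrm{Sp}_{4n}(\mathbb R)$ (embedded in $G_{4n}(\mathbb A)$ at the real place) is any element with $g(I)=Z\in\mathbb H_{2n}$. A function on $\mathbb H_{2n}$ is *nearly holomorphic* if it is a polynomial in the entries of $\mathrm{Im}(Z)^{-1}$ with holomorphic functions on $\mathbb H_{2n}$ as coefficients. Let $N_k(\Gamma_{4n}(N))$ be the space of nearly holomorphic $F$ on $\mathbb H_{2n}$ with $F(\gamma Z)=j(\gamma,Z)^kF(Z)$ for all $\gamma\in\Gamma_{4n}(N)$, $Z\in\mathbb H_{2n}$; the holomorphic functions with this property are the holomorphic Siegel modular forms of degree $2n$ and weight $k$ for $\Gamma_{4n}(N)$ (no condition at the cusps is needed, as $2n\ge2$). **Proposition.** Suppose that $k\ge 2n+2$. Then for every $Z\in\mathbb H_{2n}$ the series defining $E^\chi_{k,N}(Z,0)$ is absolutely convergent, and $E^\chi_{k,N}(\,\cdot\,,0)$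 is a holomorphic Siegel modular form of degree $2n$ and weight $k$ for $\Gamma_{4n}(N)$. More generally, for every integer $m$ with $0\le m\le \frac k2-n-1$, the series defining $E^\chi_{k,N}(Z,-m)$ is absolutely convergent for every $Z\in\mathbb H_{2n}$, and $E^\chi_{k,N}(\,\cdot\,,-m)\in N_k(\Gamma_{4n}(N))$. -/

import Mathlib

open Matrix

noncomputable section

namespace SiegelEis

/-! ### Symplectic groups -/

section Groups

variable (l : Type) [Fintype l] [DecidableEq l] (R : Type) [CommRing R]

/-- The group of symplectic similitudes `{g : ᵗg J g = μ(g) J, μ(g) ∈ Rˣ}`. (Replacing `J` by `-J`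
does not change the group.) With `l` of cardinality `d` this is `GSp_{2d}(R)`. -/
def GSp : Subgroup (GL (l ⊕ l) R) where
  carrier := {g | ∃ μ : Rˣ, (g : Matrix (l ⊕ l) (l ⊕ l) R)ᵀ * J l R * g = (μ : R) • J l R}
  one_mem' := ⟨1, by simp⟩
  mul_mem' := by
    rintro a b ⟨μ, hμ⟩ ⟨ν, hν⟩
    refine ⟨μ * ν, ?_⟩
    have : ((a * b : GL (l ⊕ l) R) : Matrix (l ⊕ l) (l ⊕ l) R)ᵀ * J l R * (a * b : GL (l ⊕ l) R)
        = (b : Matrix (l ⊕ l) (l ⊕ l) R)ᵀ *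
          ((a : Matrix (l ⊕ l) (l ⊕ l) R)ᵀ * J l R * a) * b := by
      simp only [Units.val_mul, transpose_mul, Matrix.mul_assoc]
    rw [this, hμ, Matrix.mul_smul, Matrix.smul_mul, hν, smul_smul, Units.val_mul]
  inv_mem' := by
    rintro a ⟨μ, hμ⟩
    refine ⟨μ⁻¹, ?_⟩
    have h1 : (a : Matrix (l ⊕ l) (l ⊕ l) R) * (a⁻¹ : GL (l ⊕ l) R) = 1 := by
      rw [← Units.val_mul]; simp
    have h2 : ((a⁻¹ : GL (l ⊕ l) R) : Matrix (l ⊕ l) (l ⊕ l) R)ᵀ *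
        (a : Matrix (l ⊕ l) (l ⊕ l) R)ᵀ = 1 := by
      rw [← transpose_mul, h1, transpose_one]
    have h3 : (μ : R) • (((a⁻¹ : GL (l ⊕ l) R) : Matrix (l ⊕ l) (l ⊕ l) R)ᵀ * J l R *
        (a⁻¹ : GL (l ⊕ l) R)) = J l R := by
      calc _ = ((a⁻¹ : GL (l ⊕ l) R) : Matrix (l ⊕ l) (l ⊕ l) R)ᵀ * ((μ : R) • J l R) *
            (a⁻¹ : GL (l ⊕ l) R) := by rw [Matrix.mul_smul, Matrix.smul_mul]
        _ = (((a⁻¹ : GL (l ⊕ l) R) : Matrix (l ⊕ l) (l ⊕ l) R)ᵀ *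
              (a : Matrix (l ⊕ l) (l ⊕ l) R)ᵀ) * J l R * (a * (a⁻¹ : GL (l ⊕ l) R)) := by
            rw [← hμ]; simp only [Matrix.mul_assoc]
        _ = J l R := by rw [h1, h2, Matrix.one_mul, Matrix.mul_one]
    calc _ = (((μ⁻¹ : Rˣ) : R) * (μ : R)) • (((a⁻¹ : GL (l ⊕ l) R) :
              Matrix (l ⊕ l) (l ⊕ l) R)ᵀ * J l R * (a⁻¹ : GL (l ⊕ l) R)) := by simp
      _ = _ := by rw [← smul_smul, h3]

/-- The Siegel parabolic subgroup: the lower left block vanishes. -/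
def siegelParabolic : Subgroup (GSp l R) where
  carrier := {g | ((g : GL (l ⊕ l) R) : Matrix (l ⊕ l) (l ⊕ l) R).toBlocks₂₁ = 0}
  one_mem' := by
    change (1 : Matrix (l ⊕ l) (l ⊕ l) R).toBlocks₂₁ = 0
    rw [← fromBlocks_one, toBlocks_fromBlocks₂₁]
  mul_mem' := by
    intro a b ha hb
    change (((a : GL (l ⊕ l) R) : Matrix (l ⊕ l) (l ⊕ l) R) *
      ((b : GL (l ⊕ l) R) : Matrix (l ⊕ l) (l ⊕ l) R)).toBlocks₂₁ = 0
    simp only [Set.mem_ofPred_eq] at ha hb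
    rw [← fromBlocks_toBlocks ((a : GL (l ⊕ l) R) : Matrix (l ⊕ l) (l ⊕ l) R),
      ← fromBlocks_toBlocks ((b : GL (l ⊕ l) R) : Matrix (l ⊕ l) (l ⊕ l) R), ha, hb,
      fromBlocks_multiply, toBlocks_fromBlocks₂₁]
    simp
  inv_mem' := by
    intro a ha
    simp only [Set.mem_ofPred_eq] at ha ⊢
    have h1 : ((a : GL (l ⊕ l) R) : Matrix (l ⊕ l) (l ⊕ l) R) *
        (((a⁻¹ : GSp l R) : GL (l ⊕ l) R) : Matrix (l ⊕ l) (l ⊕ l) R) = 1 := by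
      rw [← Units.val_mul, ← Subgroup.coe_mul]; simp
    rw [← fromBlocks_toBlocks ((a : GL (l ⊕ l) R) : Matrix (l ⊕ l) (l ⊕ l) R),
      ← fromBlocks_toBlocks (((a⁻¹ : GSp l R) : GL (l ⊕ l) R) : Matrix (l ⊕ l) (l ⊕ l) R), ha,
      fromBlocks_multiply, ← fromBlocks_one, fromBlocks_inj] at h1
    obtain ⟨-, -, h21, h22⟩ := h1
    rw [Matrix.zero_mul, zero_add] at h21 h22
    rw [← Matrix.one_mul (toBlocks₂₁ _), ← mul_eq_one_comm.mp h22, Matrix.mul_assoc, h21,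
      Matrix.mul_zero]

/-- The principal congruence subgroup of `Sp(R)` of level `a`: symplectic matrices congruent to the
identity modulo `a`. -/
def principalCongruence (a : R) : Set (Matrix (l ⊕ l) (l ⊕ l) R) :=
  {γ | γ ∈ symplecticGroup l R ∧ ∀ i j, a ∣ (γ - 1) i j}

end Groups

/-! ### The Siegel upper half space and (nearly) holomorphic modular forms -/

section HalfSpace

variable {l : Type} [Fintype l] [DecidableEq l]

/-- The Siegel upper half space: complex symmetric matrices with positive definite imaginary part.
Functions on it are modelled by functions on all matrices, of which only the restriction matters. -/
def upperHalfSpace (l : Type) [Fintype l] [DecidableEq l] : Set (Matrix l l ℂ) :=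
  {Z | Zᵀ = Z ∧ (Z.map Complex.im).PosDef}

/-- The base point `i·1`. -/
def basePoint (l : Type) [DecidableEq l] : Matrix l l ℂ := Complex.I • (1 : Matrix l l ℂ)

/-- The matrix `CZ + D`. -/
def denom (g : Matrix (l ⊕ l) (l ⊕ l) ℝ) (Z : Matrix l l ℂ) : Matrix l l ℂ :=
  g.toBlocks₂₁.map Complex.ofReal * Z + g.toBlocks₂₂.map Complex.ofReal

/-- The automorphy factor `j(g, Z) = det (CZ + D)`. -/
def autFactor (g : Matrix (l ⊕ l) (l ⊕ l) ℝ) (Z : Matrix l l ℂ) : ℂ := (denom g Z).det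

/-- The action `g Z = (AZ + B)(CZ + D)⁻¹`. -/
def moebius (g : Matrix (l ⊕ l) (l ⊕ l) ℝ) (Z : Matrix l l ℂ) : Matrix l l ℂ :=
  (g.toBlocks₁₁.map Complex.ofReal * Z + g.toBlocks₁₂.map Complex.ofReal) * (denom g Z)⁻¹

/-- Holomorphy on the Siegel upper half space. The half space is a relatively open subset of the
complex vector space of symmetric matrices, and differentiability within it is the existence of a
complex linear derivative along symmetric directions. -/
def IsHolomorphic (F : Matrix l l ℂ → ℂ) : Prop := DifferentiableOn ℂ F (upperHalfSpace l)

/-- Nearly holomorphic functions: polynomials in the entries of `(Im Z)⁻¹` with holomorphic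
functions as coefficients; `S` is the finite set of exponents that occur. -/
def IsNearlyHolomorphic (F : Matrix l l ℂ → ℂ) : Prop :=
  ∃ (S : Finset (l × l → ℕ)) (c : (l × l → ℕ) → Matrix l l ℂ → ℂ),
    (∀ a ∈ S, IsHolomorphic (c a)) ∧
    ∀ Z ∈ upperHalfSpace l,
      F Z = ∑ a ∈ S, c a Z * ∏ ij : l × l, (((Z.map Complex.im)⁻¹ ij.1 ij.2 : ℝ) : ℂ) ^ a ij

/-- `F(γZ) = j(γ, Z)^k F(Z)` for all `γ ∈ Γ` and all `Z` in the half space. -/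
def IsModularOfWeight (k : ℕ) (Γ : Set (Matrix (l ⊕ l) (l ⊕ l) ℝ)) (F : Matrix l l ℂ → ℂ) : Prop :=
  ∀ γ ∈ Γ, ∀ Z ∈ upperHalfSpace l, F (moebius γ Z) = autFactor γ Z ^ k * F Z

/-- Holomorphic Siegel modular forms of weight `k` for `Γ`, in degree at least two (where no
condition at the cusps is imposed, being automatic). -/
def IsSiegelModularForm (k : ℕ) (Γ : Set (Matrix (l ⊕ l) (l ⊕ l) ℝ))
    (F : Matrix l l ℂ → ℂ) : Prop :=
  IsHolomorphic F ∧ IsModularOfWeight k Γ F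

/-- The space `N_k(Γ)` of nearly holomorphic modular forms, in degree at least two (where no
condition at the cusps is imposed). -/
def IsNearlyHolomorphicModularForm (k : ℕ) (Γ : Set (Matrix (l ⊕ l) (l ⊕ l) ℝ))
    (F : Matrix l l ℂ → ℂ) : Prop :=
  IsNearlyHolomorphic F ∧ IsModularOfWeight k Γ F

end HalfSpace

/-- The principal congruence subgroup of level `N` of `Sp(ℤ)`, as a set of real matrices. -/
def GammaN (l : Type) [Fintype l] [DecidableEq l] (N : ℕ) : Set (Matrix (l ⊕ l) (l ⊕ l) ℝ) :=
  (fun γ => γ.map (Int.cast : ℤ → ℝ)) '' principalCongruence l ℤ (N : ℤ)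

/-! ### Characters of `ℚˣ \ 𝔸ˣ` -/

instance factPrimes (p : Nat.Primes) : Fact (p : ℕ).Prime := ⟨p.2⟩

/-- A character `χ = ⊗ χ_v` of `ℚˣ \ 𝔸ˣ`, given by its local components: continuous characters of
`ℝˣ` and of all `ℚ_pˣ`, almost all of them unramified, whose product is trivial on the diagonally
embedded `ℚˣ`. -/
structure IdeleClassChar where
  /-- the component at the real place -/
  arch : ℝˣ →* ℂˣ
  /-- the component at the prime `p` -/
  loc : ∀ p : Nat.Primes, ℚ_[p]ˣ →* ℂˣ
  continuous_arch : Continuous arch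
  continuous_loc : ∀ p, Continuous (loc p)
  unramified : ∀ᶠ p in Filter.cofinite, ∀ u : ℚ_[(p : Nat.Primes)]ˣ,
    ‖(u : ℚ_[p])‖ = 1 → loc p u = 1
  trivial_on_rat : ∀ a : ℚˣ, arch (Units.map (algebraMap ℚ ℝ).toMonoidHom a) *
    ∏ᶠ p : Nat.Primes, loc p (Units.map (algebraMap ℚ ℚ_[p]).toMonoidHom a) = 1

/-- `χ_∞ = sgn^k`, and `N` is a level for `χ`: the component `χ_p` is unramified for `p ∤ N` and
trivial on `1 + p^m ℤ_p` (intersected with the units), `m = v_p(N)`, for `p ∣ N`. -/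
structure IdeleClassChar.HasTypeLevel (χ : IdeleClassChar) (k N : ℕ) : Prop where
  arch_eq : ∀ u : ℝˣ, (χ.arch u : ℂ) = ((SignType.sign (u : ℝ) : ℝ) : ℂ) ^ k
  unram : ∀ p : Nat.Primes, ¬ (p : ℕ) ∣ N → ∀ u : ℚ_[p]ˣ, ‖(u : ℚ_[p])‖ = 1 → χ.loc p u = 1
  ram : ∀ p : Nat.Primes, (p : ℕ) ∣ N → ∀ u : ℚ_[p]ˣ, ‖(u : ℚ_[p])‖ = 1 →
    ‖(u : ℚ_[p]) - 1‖ ≤ ((p : ℕ) : ℝ) ^ (-(padicValNat p N : ℤ)) → χ.loc p u = 1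

/-! ### Sections of the degenerate principal series -/

section Sections

variable {l : Type} [Fintype l] [DecidableEq l] {F : Type} [NormedField F]

/-- The parabolic element with blocks `A, X, 0, v ᵗA⁻¹`. -/
def parabolicElt (A : GL l F) (X : Matrix l l F) (v : Fˣ) : Matrix (l ⊕ l) (l ⊕ l) F :=
  fromBlocks A X 0 ((v : F) • ((A⁻¹ : GL l F) : Matrix l l F)ᵀ)

/-- The function on `P(F) x K`, extended by zero to `GSp(F)`, with
`f(p x κ) = χ(d(p)) |d(p)|^e w(κ)` for `p ∈ P(F)`, `κ ∈ K`. Here `d(p) = v^{-n} det A` for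
`p = [A, X; 0, v ᵗA⁻¹]` with `A` of size `2n`. In all uses below the value does not depend
on the decomposition `g = p x κ`. -/
def localSection (n : ℕ) (χ : Fˣ →* ℂˣ) (e : ℂ) (x : Matrix (l ⊕ l) (l ⊕ l) F)
    (K : Set (Matrix (l ⊕ l) (l ⊕ l) F)) (w : Matrix (l ⊕ l) (l ⊕ l) F → ℂ)
    (g : Matrix (l ⊕ l) (l ⊕ l) F) : ℂ := by
  classical
  exact
    if h : ∃ (q : GL l F × Matrix l l F × Fˣ × Matrix (l ⊕ l) (l ⊕ l) F),
        q.2.2.2 ∈ K ∧ g = parabolicElt q.1 q.2.1 q.2.2.1 * x * q.2.2.2 then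
      let d : Fˣ := h.choose.2.2.1⁻¹ ^ n * Matrix.GeneralLinearGroup.det h.choose.1
      (χ d : ℂ) * ((‖(d : F)‖ : ℝ) : ℂ) ^ e * w h.choose.2.2.2
    else 0

end Sections

/-- The index type of size `2n`; matrices indexed by `Idx n ⊕ Idx n` have size `4n`. -/
abbrev Idx (n : ℕ) : Type := Fin n ⊕ Fin n

/-- The symplectic matrix `Q_n` of size `4n`, with rows (in blocks of size `n`)
`[1,0,0,0]`, `[0,0,0,1]`, `[0,0,1,1]`, `[1,-1,0,0]`. -/
def Qmat (n : ℕ) (R : Type) [CommRing R] : Matrix (Idx n ⊕ Idx n) (Idx n ⊕ Idx n) R :=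
  fromBlocks (fromBlocks 1 0 0 0) (fromBlocks 0 0 0 1) (fromBlocks 0 0 1 (-1)) (fromBlocks 1 1 0 0)

section Global

variable (n k N : ℕ) (χ : IdeleClassChar) (s : ℂ)

/-- The exponent of `|d(p)|` in `δ_P(p)^{s + 1/2}`, where `δ_P(p) = |d(p)|^{2n+1}`. -/
def modExponent : ℂ := (2 * n + 1) * (s + 1 / 2)

/-- The local section at the prime `p`: for `p ∤ N` the spherical one with value `1` at the
identity; for `p ∣ N` the one supported on `P(ℚ_p) Q_n Γ(p^m)`, `m = v_p(N)`, right invariant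
under `Γ(p^m)` and with value `1` at `Q_n`. -/
def sectionP (p : Nat.Primes) :
    Matrix (Idx n ⊕ Idx n) (Idx n ⊕ Idx n) ℚ_[p] → ℂ :=
  if (p : ℕ) ∣ N then
    localSection n (χ.loc p) (modExponent n s) (Qmat n ℚ_[p])
      ((fun γ => γ.map (algebraMap ℤ_[p] ℚ_[p])) ''
        principalCongruence (Idx n) ℤ_[p] (((p : ℕ) : ℤ_[p]) ^ padicValNat p N)) (fun _ => 1)
  else
    localSection n (χ.loc p) (modExponent n s) 1
      ((fun γ : GL (Idx n ⊕ Idx n) ℤ_[p] =>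
          (γ : Matrix (Idx n ⊕ Idx n) (Idx n ⊕ Idx n) ℤ_[p]).map (algebraMap ℤ_[p] ℚ_[p])) ''
        (GSp (Idx n) ℤ_[p] : Set (GL (Idx n ⊕ Idx n) ℤ_[p]))) (fun _ => 1)

/-- The local section at the real place: `f(pκ) = χ_∞(d(p)) |d(p)|^{(2n+1)(s+1/2)} j(κ, i)^{-k}` for
`p ∈ P(ℝ)` and `κ` in the standard maximal compact subgroup `Sp(ℝ) ∩ O(4n)`. -/
def sectionInfty : Matrix (Idx n ⊕ Idx n) (Idx n ⊕ Idx n) ℝ → ℂ :=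
  localSection n χ.arch (modExponent n s) 1
    {κ | κ ∈ symplecticGroup (Idx n) ℝ ∧ κ * κᵀ = 1}
    (fun κ => (autFactor κ (basePoint (Idx n)) ^ k)⁻¹)

/-- The coset space `P(ℚ) \ GSp_{4n}(ℚ)`. -/
abbrev Cosets : Type := Quotient (QuotientGroup.rightRel (siegelParabolic (Idx n) ℚ))

/-- The value `f(γ g, s)` of the global section `f = ⊗ f_v` for `γ ∈ GSp_{4n}(ℚ)`, embedded
diagonally, and `g ∈ Sp_{4n}(ℝ)`, embedded at the real place. -/
def globalSection (γ : GSp (Idx n) ℚ) (g : Matrix (Idx n ⊕ Idx n) (Idx n ⊕ Idx n) ℝ) : ℂ :=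
  sectionInfty n k χ s
      (((γ : GL (Idx n ⊕ Idx n) ℚ) : Matrix (Idx n ⊕ Idx n) (Idx n ⊕ Idx n) ℚ).map
        (algebraMap ℚ ℝ) * g) *
    ∏ᶠ p : Nat.Primes, sectionP n N χ s p
      (((γ : GL (Idx n ⊕ Idx n) ℚ) : Matrix (Idx n ⊕ Idx n) (Idx n ⊕ Idx n) ℚ).map
        (algebraMap ℚ ℚ_[p]))

/-- The terms of the Eisenstein series `E(g, s, f) = ∑_{γ ∈ P(ℚ) \ GSp_{4n}(ℚ)} f(γ g, s)`.
As `f` is left invariant under `P(ℚ)`, the representative of the coset does not matter. -/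
def eisTerm (g : Matrix (Idx n ⊕ Idx n) (Idx n ⊕ Idx n) ℝ) (c : Cosets n) : ℂ :=
  globalSection n k N χ s c.out g

/-- The Eisenstein series `E(g, s, f)` in its domain of absolute convergence. -/
def eisSeries (g : Matrix (Idx n ⊕ Idx n) (Idx n ⊕ Idx n) ℝ) : ℂ :=
  ∑' c : Cosets n, eisTerm n k N χ s g c

/-- The change of variable `s ↦ 2s/(2n+1) + k/(2n+1) - 1/2`. -/
def adelicParam : ℂ := 2 * s / (2 * n + 1) + k / (2 * n + 1) - 1 / 2

/-- An element `g ∈ Sp(ℝ)` with `g(i) = Z` (it exists for every `Z` in the half space). -/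
def liftPoint {l : Type} [Fintype l] [DecidableEq l] (Z : Matrix l l ℂ) :
    Matrix (l ⊕ l) (l ⊕ l) ℝ := by
  classical
  exact if h : ∃ g ∈ symplecticGroup l ℝ, moebius g (basePoint l) = Z then h.choose else 1

/-- `E_{k,N}^χ(Z, s) = j(g, i)^k E(g, 2s/(2n+1) + k/(2n+1) - 1/2, f)`, where `g ∈ Sp_{4n}(ℝ)` is
any element with `g(i) = Z`. -/
def classicalEis (Z : Matrix (Idx n) (Idx n) ℂ) : ℂ :=
  autFactor (liftPoint Z) (basePoint (Idx n)) ^ k *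
    eisSeries n k N χ (adelicParam n k s) (liftPoint Z)

end Global

end SiegelEis

end

/-!
The series is compared, term by term, with the Siegel series over symmetric matrices over `ℚ/ℤ`.

Put `E = k - 2m`, so that `E ≥ 2n + 2` in the range of the theorem. At the point in question the
sections transform by `χ(d) |d|^E`. As `χ_∞ = sgn^k`, the archimedean section is
`(v^n / j)^k (|j| / |v|^n)^(2m)`, where `v` is the similitude factor and `j` the automorphy factor at
the base point (`sectionInfty_eq`). With `|j(γ, Z)|² det (Im Z)⁻¹ = j(γ, Z)² det (Y⁻¹ - 2i W)`, where
`Y = Im Z` and `W = (CZ + D)⁻¹C` is holomorphic in `Z` (`norm_sq_autFactor_mul_inv_det`), the term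
that belongs to the coset of `γ` becomes `a_γ j(γ, Z)^(-E) det (Y⁻¹ - 2i W)^m` for a constant `a_γ`
(`autFactor_pow_mul_eisTerm`). This is a polynomial in the entries of `Y⁻¹` with holomorphic
coefficients, and for `m = 0` it is holomorphic.

Absolute convergence. After exchanging some of the coordinates of the lower half `(C, D)` of `γ`, the
determinant of `C` is comparable with `j(γ, i)` (`exists_swap_norm_le`). Then the symmetric rational
matrix `R = C⁻¹D` has bounded entries, and it determines the coset together with the set of exchanged
coordinates (`exists_isCoord`, `IsCoord.mk_eq`). So the cosets embed into a finite set times the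
symmetric matrices over `ℚ/ℤ` (`exists_coordMap`). If the columns of `M` span `ℤ^{2n} + R ℤ^{2n}`,
then `C M` is, up to the parabolic part of `γ`, integral at every prime, which bounds the section at
`p` by `|v^n / (det C det M)|_p^E` (`norm_sectionP_le`); here `χ_p` is unitary (`norm_loc`). By the
product formula the term at the base point is at most `|det M|^E`, and `|det M|⁻¹` is at least the
order `ν(R)` of the subgroup of `(ℚ/ℤ)^{2n}` generated by the rows of `R` (`exists_denominator`,
`norm_matSection_one_le`). The series `∑ ν(R)^(-E)` over symmetric `R` of size `d` converges for
`E ≥ d + 2` (`siegelSeries_lt_top`). This is shown by induction on `d`: adding a row `b` and a corner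
entry `c` multiplies `ν` by at least the order of `b` modulo the old rows, times the order of an
element of the form `t c - β` (`le_rowDenom_succ`).

Holomorphy. Locally uniformly in `Z`, the factor `j(γ, i) / j(γ, Z)` and the entries of `W` are
bounded independently of `γ` (`eventually_norm_autFactor_le`). Hence the coefficient series converge
normally, and their sums are holomorphic (`isHolomorphic_tsum_coeffTerm`).

Modularity. The product of the finite sections is right invariant under `Γ(N)`
(`matSection_mul_right`), so reindexing the cosets gives `eisSeries_mul_left`; the expression in `Z`
found above shows that the value does not depend on the element that maps the base point to `Z`
(`classicalEis_eq`).
-/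

noncomputable section

set_option linter.unusedSectionVars false

namespace SiegelEis

/-! ### The Siegel series of symmetric matrices over `ℚ/ℤ` -/

section SiegelSeries

open ENNReal

/-- The group `ℚ/ℤ`. -/
abbrev QmodZ : Type := AddCircle (1 : ℚ)

lemma QmodZ.isOfFinAddOrder (x : QmodZ) : IsOfFinAddOrder x := by
  obtain ⟨q, rfl⟩ := QuotientAddGroup.mk_surjective x
  rw [← addOrderOf_pos_iff]
  have := AddCircle.addOrderOf_coe_rat (p := (1 : ℚ)) (q := q)
  simp only [Rat.cast_id, mul_one] at this
  change 0 < addOrderOf (q : AddCircle (1 : ℚ))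
  rw [this]
  exact q.den_pos

lemma QmodZ.isOfFinAddOrder_pi {ι : Type} [Finite ι] (x : ι → QmodZ) : IsOfFinAddOrder x := by
  cases nonempty_fintype ι
  rw [isOfFinAddOrder_iff_nsmul_eq_zero]
  refine ⟨∏ i, addOrderOf (x i), Finset.prod_pos fun i _ => (QmodZ.isOfFinAddOrder (x i)).addOrderOf_pos,
    funext fun i => ?_⟩
  rw [Pi.smul_apply, Pi.zero_apply, ← addOrderOf_dvd_iff_nsmul_eq_zero]
  exact Finset.dvd_prod_of_mem _ (Finset.mem_univ i)

lemma QmodZ.encard_nsmul_eq_le {n : ℕ} (hn : n ≠ 0) (a : QmodZ) :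
    {c : QmodZ | n • c = a}.encard ≤ n := by
  rcases Set.eq_empty_or_nonempty {c : QmodZ | n • c = a} with h | ⟨c₀, h₀⟩
  · simp [h]
  · refine le_trans ?_ (AddCircle.card_torsion_le_of_isSMulRegular (1 : ℚ) n hn
      (.of_right_eq_zero_of_smul fun _ ↦ by simp [hn]))
    rw [Set.mem_ofPred_eq] at h₀
    refine Set.encard_le_encard_of_injOn (f := fun c => c - c₀) (fun c hc => ?_)
      (sub_left_injective.injOn)
    rw [Set.mem_ofPred_eq] at hc ⊢
    rw [smul_sub, hc, h₀, sub_self]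

lemma QmodZ.encard_pi_nsmul_eq_le {ι : Type} [Fintype ι] {n : ℕ} (hn : n ≠ 0) (a : ι → QmodZ) :
    {c : ι → QmodZ | n • c = a}.encard ≤ ((n ^ Fintype.card ι : ℕ) : ℕ∞) := by
  have : {c : ι → QmodZ | n • c = a} = Set.univ.pi fun i => {c : QmodZ | n • c = a i} := by
    ext c
    simp [funext_iff]
  rw [this, Set.encard_pi_eq_prod_encard]
  refine (Finset.prod_le_prod' fun i _ => QmodZ.encard_nsmul_eq_le hn (a i)).trans ?_
  simp [Finset.prod_const]

lemma tsum_indicator_eq_encard {α : Type*} (s : Set α) [DecidablePred (· ∈ s)] :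
    ∑' a, (if a ∈ s then (1 : ℝ≥0∞) else 0) = s.encard := by
  classical
  rw [← ENNReal.tsum_set_one, tsum_subtype s (fun _ => (1 : ℝ≥0∞))]
  refine tsum_congr fun a => ?_
  by_cases h : a ∈ s <;> simp [h]

open Classical in
/-- A sum of inverse powers of orders of elements is controlled by the numbers of elements whose
order divides a given integer. -/
lemma tsum_addOrderOf_inv_pow_le {α A : Type*} [AddGroup A] (f : α → A)
    (hf : ∀ a, IsOfFinAddOrder (f a)) (e : ℕ) :
    ∑' a, ((addOrderOf (f a) : ℝ≥0∞)⁻¹) ^ e ≤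
      ∑' n : ℕ, (((n + 1 : ℕ) : ℝ≥0∞)⁻¹) ^ e * ({a | (n + 1) • f a = 0}.encard : ℝ≥0∞) := by
  calc ∑' a, ((addOrderOf (f a) : ℝ≥0∞)⁻¹) ^ e
      ≤ ∑' a, ∑' n : ℕ, (((n + 1 : ℕ) : ℝ≥0∞)⁻¹) ^ e *
          (if a ∈ {a | (n + 1) • f a = 0} then 1 else 0) := by
        refine ENNReal.tsum_le_tsum fun a => ?_
        refine le_trans ?_ (ENNReal.le_tsum (addOrderOf (f a) - 1))
        have h := (hf a).addOrderOf_pos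
        have h1 : addOrderOf (f a) - 1 + 1 = addOrderOf (f a) := by omega
        rw [h1, if_pos (by rw [Set.mem_ofPred_eq]; exact addOrderOf_nsmul_eq_zero _), mul_one]
    _ = _ := by
        rw [ENNReal.tsum_comm]
        refine tsum_congr fun n => ?_
        rw [ENNReal.tsum_mul_left, tsum_indicator_eq_encard]

/-- The subgroup of `(ℚ/ℤ)^κ` generated by the rows of `R`. -/
def rowGroup {ι κ : Type} (R : ι → κ → QmodZ) : AddSubgroup (κ → QmodZ) :=
  AddSubgroup.closure (Set.range R)

instance finite_rowGroup {ι κ : Type} [Finite ι] [Finite κ] (R : ι → κ → QmodZ) :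
    Finite (rowGroup R) := by
  have : AddGroup.FG (rowGroup R) := by
    rw [rowGroup]
    exact (AddGroup.fg_iff_addSubgroup_fg _).2 ⟨(Set.finite_range R).toFinset, by simp⟩
  refine AddCommGroup.finite_of_fg_isAddTorsion _ ?_
  intro x
  exact AddSubmonoid.isOfFinAddOrder_coe.1 (QmodZ.isOfFinAddOrder_pi (x : κ → QmodZ))

/-- The order of the subgroup of `(ℚ/ℤ)^κ` generated by the rows of `R`: the denominator of `R`. -/
def rowDenom {ι κ : Type} (R : ι → κ → QmodZ) : ℕ := Nat.card (rowGroup R)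

lemma rowDenom_pos {ι κ : Type} [Finite ι] [Finite κ] (R : ι → κ → QmodZ) : 0 < rowDenom R :=
  Nat.card_pos

/-- Symmetric matrices over `ℚ/ℤ`. -/
abbrev SymQmodZ (ι : Type) : Type := {R : ι → ι → QmodZ // ∀ i j, R i j = R j i}

/-- The Siegel series `∑_R ν(R)^{-e}` over the symmetric matrices over `ℚ/ℤ`. -/
def siegelSeries (ι : Type) (e : ℕ) : ℝ≥0∞ := ∑' R : SymQmodZ ι, ((rowDenom R.1 : ℝ≥0∞)⁻¹) ^ e

section Step

variable {d : ℕ}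

/-- Decomposition of a symmetric matrix into its first row and the complementary block. -/
def symSplit (R : SymQmodZ (Fin (d + 1))) : SymQmodZ (Fin d) × (Fin d → QmodZ) × QmodZ :=
  (⟨fun i j => R.1 i.succ j.succ, fun _ _ => R.2 _ _⟩, fun i => R.1 0 i.succ, R.1 0 0)

lemma symSplit_injective : Function.Injective (symSplit (d := d)) := by
  intro R S h
  simp only [symSplit, Prod.mk.injEq, Subtype.mk.injEq] at h
  obtain ⟨h1, h2, h3⟩ := h
  refine Subtype.ext (funext fun i => funext fun j => ?_)
  refine Fin.cases ?_ (fun i => ?_) i <;> refine Fin.cases ?_ (fun j => ?_) j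
  · exact h3
  · exact congrFun h2 j
  · rw [R.2, S.2]; exact congrFun h2 i
  · exact congrFun (congrFun h1 i) j

/-- Forgetting the first coordinate. -/
def tailHom : (Fin (d + 1) → QmodZ) →+ (Fin d → QmodZ) where
  toFun x := Fin.tail x
  map_zero' := rfl
  map_add' _ _ := rfl

lemma map_tailHom_rowGroup (R' : Fin d → Fin d → QmodZ) (b : Fin d → QmodZ) :
    (rowGroup fun i => (Fin.cons (b i) (R' i) : Fin (d + 1) → QmodZ)).map tailHom = rowGroup R' := by
  rw [rowGroup, rowGroup, AddMonoidHom.map_closure, ← Set.range_comp]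
  congr 2

/-- The order of `b` modulo the subgroup generated by the rows of `R'`. -/
def relOrder (R' : Fin d → Fin d → QmodZ) (b : Fin d → QmodZ) : ℕ :=
  addOrderOf (QuotientAddGroup.mk b : (Fin d → QmodZ) ⧸ rowGroup R')

lemma relOrder_fin (R' : Fin d → Fin d → QmodZ) (b : Fin d → QmodZ) :
    IsOfFinAddOrder (QuotientAddGroup.mk b : (Fin d → QmodZ) ⧸ rowGroup R') :=
  (QuotientAddGroup.mk' (rowGroup R')).isOfFinAddOrder (QmodZ.isOfFinAddOrder_pi b)

lemma exists_lift_relOrder (R' : Fin d → Fin d → QmodZ) (b : Fin d → QmodZ) :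
    ∃ h ∈ rowGroup fun i => (Fin.cons (b i) (R' i) : Fin (d + 1) → QmodZ),
      tailHom h = relOrder R' b • b := by
  have h1 : relOrder R' b • b ∈ rowGroup R' := by
    have := addOrderOf_nsmul_eq_zero (QuotientAddGroup.mk b : (Fin d → QmodZ) ⧸ rowGroup R')
    rw [← QuotientAddGroup.mk_nsmul, QuotientAddGroup.eq_zero_iff] at this
    exact this
  rw [← map_tailHom_rowGroup R' b] at h1
  obtain ⟨h, h2, h3⟩ := h1
  exact ⟨h, h2, h3⟩

/-- The first coordinate of a chosen element of the group generated by the rows `(b i, R' i)` whose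
other coordinates are `t b`, where `t` is the order of `b` modulo the rows of `R'`. -/
def relShift (R' : Fin d → Fin d → QmodZ) (b : Fin d → QmodZ) : QmodZ :=
  (exists_lift_relOrder R' b).choose 0

/-- Passing from size `d` to size `d + 1`, the denominator gains at least the order `t` of the new
row `b` modulo the old rows, times the order of the element of the kernel of the projection to the
last `d` coordinates that the relation `t b ∈ rowGroup R'` produces. -/
lemma le_rowDenom_succ (R : SymQmodZ (Fin (d + 1))) :
    rowDenom (symSplit R).1.1 * relOrder (symSplit R).1.1 (symSplit R).2.1 *
      addOrderOf (relOrder (symSplit R).1.1 (symSplit R).2.1 • (symSplit R).2.2 -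
        relShift (symSplit R).1.1 (symSplit R).2.1) ≤ rowDenom R.1 := by
  set R' := (symSplit R).1.1 with hR'
  set b := (symSplit R).2.1 with hb
  set c := (symSplit R).2.2 with hc
  set t := relOrder R' b with ht
  obtain ⟨hx, hxt⟩ := (exists_lift_relOrder R' b).choose_spec
  set h := (exists_lift_relOrder R' b).choose with hh
  have hβ : relShift R' b = h 0 := rfl
  set w := addOrderOf (t • c - relShift R' b) with hw
  have hrows : (fun i => (Fin.cons (b i) (R' i) : Fin (d + 1) → QmodZ)) = fun i => R.1 i.succ := by
    funext i j
    refine Fin.cases ?_ (fun j => ?_) j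
    · exact R.2 0 i.succ
    · rfl
  have hsub : rowGroup (fun i => (Fin.cons (b i) (R' i) : Fin (d + 1) → QmodZ)) ≤ rowGroup R.1 := by
    rw [hrows]
    refine AddSubgroup.closure_mono ?_
    rintro _ ⟨i, rfl⟩
    exact ⟨i.succ, rfl⟩
  have h0 : R.1 0 ∈ rowGroup R.1 := AddSubgroup.subset_closure ⟨0, rfl⟩
  have h0t : tailHom (R.1 0) = b := rfl
  have hlift : ∀ g : rowGroup R', ∃ x ∈ rowGroup R.1, tailHom x = g := by
    rintro ⟨g, hg⟩
    rw [← map_tailHom_rowGroup R' b] at hg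
    obtain ⟨x, h1, h2⟩ := hg
    exact ⟨x, hsub h1, h2⟩
  choose lift hl1 hl2 using hlift
  let z : Fin (d + 1) → QmodZ := t • R.1 0 - h
  have hz : z ∈ rowGroup R.1 := sub_mem (nsmul_mem h0 t) (hsub hx)
  have hzt : tailHom z = 0 := by
    simp only [z, map_sub, map_nsmul, h0t]
    rw [hxt, ← ht, sub_self]
  have hz0 : z 0 = t • c - relShift R' b := rfl
  -- The elements `x + i r + j z` with `x` in a set of representatives of `rowGroup R'`, `r` the first
  -- row of `R`, `i < t` and `j < w` are distinct: modulo `rowGroup R'` the tail determines `i`, then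
  -- the tail determines `x`, and the first coordinate determines `j`.
  have hcard : Nat.card (rowGroup R' × Fin t × Fin w) ≤ Nat.card (rowGroup R.1) := by
    refine Nat.card_le_card_of_injective
      (fun x => (⟨lift x.1 + x.2.1.1 • R.1 0 + x.2.2.1 • z,
        add_mem (add_mem (hl1 _) (nsmul_mem h0 _)) (nsmul_mem hz _)⟩ : rowGroup R.1)) ?_
    rintro ⟨g, i, j⟩ ⟨g', i', j'⟩ heq
    have heq : lift g + i.1 • R.1 0 + j.1 • z = lift g' + i'.1 • R.1 0 + j'.1 • z := by
      simpa using heq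
    have h1 := congrArg tailHom heq
    simp only [map_add, map_nsmul, hl2, h0t, hzt, smul_zero, add_zero] at h1
    have h2 := congrArg (QuotientAddGroup.mk (s := rowGroup R')) h1
    have hg : (QuotientAddGroup.mk (g : Fin d → QmodZ) : (Fin d → QmodZ) ⧸ rowGroup R') = 0 :=
      (QuotientAddGroup.eq_zero_iff _).2 g.2
    have hg' : (QuotientAddGroup.mk (g' : Fin d → QmodZ) : (Fin d → QmodZ) ⧸ rowGroup R') = 0 :=
      (QuotientAddGroup.eq_zero_iff _).2 g'.2
    rw [QuotientAddGroup.mk_add, QuotientAddGroup.mk_add, hg, hg', zero_add, zero_add,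
      QuotientAddGroup.mk_nsmul, QuotientAddGroup.mk_nsmul] at h2
    have hi : i = i' := Fin.ext (nsmul_injOn_Iio_addOrderOf i.2 i'.2 h2)
    subst hi
    have hgg : g = g' := Subtype.ext (add_right_cancel h1)
    subst hgg
    have h3 := congrFun (add_left_cancel heq) 0
    rw [Pi.smul_apply, Pi.smul_apply, hz0] at h3
    have hj : j = j' := Fin.ext (nsmul_injOn_Iio_addOrderOf j.2 j'.2 h3)
    rw [hj]
  rw [Nat.card_prod, Nat.card_prod, Nat.card_fin, Nat.card_fin, ← mul_assoc] at hcard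
  exact hcard

end Step

lemma tsum_inv_sq_lt_top : ∑' n : ℕ, (((n + 1 : ℕ) : ℝ≥0∞)⁻¹) ^ 2 < ∞ := by
  have h : Summable fun n : ℕ => (((n + 1 : ℕ) : ℝ) ^ 2)⁻¹ :=
    (summable_nat_add_iff 1).2 (Real.summable_nat_pow_inv.2 one_lt_two)
  have h2 : ∀ n : ℕ, (((n + 1 : ℕ) : ℝ≥0∞)⁻¹) ^ 2 = ENNReal.ofReal ((((n + 1 : ℕ) : ℝ) ^ 2)⁻¹) := by
    intro n
    rw [ENNReal.ofReal_inv_of_pos (by positivity), ENNReal.ofReal_pow (by positivity),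
      ENNReal.ofReal_natCast, ENNReal.inv_pow]
  simp_rw [h2]
  exact h.tsum_ofReal_lt_top

/-- Powers `n^{a-b}` with `b ≥ a + 2` are at most `n^{-2}`. -/
lemma inv_pow_mul_pow_le (n : ℕ) {a b : ℕ} (h : a + 2 ≤ b) :
    (((n + 1 : ℕ) : ℝ≥0∞)⁻¹) ^ b * ((n + 1 : ℕ) : ℝ≥0∞) ^ a ≤ (((n + 1 : ℕ) : ℝ≥0∞)⁻¹) ^ 2 := by
  obtain ⟨c, rfl⟩ := Nat.exists_eq_add_of_le h
  have h1 : ((n + 1 : ℕ) : ℝ≥0∞)⁻¹ ≤ 1 := by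
    rw [ENNReal.inv_le_one]; exact_mod_cast Nat.le_add_left 1 n
  have h2 : (((n + 1 : ℕ) : ℝ≥0∞)⁻¹) * ((n + 1 : ℕ) : ℝ≥0∞) = 1 :=
    ENNReal.inv_mul_cancel (by simp) (by simp)
  calc _ = (((n + 1 : ℕ) : ℝ≥0∞)⁻¹ * ((n + 1 : ℕ) : ℝ≥0∞)) ^ a * (((n + 1 : ℕ) : ℝ≥0∞)⁻¹) ^ 2 *
        (((n + 1 : ℕ) : ℝ≥0∞)⁻¹) ^ c := by ring
    _ ≤ _ := by
        rw [h2, one_pow, one_mul]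
        exact mul_le_of_le_one_right' (pow_le_one' h1 c)

/-- The equations `w (t c - β) = 0` in `c` have at most `w t` solutions in `ℚ/ℤ`. -/
lemma tsum_order_shift_le {e t : ℕ} (he : 3 ≤ e) (ht : t ≠ 0) (β : QmodZ) :
    ∑' c : QmodZ, ((addOrderOf (t • c - β) : ℝ≥0∞)⁻¹) ^ e ≤
      t * ∑' n : ℕ, (((n + 1 : ℕ) : ℝ≥0∞)⁻¹) ^ 2 := by
  refine (tsum_addOrderOf_inv_pow_le _ (fun c => QmodZ.isOfFinAddOrder _) e).trans ?_
  rw [← ENNReal.tsum_mul_left]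
  refine ENNReal.tsum_le_tsum fun n => ?_
  have h1 : {c : QmodZ | (n + 1) • (t • c - β) = 0}.encard ≤ (((n + 1) * t : ℕ) : ℕ∞) := by
    refine le_trans (le_of_eq ?_) (QmodZ.encard_nsmul_eq_le (by positivity) ((n + 1) • β))
    congr 1
    ext c
    rw [Set.mem_ofPred_eq, Set.mem_ofPred_eq, smul_sub, sub_eq_zero, mul_smul]
  calc _ ≤ (((n + 1 : ℕ) : ℝ≥0∞)⁻¹) ^ e * (((n + 1) * t : ℕ) : ℝ≥0∞) := by
        gcongr
        exact_mod_cast ENat.toENNReal_le.2 h1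
    _ = t * ((((n + 1 : ℕ) : ℝ≥0∞)⁻¹) ^ e * ((n + 1 : ℕ) : ℝ≥0∞) ^ 1) := by push_cast; ring
    _ ≤ _ := by gcongr; exact inv_pow_mul_pow_le n (by omega)

/-- The orders of vectors modulo the rows of `R'`: the condition `w b ∈ rowGroup R'` has at most
`w^d ν(R')` solutions `b`. -/
lemma tsum_relOrder_le {d e : ℕ} (he : d + 2 ≤ e) (R' : Fin d → Fin d → QmodZ) :
    ∑' b : Fin d → QmodZ, ((relOrder R' b : ℝ≥0∞)⁻¹) ^ e ≤
      rowDenom R' * ∑' n : ℕ, (((n + 1 : ℕ) : ℝ≥0∞)⁻¹) ^ 2 := by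
  classical
  refine (tsum_addOrderOf_inv_pow_le _ (relOrder_fin R') e).trans ?_
  rw [← ENNReal.tsum_mul_left]
  refine ENNReal.tsum_le_tsum fun n => ?_
  have h1 : ({b : Fin d → QmodZ | (n + 1) •
      (QuotientAddGroup.mk b : (Fin d → QmodZ) ⧸ rowGroup R') = 0}.encard : ℝ≥0∞) ≤
      rowDenom R' * ((n + 1 : ℕ) : ℝ≥0∞) ^ d := by
    rw [← tsum_indicator_eq_encard]
    calc _ ≤ ∑' b : Fin d → QmodZ, ∑' g : rowGroup R',
          (if b ∈ {b : Fin d → QmodZ | (n + 1) • b = g.1} then (1 : ℝ≥0∞) else 0) := by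
          refine ENNReal.tsum_le_tsum fun b => ?_
          split_ifs with hb
          · rw [Set.mem_ofPred_eq, ← QuotientAddGroup.mk_nsmul, QuotientAddGroup.eq_zero_iff] at hb
            refine le_trans ?_ (ENNReal.le_tsum ⟨_, hb⟩)
            rw [if_pos (by rw [Set.mem_ofPred_eq])]
          · exact zero_le
      _ = ∑' g : rowGroup R', ({b : Fin d → QmodZ | (n + 1) • b = g.1}.encard : ℝ≥0∞) := by
          rw [ENNReal.tsum_comm]
          exact tsum_congr fun g => tsum_indicator_eq_encard _
      _ ≤ ∑' g : rowGroup R', (((n + 1) ^ d : ℕ) : ℝ≥0∞) := by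
          refine ENNReal.tsum_le_tsum fun g => ?_
          have := QmodZ.encard_pi_nsmul_eq_le (n := n + 1) (by omega) g.1
          rw [Fintype.card_fin] at this
          exact_mod_cast ENat.toENNReal_le.2 this
      _ = _ := by
          have := Fintype.ofFinite (rowGroup R')
          rw [tsum_fintype, Finset.sum_const, Finset.card_univ, rowDenom, Nat.card_eq_fintype_card,
            nsmul_eq_mul, Nat.cast_pow]
  calc _ ≤ (((n + 1 : ℕ) : ℝ≥0∞)⁻¹) ^ e * (rowDenom R' * ((n + 1 : ℕ) : ℝ≥0∞) ^ d) := by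
        gcongr
    _ = rowDenom R' * ((((n + 1 : ℕ) : ℝ≥0∞)⁻¹) ^ e * ((n + 1 : ℕ) : ℝ≥0∞) ^ d) := by ring
    _ ≤ _ := by gcongr; exact inv_pow_mul_pow_le n he

/-- The induction step for the Siegel series. By `le_rowDenom_succ` the sum over the corner entry
costs a factor `t` and the sum over the new row a factor `ν(R')`; each is paid for by one of the
`e + 1` powers at hand. -/
lemma siegelSeries_succ_le {d e : ℕ} (he : d + 2 ≤ e) :
    siegelSeries (Fin (d + 1)) (e + 1) ≤
      (∑' n : ℕ, (((n + 1 : ℕ) : ℝ≥0∞)⁻¹) ^ 2) ^ 2 * siegelSeries (Fin d) e := by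
  set ζ := ∑' n : ℕ, (((n + 1 : ℕ) : ℝ≥0∞)⁻¹) ^ 2 with hζ
  let F : SymQmodZ (Fin d) × (Fin d → QmodZ) × QmodZ → ℝ≥0∞ := fun x =>
    ((rowDenom x.1.1 : ℝ≥0∞)⁻¹) ^ (e + 1) * (((relOrder x.1.1 x.2.1 : ℝ≥0∞)⁻¹) ^ (e + 1) *
      ((addOrderOf (relOrder x.1.1 x.2.1 • x.2.2 - relShift x.1.1 x.2.1) : ℝ≥0∞)⁻¹) ^ (e + 1))
  have hinv : ∀ m : ℕ, 0 < m → ((m : ℝ≥0∞)⁻¹) ^ (e + 1) * m = ((m : ℝ≥0∞)⁻¹) ^ e := by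
    intro m hm
    rw [pow_succ, mul_assoc, ENNReal.inv_mul_cancel (by simpa using hm.ne') (by simp), mul_one]
  calc siegelSeries (Fin (d + 1)) (e + 1) ≤ ∑' R : SymQmodZ (Fin (d + 1)), F (symSplit R) := by
        refine ENNReal.tsum_le_tsum fun R => ?_
        simp only [F]
        rw [← mul_pow, ← mul_pow, ← ENNReal.mul_inv (by simp) (by simp),
          ← ENNReal.mul_inv (.inr (ENNReal.mul_ne_top (by simp) (by simp))) (.inl (by simp)), ← mul_assoc]
        gcongr
        exact_mod_cast le_rowDenom_succ R
    _ ≤ ∑' x, F x := ENNReal.tsum_comp_le_tsum_of_injective symSplit_injective F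
    _ = ∑' R' : SymQmodZ (Fin d), ∑' b : Fin d → QmodZ, ∑' c : QmodZ, F (R', b, c) := by
        rw [ENNReal.tsum_prod']
        exact tsum_congr fun _ => ENNReal.tsum_prod'
    _ ≤ ∑' R' : SymQmodZ (Fin d), ζ ^ 2 * ((rowDenom R'.1 : ℝ≥0∞)⁻¹) ^ e := by
        refine ENNReal.tsum_le_tsum fun R' => ?_
        simp only [F, ENNReal.tsum_mul_left]
        calc _ ≤ ((rowDenom R'.1 : ℝ≥0∞)⁻¹) ^ (e + 1) * ∑' b : Fin d → QmodZ,
              ((relOrder R'.1 b : ℝ≥0∞)⁻¹) ^ (e + 1) * (relOrder R'.1 b * ζ) := by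
              gcongr with b
              exact tsum_order_shift_le (by omega) (relOrder_fin R'.1 b).addOrderOf_pos.ne' _
          _ = ((rowDenom R'.1 : ℝ≥0∞)⁻¹) ^ (e + 1) * ((∑' b : Fin d → QmodZ,
              ((relOrder R'.1 b : ℝ≥0∞)⁻¹) ^ e) * ζ) := by
              rw [← ENNReal.tsum_mul_right]
              congr 1
              refine tsum_congr fun b => ?_
              rw [← mul_assoc, hinv (relOrder R'.1 b) (relOrder_fin R'.1 b).addOrderOf_pos]
          _ ≤ ((rowDenom R'.1 : ℝ≥0∞)⁻¹) ^ (e + 1) * ((rowDenom R'.1 * ζ) * ζ) := by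
              gcongr
              exact tsum_relOrder_le he R'.1
          _ = ζ ^ 2 * (((rowDenom R'.1 : ℝ≥0∞)⁻¹) ^ (e + 1) * rowDenom R'.1) := by ring
          _ = _ := by rw [hinv _ (rowDenom_pos _)]
    _ = _ := by rw [ENNReal.tsum_mul_left, siegelSeries]

lemma siegelSeries_fin_lt_top : ∀ {d e : ℕ}, d + 2 ≤ e → siegelSeries (Fin d) e < ∞
  | 0, e, _ => by
    have : Finite (SymQmodZ (Fin 0)) := inferInstance
    have := Fintype.ofFinite (SymQmodZ (Fin 0))
    rw [siegelSeries, tsum_fintype]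
    refine ENNReal.sum_lt_top.2 fun R _ => ENNReal.pow_lt_top ?_
    rw [ENNReal.inv_lt_top]
    exact_mod_cast rowDenom_pos R.1
  | d + 1, 0, h => by omega
  | d + 1, e + 1, h => by
    refine (siegelSeries_succ_le (by omega)).trans_lt ?_
    exact ENNReal.mul_lt_top (ENNReal.pow_lt_top tsum_inv_sq_lt_top)
      (siegelSeries_fin_lt_top (by omega))

/-- The denominator does not depend on the names of rows and columns. -/
lemma rowDenom_reindex {ι κ : Type} (σ : κ ≃ ι) (R : ι → ι → QmodZ) :
    rowDenom (fun i j => R (σ i) (σ j)) = rowDenom R := by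
  let φ : (ι → QmodZ) ≃+ (κ → QmodZ) :=
    { (Equiv.arrowCongr σ.symm (Equiv.refl QmodZ)) with map_add' := fun _ _ => rfl }
  have : rowGroup (fun i j => R (σ i) (σ j)) = (rowGroup R).map (φ : (ι → QmodZ) →+ (κ → QmodZ)) := by
    rw [rowGroup, rowGroup, AddMonoidHom.map_closure, ← Set.range_comp]
    congr 1
    ext x
    constructor
    · rintro ⟨i, rfl⟩
      exact ⟨σ i, rfl⟩
    · rintro ⟨i, rfl⟩
      refine ⟨σ.symm i, ?_⟩
      funext j
      change R (σ (σ.symm i)) (σ j) = R i (σ j)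
      rw [σ.apply_symm_apply]
  rw [rowDenom, rowDenom, this]
  exact (Nat.card_congr ((rowGroup R).equivMapOfInjective (φ : (ι → QmodZ) →+ (κ → QmodZ))
    φ.injective).toEquiv).symm

/-- Convergence of the Siegel series for `e ≥ d + 2`. -/
theorem siegelSeries_lt_top {ι : Type} [Fintype ι] {e : ℕ} (h : Fintype.card ι + 2 ≤ e) :
    siegelSeries ι e < ∞ := by
  refine lt_of_le_of_lt ?_ (siegelSeries_fin_lt_top h)
  let σ := (Fintype.equivFin ι).symm
  let f : SymQmodZ ι → SymQmodZ (Fin (Fintype.card ι)) := fun R =>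
    ⟨fun i j => R.1 (σ i) (σ j), fun i j => R.2 _ _⟩
  have hf : Function.Injective f := by
    intro R S hRS
    refine Subtype.ext (funext fun i => funext fun j => ?_)
    have := congrFun (congrFun (congrArg Subtype.val hRS) (σ.symm i)) (σ.symm j)
    simpa [f] using this
  refine le_trans (le_of_eq ?_) (ENNReal.tsum_comp_le_tsum_of_injective hf _)
  refine tsum_congr fun R => ?_
  rw [← rowDenom_reindex σ R.1]

end SiegelSeries

/-! ### Symplectic similitudes -/

section Similitudes

variable {l : Type} [Fintype l] [DecidableEq l] {R S : Type} [CommRing R] [CommRing S]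

/-- `g` is a symplectic similitude with factor `v`. -/
def IsSimil (g : Matrix (l ⊕ l) (l ⊕ l) R) (v : R) : Prop := gᵀ * J l R * g = v • J l R

lemma IsSimil.mul {g h : Matrix (l ⊕ l) (l ⊕ l) R} {v w : R} (hg : IsSimil g v)
    (hh : IsSimil h w) : IsSimil (g * h) (v * w) := by
  unfold IsSimil at *
  calc _ = hᵀ * (gᵀ * J l R * g) * h := by simp only [transpose_mul, Matrix.mul_assoc]
    _ = _ := by rw [hg, Matrix.mul_smul, Matrix.smul_mul, hh, smul_smul]

lemma IsSimil.map {g : Matrix (l ⊕ l) (l ⊕ l) R} {v : R} (hg : IsSimil g v) (f : R →+* S) :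
    IsSimil (g.map f) (f v) := by
  unfold IsSimil at *
  have h := congrArg (fun M : Matrix (l ⊕ l) (l ⊕ l) R => M.map f) hg
  simp only [Matrix.map_mul] at h
  rw [← transpose_map, ← map_J l f, h]
  ext i j
  simp only [Matrix.map_apply, Matrix.smul_apply, smul_eq_mul, map_mul]

lemma isSimil_one_iff {g : Matrix (l ⊕ l) (l ⊕ l) R} : IsSimil g 1 ↔ g ∈ symplecticGroup l R := by
  rw [SymplecticGroup.mem_iff', IsSimil, one_smul]

lemma isSimil_one : IsSimil (1 : Matrix (l ⊕ l) (l ⊕ l) R) 1 := by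
  simp [IsSimil]

lemma isSimil_of_blocks {A B C D : Matrix l l R} {v : R} (h1 : Aᵀ * C = Cᵀ * A)
    (h2 : Bᵀ * D = Dᵀ * B) (h3 : Aᵀ * D - Cᵀ * B = v • 1) : IsSimil (fromBlocks A B C D) v := by
  have h4 : Dᵀ * A - Bᵀ * C = v • 1 := by
    have := congrArg transpose h3
    simpa using this
  rw [IsSimil, J, fromBlocks_transpose, fromBlocks_multiply, fromBlocks_multiply, fromBlocks_smul]
  simp only [Matrix.mul_zero, Matrix.mul_one, Matrix.mul_neg, Matrix.neg_mul, zero_add, add_zero,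
    smul_zero, smul_neg]
  rw [fromBlocks_inj]
  refine ⟨?_, ?_, ?_, ?_⟩
  · rw [h1]; abel
  · rw [← h3]; abel
  · rw [← h4]; abel
  · rw [h2]; abel

/-- The relations between the blocks that express `ᵗg J g = v J`. -/
lemma IsSimil.blocks {g : Matrix (l ⊕ l) (l ⊕ l) R} {v : R} (hg : IsSimil g v) :
    g.toBlocks₁₁ᵀ * g.toBlocks₂₁ = g.toBlocks₂₁ᵀ * g.toBlocks₁₁ ∧
    g.toBlocks₁₂ᵀ * g.toBlocks₂₂ = g.toBlocks₂₂ᵀ * g.toBlocks₁₂ ∧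
    g.toBlocks₁₁ᵀ * g.toBlocks₂₂ - g.toBlocks₂₁ᵀ * g.toBlocks₁₂ = v • 1 ∧
    g.toBlocks₂₂ᵀ * g.toBlocks₁₁ - g.toBlocks₁₂ᵀ * g.toBlocks₂₁ = v • 1 := by
  rw [IsSimil, ← fromBlocks_toBlocks g, J, fromBlocks_transpose, fromBlocks_multiply,
    fromBlocks_multiply, fromBlocks_smul] at hg
  simp only [Matrix.mul_zero, Matrix.mul_one, Matrix.mul_neg, Matrix.neg_mul, zero_add, add_zero,
    smul_zero, smul_neg] at hg
  obtain ⟨h1, h2, h3, h4⟩ := fromBlocks_inj.1 hg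
  refine ⟨?_, ?_, ?_, ?_⟩
  · rw [← sub_eq_zero, ← neg_eq_zero, ← h1]; abel
  · rw [← sub_eq_zero, ← neg_eq_zero, ← h4]; abel
  · rw [← neg_inj, ← h2]; abel
  · rw [← h3]; abel

/-- The matrix `v g⁻¹` for a similitude `g` with factor `v`. -/
def simAdj (g : Matrix (l ⊕ l) (l ⊕ l) R) : Matrix (l ⊕ l) (l ⊕ l) R :=
  fromBlocks g.toBlocks₂₂ᵀ (-g.toBlocks₁₂ᵀ) (-g.toBlocks₂₁ᵀ) g.toBlocks₁₁ᵀ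

lemma IsSimil.simAdj_mul {g : Matrix (l ⊕ l) (l ⊕ l) R} {v : R} (hg : IsSimil g v) :
    simAdj g * g = v • 1 := by
  obtain ⟨h1, h2, h3, h4⟩ := hg.blocks
  conv_lhs => rw [← fromBlocks_toBlocks g]
  rw [simAdj, toBlocks_fromBlocks₁₁, toBlocks_fromBlocks₁₂, toBlocks_fromBlocks₂₁,
    toBlocks_fromBlocks₂₂, fromBlocks_multiply, ← fromBlocks_one, fromBlocks_smul]
  simp only [Matrix.neg_mul, smul_zero]
  rw [fromBlocks_inj]
  refine ⟨?_, ?_, ?_, ?_⟩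
  · rw [← h4]; abel
  · rw [h2]; abel
  · rw [h1]; abel
  · rw [← h3]; abel

lemma IsSimil.mul_simAdj {g : Matrix (l ⊕ l) (l ⊕ l) R} {v : R} (hg : IsSimil g v)
    (hv : IsUnit v) : g * simAdj g = v • 1 := by
  obtain ⟨u, rfl⟩ := hv
  have h : (((u⁻¹ : Rˣ) : R) • simAdj g) * g = 1 := by
    rw [Matrix.smul_mul, hg.simAdj_mul, smul_smul, Units.inv_mul, one_smul]
  have h2 := mul_eq_one_comm.1 h
  rw [Matrix.mul_smul] at h2
  rw [← h2, smul_smul, Units.mul_inv, one_smul]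

/-- The relations between the blocks that express `g J ᵗg = v J`. -/
lemma IsSimil.blocks' {g : Matrix (l ⊕ l) (l ⊕ l) R} {v : R} (hg : IsSimil g v) (hv : IsUnit v) :
    g.toBlocks₂₁ * g.toBlocks₂₂ᵀ = g.toBlocks₂₂ * g.toBlocks₂₁ᵀ ∧
    g.toBlocks₁₁ * g.toBlocks₁₂ᵀ = g.toBlocks₁₂ * g.toBlocks₁₁ᵀ ∧
    g.toBlocks₂₂ * g.toBlocks₁₁ᵀ - g.toBlocks₂₁ * g.toBlocks₁₂ᵀ = v • 1 := by
  have h := hg.mul_simAdj hv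
  conv_lhs at h => rw [← fromBlocks_toBlocks g]
  rw [simAdj, toBlocks_fromBlocks₁₁, toBlocks_fromBlocks₁₂, toBlocks_fromBlocks₂₁,
    toBlocks_fromBlocks₂₂, fromBlocks_multiply, ← fromBlocks_one, fromBlocks_smul] at h
  simp only [Matrix.mul_neg, smul_zero] at h
  obtain ⟨h1, h2, h3, h4⟩ := fromBlocks_inj.1 h
  refine ⟨?_, ?_, ?_⟩
  · rw [← sub_eq_zero, ← h3]; abel
  · rw [← sub_eq_zero, ← neg_eq_zero, ← h2]; abel
  · rw [← h4]; abel

lemma IsSimil.simAdj {g : Matrix (l ⊕ l) (l ⊕ l) R} {v : R} (hg : IsSimil g v) (hv : IsUnit v) :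
    IsSimil (simAdj g) v := by
  obtain ⟨h1, h2, h3⟩ := hg.blocks' hv
  refine isSimil_of_blocks ?_ ?_ ?_
  · simp only [transpose_neg, transpose_transpose, Matrix.mul_neg, Matrix.neg_mul]
    rw [← h1]
  · simp only [transpose_neg, transpose_transpose, Matrix.mul_neg, Matrix.neg_mul]
    rw [← h2]
  · simp only [transpose_neg, transpose_transpose, Matrix.mul_neg, Matrix.neg_mul, neg_neg]
    exact h3

end Similitudes

section Parabolic

variable {l : Type} [Fintype l] [DecidableEq l] {F : Type} [NormedField F]

lemma parabolicElt_mul (A A' : GL l F) (X X' : Matrix l l F) (v v' : Fˣ) :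
    parabolicElt A X v * parabolicElt A' X' v' =
      parabolicElt (A * A') ((A : Matrix l l F) * X' + (v' : F) • (X * ((A'⁻¹ : GL l F) : Matrix l l F)ᵀ))
        (v * v') := by
  rw [parabolicElt, parabolicElt, parabolicElt, fromBlocks_multiply]
  congr 1
  · simp
  · simp
  · simp
  · simp only [Matrix.zero_mul, zero_add, Matrix.smul_mul, Matrix.mul_smul, smul_smul,
      _root_.mul_inv_rev, Units.val_mul, transpose_mul]
    rw [mul_comm]

/-- A similitude with vanishing lower left block is of the form `[A, X; 0, v ᵗA⁻¹]`. -/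
lemma exists_parabolicElt {g : Matrix (l ⊕ l) (l ⊕ l) F} {v : Fˣ} (hg : IsSimil g (v : F))
    (h0 : g.toBlocks₂₁ = 0) : ∃ A : GL l F, g = parabolicElt A g.toBlocks₁₂ v := by
  obtain ⟨-, -, h3, -⟩ := hg.blocks
  rw [h0, transpose_zero, Matrix.zero_mul, sub_zero] at h3
  have h4 : g.toBlocks₁₁ᵀ * ((v⁻¹ : Fˣ) : F) • g.toBlocks₂₂ = 1 := by
    rw [Matrix.mul_smul, h3, smul_smul, Units.inv_mul, one_smul]
  have h5 : g.toBlocks₁₁ * (((v⁻¹ : Fˣ) : F) • g.toBlocks₂₂)ᵀ = 1 := by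
    have := congrArg transpose (mul_eq_one_comm.1 h4)
    rwa [transpose_mul, transpose_transpose, transpose_one] at this
  refine ⟨⟨g.toBlocks₁₁, (((v⁻¹ : Fˣ) : F) • g.toBlocks₂₂)ᵀ, h5, mul_eq_one_comm.1 h5⟩, ?_⟩
  conv_lhs => rw [← fromBlocks_toBlocks g, h0]
  rw [parabolicElt]
  congr 1
  change _ = (v : F) • ((((v⁻¹ : Fˣ) : F) • g.toBlocks₂₂)ᵀ)ᵀ
  rw [transpose_transpose, smul_smul, Units.mul_inv, one_smul]

@[simp] lemma parabolicElt_toBlocks₂₁ (A : GL l F) (X : Matrix l l F) (v : Fˣ) :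
    (parabolicElt A X v).toBlocks₂₁ = 0 := rfl

@[simp] lemma parabolicElt_toBlocks₂₂ (A : GL l F) (X : Matrix l l F) (v : Fˣ) :
    (parabolicElt A X v).toBlocks₂₂ = (v : F) • ((A⁻¹ : GL l F) : Matrix l l F)ᵀ := rfl

lemma parabolicElt_inv_mul (A : GL l F) (X : Matrix l l F) (v : Fˣ) :
    parabolicElt A⁻¹ (-((v⁻¹ : Fˣ) : F) • (((A⁻¹ : GL l F) : Matrix l l F) * X * (A : Matrix l l F)ᵀ)) v⁻¹ *
      parabolicElt A X v = 1 := by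
  have h : ((A : Matrix l l F)ᵀ * ((A⁻¹ : GL l F) : Matrix l l F)ᵀ) = 1 := by
    rw [← transpose_mul, ← Units.val_mul, inv_mul_cancel, Units.val_one, transpose_one]
  rw [parabolicElt_mul, parabolicElt, ← fromBlocks_one]
  congr 1
  · simp
  · rw [Matrix.smul_mul, smul_smul, Matrix.mul_assoc, h, Matrix.mul_one]
    simp
  · simp

end Parabolic

lemma toBlocks₂₁_mul {l R : Type} [Fintype l] [CommRing R] (g h : Matrix (l ⊕ l) (l ⊕ l) R) :
    (g * h).toBlocks₂₁ = g.toBlocks₂₁ * h.toBlocks₁₁ + g.toBlocks₂₂ * h.toBlocks₂₁ := by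
  conv_lhs => rw [← fromBlocks_toBlocks g, ← fromBlocks_toBlocks h, fromBlocks_multiply,
    toBlocks_fromBlocks₂₁]

lemma toBlocks₂₂_mul {l R : Type} [Fintype l] [CommRing R] (g h : Matrix (l ⊕ l) (l ⊕ l) R) :
    (g * h).toBlocks₂₂ = g.toBlocks₂₁ * h.toBlocks₁₂ + g.toBlocks₂₂ * h.toBlocks₂₂ := by
  conv_lhs => rw [← fromBlocks_toBlocks g, ← fromBlocks_toBlocks h, fromBlocks_multiply,
    toBlocks_fromBlocks₂₂]

lemma toBlocks₁₁_mul {l R : Type} [Fintype l] [CommRing R] (g h : Matrix (l ⊕ l) (l ⊕ l) R) :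
    (g * h).toBlocks₁₁ = g.toBlocks₁₁ * h.toBlocks₁₁ + g.toBlocks₁₂ * h.toBlocks₂₁ := by
  conv_lhs => rw [← fromBlocks_toBlocks g, ← fromBlocks_toBlocks h, fromBlocks_multiply,
    toBlocks_fromBlocks₁₁]

lemma toBlocks₁₂_mul {l R : Type} [Fintype l] [CommRing R] (g h : Matrix (l ⊕ l) (l ⊕ l) R) :
    (g * h).toBlocks₁₂ = g.toBlocks₁₁ * h.toBlocks₁₂ + g.toBlocks₁₂ * h.toBlocks₂₂ := by
  conv_lhs => rw [← fromBlocks_toBlocks g, ← fromBlocks_toBlocks h, fromBlocks_multiply,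
    toBlocks_fromBlocks₁₂]

/-! ### The action of symplectic similitudes on the Siegel upper half space -/

section HalfSpaceAction

open scoped ComplexOrder MatrixOrder

variable {l : Type} [Fintype l] [DecidableEq l]

/-- A real matrix, regarded as a complex one. -/
abbrev cplx {m n : Type} (M : Matrix m n ℝ) : Matrix m n ℂ := M.map Complex.ofReal

lemma cplx_mul {m n o : Type} [Fintype n] (M : Matrix m n ℝ) (N : Matrix n o ℝ) :
    cplx (M * N) = cplx M * cplx N :=
  Matrix.map_mul (f := Complex.ofRealHom)

lemma cplx_add {m n : Type} (M N : Matrix m n ℝ) : cplx (M + N) = cplx M + cplx N := by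
  ext i j; simp

lemma cplx_smul {m n : Type} (a : ℝ) (M : Matrix m n ℝ) : cplx (a • M) = (a : ℂ) • cplx M := by
  ext i j; simp

lemma cplx_one : cplx (1 : Matrix l l ℝ) = 1 := by
  ext i j; by_cases h : i = j <;> simp [h, Matrix.one_apply]

lemma cplx_conjTranspose {m n : Type} (M : Matrix m n ℝ) : (cplx M)ᴴ = cplx Mᵀ := by
  ext i j; simp [conjTranspose_apply]

lemma cplx_transpose {m n : Type} (M : Matrix m n ℝ) : (cplx M)ᵀ = cplx Mᵀ := rfl

lemma cplx_injective {m n : Type} : Function.Injective (cplx : Matrix m n ℝ → Matrix m n ℂ) :=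
  fun M N h => by
    ext i j
    have := congrFun (congrFun h i) j
    simpa using this

lemma cplx_det (M : Matrix l l ℝ) : (cplx M).det = (M.det : ℂ) :=
  (RingHom.map_det Complex.ofRealHom M).symm

lemma posSemidef_cplx {Y : Matrix l l ℝ} (h : Y.PosSemidef) : (cplx Y).PosSemidef := by
  obtain ⟨B, rfl⟩ := CStarAlgebra.nonneg_iff_eq_star_mul_self.mp h.nonneg
  rw [star_eq_conjTranspose, cplx_mul, conjTranspose_eq_transpose_of_trivial, ← cplx_conjTranspose]
  exact posSemidef_conjTranspose_mul_self _

lemma posDef_cplx {Y : Matrix l l ℝ} (h : Y.PosDef) : (cplx Y).PosDef := by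
  rw [(posSemidef_cplx h.posSemidef).posDef_iff_det_ne_zero, cplx_det]
  exact_mod_cast h.det_pos.ne'

lemma posDef_of_cplx {Y : Matrix l l ℝ} (h : (cplx Y).PosDef) : Y.PosDef := by
  rw [posDef_iff_dotProduct_mulVec] at h ⊢
  refine ⟨?_, fun {x} hx => ?_⟩
  · apply cplx_injective
    rw [conjTranspose_eq_transpose_of_trivial, ← cplx_conjTranspose]
    exact h.1
  · have hx' : (fun i => (x i : ℂ)) ≠ 0 := fun h0 => hx <| funext fun i => by
      simpa using congrFun h0 i
    have h2 := h.2 hx'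
    have h3 : star (fun i => (x i : ℂ)) ⬝ᵥ (cplx Y *ᵥ fun i => (x i : ℂ)) =
        ((star x ⬝ᵥ (Y *ᵥ x) : ℝ) : ℂ) := by
      simp [dotProduct, mulVec]
    rw [h3] at h2
    exact_mod_cast h2

/-- The matrix `AZ + B`. -/
def numer (g : Matrix (l ⊕ l) (l ⊕ l) ℝ) (Z : Matrix l l ℂ) : Matrix l l ℂ :=
  cplx g.toBlocks₁₁ * Z + cplx g.toBlocks₁₂

lemma denom_mul (g h : Matrix (l ⊕ l) (l ⊕ l) ℝ) (Z : Matrix l l ℂ) :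
    denom (g * h) Z = cplx g.toBlocks₂₁ * numer h Z + cplx g.toBlocks₂₂ * denom h Z := by
  simp only [denom, numer]
  change cplx _ * Z + cplx _ = _
  rw [toBlocks₂₁_mul, toBlocks₂₂_mul, cplx_add, cplx_add, cplx_mul, cplx_mul, cplx_mul, cplx_mul]
  noncomm_ring

lemma numer_mul (g h : Matrix (l ⊕ l) (l ⊕ l) ℝ) (Z : Matrix l l ℂ) :
    numer (g * h) Z = cplx g.toBlocks₁₁ * numer h Z + cplx g.toBlocks₁₂ * denom h Z := by
  simp only [denom, numer]
  rw [toBlocks₁₁_mul, toBlocks₁₂_mul, cplx_add, cplx_add, cplx_mul, cplx_mul, cplx_mul, cplx_mul]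
  noncomm_ring

lemma moebius_mul_denom {h : Matrix (l ⊕ l) (l ⊕ l) ℝ} {Z : Matrix l l ℂ}
    (hu : IsUnit (denom h Z).det) : moebius h Z * denom h Z = numer h Z := by
  rw [moebius, Matrix.mul_assoc, nonsing_inv_mul _ hu, Matrix.mul_one]
  rfl

lemma denom_mul' (g : Matrix (l ⊕ l) (l ⊕ l) ℝ) {h : Matrix (l ⊕ l) (l ⊕ l) ℝ} {Z : Matrix l l ℂ}
    (hu : IsUnit (denom h Z).det) :
    denom (g * h) Z = denom g (moebius h Z) * denom h Z := by
  rw [denom_mul, ← moebius_mul_denom hu]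
  change _ = (cplx _ * _ + cplx _) * _
  rw [Matrix.add_mul, Matrix.mul_assoc]

/-- The cocycle relation. -/
lemma autFactor_mul (g : Matrix (l ⊕ l) (l ⊕ l) ℝ) {h : Matrix (l ⊕ l) (l ⊕ l) ℝ}
    {Z : Matrix l l ℂ} (hu : IsUnit (denom h Z).det) :
    autFactor (g * h) Z = autFactor g (moebius h Z) * autFactor h Z := by
  rw [autFactor, denom_mul' g hu, det_mul]
  rfl

lemma moebius_mul (g : Matrix (l ⊕ l) (l ⊕ l) ℝ) {h : Matrix (l ⊕ l) (l ⊕ l) ℝ}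
    {Z : Matrix l l ℂ} (hu : IsUnit (denom h Z).det) :
    moebius (g * h) Z = moebius g (moebius h Z) := by
  have h1 : numer (g * h) Z = numer g (moebius h Z) * denom h Z := by
    rw [numer_mul, ← moebius_mul_denom hu, numer, Matrix.add_mul, Matrix.mul_assoc]
  change numer (g * h) Z * (denom (g * h) Z)⁻¹ = numer g _ * (denom g _)⁻¹
  rw [h1, denom_mul' g hu, Matrix.mul_inv_rev, Matrix.mul_assoc, ← Matrix.mul_assoc (denom h Z),
    mul_nonsing_inv _ hu, Matrix.one_mul]

/-- The symplectic form evaluated on the columns of `g (Z₁, 1)` and `g (Z, 1)`. With `Z₁ = Z` it gives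
the symmetry of `gZ`, with `Z₁ = Z̄` the transformation of the imaginary part. -/
lemma IsSimil.pairing {R : Type} [CommRing R] {G : Matrix (l ⊕ l) (l ⊕ l) R} {v : R}
    (hG : IsSimil G v) (Z₁ Z : Matrix l l R) :
    (Z₁ * G.toBlocks₁₁ᵀ + G.toBlocks₁₂ᵀ) * (G.toBlocks₂₁ * Z + G.toBlocks₂₂) -
      (Z₁ * G.toBlocks₂₁ᵀ + G.toBlocks₂₂ᵀ) * (G.toBlocks₁₁ * Z + G.toBlocks₁₂) = v • (Z₁ - Z) := by
  obtain ⟨h1, h2, h3, h4⟩ := hG.blocks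
  have e : (Z₁ * G.toBlocks₁₁ᵀ + G.toBlocks₁₂ᵀ) * (G.toBlocks₂₁ * Z + G.toBlocks₂₂) -
      (Z₁ * G.toBlocks₂₁ᵀ + G.toBlocks₂₂ᵀ) * (G.toBlocks₁₁ * Z + G.toBlocks₁₂) =
      Z₁ * (G.toBlocks₁₁ᵀ * G.toBlocks₂₁ - G.toBlocks₂₁ᵀ * G.toBlocks₁₁) * Z +
      Z₁ * (G.toBlocks₁₁ᵀ * G.toBlocks₂₂ - G.toBlocks₂₁ᵀ * G.toBlocks₁₂) -
      (G.toBlocks₂₂ᵀ * G.toBlocks₁₁ - G.toBlocks₁₂ᵀ * G.toBlocks₂₁) * Z +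
      (G.toBlocks₁₂ᵀ * G.toBlocks₂₂ - G.toBlocks₂₂ᵀ * G.toBlocks₁₂) := by noncomm_ring
  rw [e, h3, h4, h1, h2, sub_self, sub_self, Matrix.mul_zero, Matrix.zero_mul, zero_add, add_zero,
    Matrix.mul_smul, Matrix.mul_one, Matrix.smul_mul, Matrix.one_mul, smul_sub]

lemma IsSimil.cplx {g : Matrix (l ⊕ l) (l ⊕ l) ℝ} {v : ℝ} (hg : IsSimil g v) :
    IsSimil (SiegelEis.cplx g) (v : ℂ) := hg.map Complex.ofRealHom

lemma pairing_conj {g : Matrix (l ⊕ l) (l ⊕ l) ℝ} {v : ℝ} (hg : IsSimil g v) (Z : Matrix l l ℂ) :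
    (numer g Z)ᴴ * denom g Z - (denom g Z)ᴴ * numer g Z = (v : ℂ) • (Zᴴ - Z) := by
  rw [← hg.cplx.pairing Zᴴ Z, numer, denom, conjTranspose_add, conjTranspose_add, conjTranspose_mul,
    conjTranspose_mul]
  rw [cplx_conjTranspose, cplx_conjTranspose, cplx_conjTranspose, cplx_conjTranspose]
  rfl

lemma pairing_transpose {g : Matrix (l ⊕ l) (l ⊕ l) ℝ} {v : ℝ} (hg : IsSimil g v)
    {Z : Matrix l l ℂ} (hZ : Zᵀ = Z) :
    (numer g Z)ᵀ * denom g Z = (denom g Z)ᵀ * numer g Z := by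
  rw [← sub_eq_zero]
  have := hg.cplx.pairing Zᵀ Z
  rw [hZ, sub_self, smul_zero] at this
  rw [← this, numer, denom, transpose_add, transpose_add, transpose_mul, transpose_mul, hZ]
  rfl

lemma sub_conjTranspose_eq {Z : Matrix l l ℂ} (hZ : Zᵀ = Z) :
    Z - Zᴴ = (2 * Complex.I) • cplx (Z.map Complex.im) := by
  ext i j
  have h : Z j i = Z i j := congrFun (congrFun hZ i) j
  simp only [Matrix.sub_apply, conjTranspose_apply, Matrix.smul_apply, Matrix.map_apply, smul_eq_mul,
    h]
  apply Complex.ext <;> simp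
  ring

/-- `CZ + D` is invertible for every `Z` in the half space and every similitude. -/
lemma isUnit_denom {g : Matrix (l ⊕ l) (l ⊕ l) ℝ} {v : ℝ} (hg : IsSimil g v) (hv : v ≠ 0)
    {Z : Matrix l l ℂ} (hZ : Z ∈ upperHalfSpace l) : IsUnit (denom g Z).det := by
  rw [isUnit_iff_ne_zero]
  intro h0
  obtain ⟨x, hx, hx0⟩ := exists_mulVec_eq_zero_iff.2 h0
  have h1 := congrArg (fun M : Matrix l l ℂ => star x ⬝ᵥ M *ᵥ x) (pairing_conj hg Z)
  have h2 : Zᴴ - Z = -((2 * Complex.I) • cplx (Z.map Complex.im)) := by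
    rw [← sub_conjTranspose_eq hZ.1, neg_sub]
  have h3 : star x ᵥ* (denom g Z)ᴴ = 0 := by
    rw [← star_mulVec, hx0, star_zero]
  simp only [sub_mulVec, ← mulVec_mulVec, hx0, mulVec_zero, zero_sub, dotProduct_neg] at h1
  rw [dotProduct_mulVec, h3, zero_dotProduct, neg_zero, h2, smul_neg, smul_smul, neg_mulVec,
    smul_mulVec, dotProduct_neg, dotProduct_smul, smul_eq_mul] at h1
  have h4 := (posDef_iff_dotProduct_mulVec.1 (posDef_cplx hZ.2)).2 hx
  have h5 : (v : ℂ) * (2 * Complex.I) ≠ 0 := by simp [hv, Complex.I_ne_zero]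
  exact (neg_ne_zero.2 (mul_ne_zero h5 h4.ne')) h1.symm

lemma transpose_moebius {g : Matrix (l ⊕ l) (l ⊕ l) ℝ} {v : ℝ} (hg : IsSimil g v)
    {Z : Matrix l l ℂ} (hZ : Zᵀ = Z) (hu : IsUnit (denom g Z).det) :
    (moebius g Z)ᵀ = moebius g Z := by
  have hu' : IsUnit (denom g Z)ᵀ.det := by rwa [det_transpose]
  have h1 : (denom g Z)ᵀ * (moebius g Z)ᵀ * denom g Z = (denom g Z)ᵀ * moebius g Z * denom g Z := by
    rw [← transpose_mul, moebius_mul_denom hu, pairing_transpose hg hZ, Matrix.mul_assoc,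
      moebius_mul_denom hu]
  have h2 := congrArg (fun M => (denom g Z)ᵀ⁻¹ * M * (denom g Z)⁻¹) h1
  simp only [Matrix.mul_assoc, mul_nonsing_inv _ hu, Matrix.mul_one] at h2
  rw [← Matrix.mul_assoc, ← Matrix.mul_assoc, nonsing_inv_mul _ hu', Matrix.one_mul,
    Matrix.one_mul] at h2
  exact h2

/-- The transformation law of the imaginary part. -/
lemma conj_denom_mul_im {g : Matrix (l ⊕ l) (l ⊕ l) ℝ} {v : ℝ} (hg : IsSimil g v)
    {Z : Matrix l l ℂ} (hZ : Zᵀ = Z) (hu : IsUnit (denom g Z).det) :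
    (denom g Z)ᴴ * cplx ((moebius g Z).map Complex.im) * denom g Z =
      (v : ℂ) • cplx (Z.map Complex.im) := by
  have h1 := pairing_conj hg Z
  rw [← moebius_mul_denom hu, conjTranspose_mul] at h1
  have h2 : (denom g Z)ᴴ * (moebius g Z - (moebius g Z)ᴴ) * denom g Z = (v : ℂ) • (Z - Zᴴ) := by
    rw [← neg_sub Zᴴ Z, smul_neg, ← h1]
    noncomm_ring
  rw [sub_conjTranspose_eq hZ, sub_conjTranspose_eq (transpose_moebius hg hZ hu), Matrix.mul_smul,
    Matrix.smul_mul, smul_comm (v : ℂ)] at h2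
  exact smul_right_injective _ (by simp [Complex.I_ne_zero] : (2 * Complex.I) ≠ 0) h2

lemma moebius_mem {g : Matrix (l ⊕ l) (l ⊕ l) ℝ} (hg : g ∈ symplecticGroup l ℝ)
    {Z : Matrix l l ℂ} (hZ : Z ∈ upperHalfSpace l) : moebius g Z ∈ upperHalfSpace l := by
  have hg1 := isSimil_one_iff.2 hg
  have hu := isUnit_denom hg1 one_ne_zero hZ
  refine ⟨transpose_moebius hg1 hZ.1 hu, posDef_of_cplx ?_⟩
  have h := conj_denom_mul_im hg1 hZ.1 hu
  rw [Complex.ofReal_one, one_smul] at h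
  have huu : IsUnit (denom g Z) := (isUnit_iff_isUnit_det _).2 hu
  rw [← Matrix.IsUnit.posDef_star_left_conjugate_iff huu, star_eq_conjTranspose, h]
  exact posDef_cplx hZ.2

lemma basePoint_mem : basePoint l ∈ upperHalfSpace l := by
  refine ⟨by simp [basePoint], ?_⟩
  have : (basePoint l).map Complex.im = 1 := by
    ext i j; by_cases h : i = j <;> simp [basePoint, Matrix.one_apply, h]
  rw [this]
  exact PosDef.one

lemma im_basePoint : (basePoint l).map Complex.im = 1 := by
  ext i j; by_cases h : i = j <;> simp [basePoint, Matrix.one_apply, h]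

/-- `det Im (g i) = |j(g, i)|⁻²`. -/
lemma norm_sq_autFactor_mul_det {g : Matrix (l ⊕ l) (l ⊕ l) ℝ} (hg : g ∈ symplecticGroup l ℝ) :
    ‖autFactor g (basePoint l)‖ ^ 2 * ((moebius g (basePoint l)).map Complex.im).det = 1 := by
  have hg1 := isSimil_one_iff.2 hg
  have hu := isUnit_denom hg1 one_ne_zero basePoint_mem
  have h := congrArg Matrix.det (conj_denom_mul_im hg1 basePoint_mem.1 hu)
  rw [Complex.ofReal_one, one_smul, im_basePoint, cplx_one, det_one, det_mul, det_mul,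
    det_conjTranspose, cplx_det, mul_right_comm] at h
  have h2 : star (denom g (basePoint l)).det * (denom g (basePoint l)).det =
      ((‖autFactor g (basePoint l)‖ ^ 2 : ℝ) : ℂ) := by
    rw [mul_comm]
    exact (Complex.mul_conj' _).trans (by push_cast; rfl)
  rw [h2] at h
  exact_mod_cast h

/-- Positive definite matrices are of the form `B ᵗB`. -/
lemma exists_mul_transpose_eq {Y : Matrix l l ℝ} (hY : Y.PosDef) :
    ∃ B : GL l ℝ, Y = (B : Matrix l l ℝ) * (B : Matrix l l ℝ)ᵀ := by
  obtain ⟨B, hB⟩ := CStarAlgebra.nonneg_iff_eq_star_mul_self.mp hY.posSemidef.nonneg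
  rw [star_eq_conjTranspose, conjTranspose_eq_transpose_of_trivial] at hB
  have hdet : IsUnit B.det := by
    rw [isUnit_iff_ne_zero]
    intro h0
    have := hY.det_pos
    rw [hB, det_mul, h0, mul_zero] at this
    exact lt_irrefl _ this
  refine ⟨GeneralLinearGroup.mk'' Bᵀ (by rwa [det_transpose]), ?_⟩
  change Y = Bᵀ * Bᵀᵀ
  rwa [transpose_transpose]

/-- The symplectic group acts transitively on the half space. -/
lemma exists_moebius_eq {Z : Matrix l l ℂ} (hZ : Z ∈ upperHalfSpace l) :
    ∃ g ∈ symplecticGroup l ℝ, moebius g (basePoint l) = Z := by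
  obtain ⟨B, hB⟩ := exists_mul_transpose_eq hZ.2
  set B' : Matrix l l ℝ := ((B⁻¹ : GL l ℝ) : Matrix l l ℝ) with hB'
  have hBB : (B : Matrix l l ℝ) * B' = 1 := by rw [hB', ← Units.val_mul]; simp
  have hBB' : B' * (B : Matrix l l ℝ) = 1 := by rw [hB', ← Units.val_mul]; simp
  have ht : B'ᵀ * (B : Matrix l l ℝ)ᵀ = 1 := by rw [← transpose_mul, hBB, transpose_one]
  have ht' : (B : Matrix l l ℝ)ᵀ * B'ᵀ = 1 := by rw [← transpose_mul, hBB', transpose_one]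
  set X := Z.map Complex.re with hX
  have hXt : Xᵀ = X := by
    ext i j
    have h : Z j i = Z i j := congrFun (congrFun hZ.1 i) j
    simp [hX, h]
  refine ⟨fromBlocks B (X * B'ᵀ) 0 B'ᵀ, ?_, ?_⟩
  · rw [← isSimil_one_iff]
    refine isSimil_of_blocks (by simp) ?_ ?_
    · rw [transpose_mul, hXt, transpose_transpose, Matrix.mul_assoc]
    · rw [ht', transpose_zero, Matrix.zero_mul, sub_zero, one_smul]
  · have hd : denom (fromBlocks (B : Matrix l l ℝ) (X * B'ᵀ) 0 B'ᵀ) (basePoint l) = cplx B'ᵀ := by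
      rw [denom, toBlocks_fromBlocks₂₁, toBlocks_fromBlocks₂₂]
      simp
    have h1 : cplx (B : Matrix l l ℝ)ᵀ * cplx B'ᵀ = 1 := by rw [← cplx_mul, ht', cplx_one]
    have h2 : (cplx B'ᵀ)⁻¹ = cplx (B : Matrix l l ℝ)ᵀ := inv_eq_left_inv h1
    rw [moebius, hd, h2, toBlocks_fromBlocks₁₁, toBlocks_fromBlocks₁₂]
    change (cplx (B : Matrix l l ℝ) * basePoint l + cplx (X * B'ᵀ)) * _ = _
    rw [Matrix.add_mul, ← cplx_mul, Matrix.mul_assoc X, ht, Matrix.mul_one, basePoint,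
      Matrix.mul_smul, Matrix.mul_one, Matrix.smul_mul, ← cplx_mul, ← hB]
    ext i j
    simp only [Matrix.add_apply, Matrix.smul_apply, Matrix.map_apply, smul_eq_mul, hX]
    rw [mul_comm, add_comm]
    exact Complex.re_add_im _

lemma liftPoint_spec {Z : Matrix l l ℂ} (hZ : Z ∈ upperHalfSpace l) :
    liftPoint Z ∈ symplecticGroup l ℝ ∧ moebius (liftPoint Z) (basePoint l) = Z := by
  have h := exists_moebius_eq hZ
  rw [liftPoint, dif_pos h]
  exact h.choose_spec

end HalfSpaceAction

/-! ### The symmetric matrix `(CZ + D)⁻¹ C` -/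

section LogDeriv

open scoped ComplexOrder MatrixOrder

variable {l : Type} [Fintype l] [DecidableEq l]

/-- The matrix `(CZ + D)⁻¹ C`. -/
def logDenom (g : Matrix (l ⊕ l) (l ⊕ l) ℝ) (Z : Matrix l l ℂ) : Matrix l l ℂ :=
  (denom g Z)⁻¹ * cplx g.toBlocks₂₁

lemma denom_mul_logDenom {g : Matrix (l ⊕ l) (l ⊕ l) ℝ} {Z : Matrix l l ℂ}
    (hu : IsUnit (denom g Z).det) : denom g Z * logDenom g Z = cplx g.toBlocks₂₁ := by
  rw [logDenom, ← Matrix.mul_assoc, mul_nonsing_inv _ hu, Matrix.one_mul]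

/-- The expansion of `CZ' + D` at `Z`, in terms of `(CZ + D)⁻¹C`. -/
lemma denom_add {g : Matrix (l ⊕ l) (l ⊕ l) ℝ} {Z : Matrix l l ℂ} (Z' : Matrix l l ℂ)
    (hu : IsUnit (denom g Z).det) :
    denom g Z' = denom g Z * (1 + logDenom g Z * (Z' - Z)) := by
  rw [Matrix.mul_add, Matrix.mul_one, ← Matrix.mul_assoc, denom_mul_logDenom hu, denom, denom]
  change cplx _ * _ + _ = cplx _ * _ + _ + _
  noncomm_ring

lemma transpose_logDenom {g : Matrix (l ⊕ l) (l ⊕ l) ℝ} {v : ℝ} (hg : IsSimil g v) (hv : v ≠ 0)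
    {Z : Matrix l l ℂ} (hZ : Zᵀ = Z) (hu : IsUnit (denom g Z).det) :
    (logDenom g Z)ᵀ = logDenom g Z := by
  have hu' : IsUnit (denom g Z)ᵀ.det := by rwa [det_transpose]
  have h1 : cplx g.toBlocks₂₁ * (denom g Z)ᵀ = denom g Z * (cplx g.toBlocks₂₁)ᵀ := by
    have h := congrArg cplx (hg.blocks' (isUnit_iff_ne_zero.2 hv)).1
    rw [cplx_mul, cplx_mul, ← cplx_transpose, ← cplx_transpose] at h
    rw [denom]
    change cplx _ * (cplx _ * Z + cplx _)ᵀ = (cplx _ * Z + cplx _) * _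
    rw [transpose_add, transpose_mul, hZ, Matrix.mul_add, Matrix.add_mul, h, Matrix.mul_assoc]
  rw [logDenom, transpose_mul, transpose_nonsing_inv]
  calc (cplx g.toBlocks₂₁)ᵀ * (denom g Z)ᵀ⁻¹
      = (denom g Z)⁻¹ * (denom g Z * (cplx g.toBlocks₂₁)ᵀ) * (denom g Z)ᵀ⁻¹ := by
        rw [← Matrix.mul_assoc (denom g Z)⁻¹, nonsing_inv_mul _ hu, Matrix.one_mul]
    _ = _ := by
        rw [← h1, Matrix.mul_assoc, Matrix.mul_assoc, mul_nonsing_inv _ hu', Matrix.mul_one]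

lemma denom_conj_eq {g : Matrix (l ⊕ l) (l ⊕ l) ℝ} {Z : Matrix l l ℂ} (hZ : Zᵀ = Z) :
    denom g Zᴴ = (denom g Z)ᴴᵀ := by
  have hc : ∀ M : Matrix l l ℝ, (cplx M)ᴴᵀ = cplx M := fun M => by
    rw [cplx_conjTranspose, cplx_transpose, transpose_transpose]
  have hZ' : Zᴴᵀ = Zᴴ := by rw [conjTranspose, hZ, ← transpose_map, hZ]
  rw [denom, denom, conjTranspose_add, conjTranspose_mul, transpose_add, transpose_mul, hZ']
  change cplx _ * _ + cplx _ = (cplx _)ᴴᵀ * _ + (cplx _)ᴴᵀ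
  rw [hc, hc]

/-- The relation `W (Z - Z̄) W* = W* - W` for `W = (CZ + D)⁻¹ C`. -/
lemma logDenom_conj_relation {g : Matrix (l ⊕ l) (l ⊕ l) ℝ} {v : ℝ} (hg : IsSimil g v) (hv : v ≠ 0)
    {Z : Matrix l l ℂ} (hZ : Zᵀ = Z) (hu : IsUnit (denom g Z).det) :
    logDenom g Z * (Z - Zᴴ) * (logDenom g Z)ᴴ = (logDenom g Z)ᴴ - logDenom g Z := by
  set W := logDenom g Z with hW
  set Q := denom g Z with hQ
  have hWt : Wᵀ = W := transpose_logDenom hg hv hZ hu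
  have hQW : Q * W = cplx g.toBlocks₂₁ := denom_mul_logDenom hu
  have hWc : Wᴴᵀ = Wᴴ := by rw [conjTranspose, hWt, ← transpose_map, hWt]
  have hQWc : denom g Zᴴ * Wᴴ = cplx g.toBlocks₂₁ := by
    have h := congrArg (fun M : Matrix l l ℂ => Mᴴᵀ) hQW
    simp only [cplx_conjTranspose, cplx_transpose, transpose_transpose, conjTranspose_mul,
      transpose_mul, hWc] at h
    rwa [denom_conj_eq hZ]
  have h1 : Q * (W * (Z - Zᴴ) * Wᴴ) = Q * (Wᴴ - W) := by
    rw [← Matrix.mul_assoc, ← Matrix.mul_assoc, hQW, Matrix.mul_sub Q, hQW]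
    conv_rhs => rw [← hQWc]
    rw [← Matrix.sub_mul, hQ, denom, denom]
    congr 1
    change cplx _ * _ = cplx _ * _ + _ - (cplx _ * _ + _)
    noncomm_ring
  have h2 := congrArg (fun M => Q⁻¹ * M) h1
  simp only [← Matrix.mul_assoc Q⁻¹ Q, nonsing_inv_mul _ hu, Matrix.one_mul] at h2
  exact h2

/-- The part of the half space where the imaginary part is at least `lam`. -/
def halfSpaceGE (l : Type) [Fintype l] [DecidableEq l] (lam : ℝ) : Set (Matrix l l ℂ) :=
  {Z | Zᵀ = Z ∧ (Z.map Complex.im - lam • (1 : Matrix l l ℝ)).PosSemidef}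

lemma halfSpaceGE_subset {lam : ℝ} (h : 0 < lam) : halfSpaceGE l lam ⊆ upperHalfSpace l := by
  rintro Z ⟨h1, h2⟩
  refine ⟨h1, ?_⟩
  have h3 : (lam • (1 : Matrix l l ℝ)).PosDef := PosDef.one.smul h
  have := h3.add_posSemidef h2
  simpa using this

/-- The entries of `(CZ + D)⁻¹ C` are bounded independently of `g`. -/
lemma norm_logDenom_apply_le {g : Matrix (l ⊕ l) (l ⊕ l) ℝ} {v : ℝ} (hg : IsSimil g v)
    (hv : v ≠ 0) {lam : ℝ} (hlam : 0 < lam) {Z : Matrix l l ℂ} (hZ : Z ∈ halfSpaceGE l lam)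
    (a b : l) : ‖logDenom g Z a b‖ ≤ lam⁻¹ := by
  have hZ' := halfSpaceGE_subset hlam hZ
  have hu := isUnit_denom hg hv hZ'
  set W := logDenom g Z with hW
  have h1 := logDenom_conj_relation hg hv hZ.1 hu
  rw [← hW, sub_conjTranspose_eq hZ.1] at h1
  have h2 := posSemidef_cplx hZ.2
  have h3 : cplx (Z.map Complex.im) = cplx (Z.map Complex.im - lam • (1 : Matrix l l ℝ)) +
      (lam : ℂ) • 1 := by
    rw [← cplx_one, ← cplx_smul, ← cplx_add, sub_add_cancel]
  have h4 := h2.mul_mul_conjTranspose_same W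
  have h5 : (0 : ℂ) ≤ (W * cplx (Z.map Complex.im - lam • (1 : Matrix l l ℝ)) * Wᴴ) a a :=
    h4.diag_nonneg
  rw [h3, Matrix.mul_smul, Matrix.smul_mul, Matrix.mul_add, Matrix.add_mul, Matrix.mul_smul,
    Matrix.mul_one, Matrix.smul_mul] at h1
  have h6 := congrFun (congrFun h1 a) a
  simp only [Matrix.smul_apply, Matrix.add_apply, Matrix.sub_apply, smul_eq_mul] at h6
  have h7 : (W * Wᴴ) a a = ((∑ c, ‖W a c‖ ^ 2 : ℝ) : ℂ) := by
    rw [Matrix.mul_apply, Complex.ofReal_sum]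
    refine Finset.sum_congr rfl fun c _ => ?_
    rw [conjTranspose_apply]
    exact (Complex.mul_conj' _).trans (by push_cast; rfl)
  rw [h7, conjTranspose_apply] at h6
  generalize hs : ∑ c, ‖W a c‖ ^ 2 = s at h6
  have h8 := congrArg Complex.im h6
  obtain ⟨h9, h10⟩ := Complex.nonneg_iff.1 h5
  simp [Complex.mul_im] at h8
  have h11 : lam * ∑ c, ‖W a c‖ ^ 2 ≤ ‖W a a‖ := by
    rw [hs]
    have : -(W a a).im ≤ ‖W a a‖ := (neg_le_abs _).trans (Complex.abs_im_le_norm _)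
    nlinarith
  have h12 : ∀ c, ‖W a c‖ ^ 2 ≤ ∑ c, ‖W a c‖ ^ 2 := fun c =>
    Finset.single_le_sum (f := fun c => ‖W a c‖ ^ 2) (fun _ _ => sq_nonneg _) (Finset.mem_univ c)
  have h13 : ‖W a a‖ ≤ lam⁻¹ := by
    rcases (norm_nonneg (W a a)).eq_or_lt with h0 | h0
    · rw [← h0]; positivity
    · rw [← mul_le_mul_iff_right₀ hlam, mul_inv_cancel₀ hlam.ne']
      have := (mul_le_mul_of_nonneg_left (h12 a) hlam.le).trans h11
      rw [← mul_le_mul_iff_left₀ h0]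
      linarith
  have h14 : ‖W a b‖ ^ 2 ≤ (lam⁻¹) ^ 2 := by
    rw [sq lam⁻¹, ← mul_le_mul_iff_right₀ hlam, mul_inv_cancel_left₀ hlam.ne']
    exact ((mul_le_mul_of_nonneg_left (h12 b) hlam.le).trans h11).trans h13
  exact (pow_le_pow_iff_left₀ (norm_nonneg _) (by positivity) two_ne_zero).1 h14

end LogDeriv

/-! ### The archimedean section -/

section Arch

open scoped ComplexOrder

variable {l : Type} [Fintype l] [DecidableEq l]

lemma denom_basePoint (g : Matrix (l ⊕ l) (l ⊕ l) ℝ) :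
    denom g (basePoint l) = Complex.I • cplx g.toBlocks₂₁ + cplx g.toBlocks₂₂ := by
  rw [denom, basePoint, Matrix.mul_smul, Matrix.mul_one]

lemma smul_I_add_mul_conjTranspose {C D : Matrix l l ℝ} (h : C * Dᵀ = D * Cᵀ) :
    (Complex.I • cplx C + cplx D) * (Complex.I • cplx C + cplx D)ᴴ = cplx (C * Cᵀ + D * Dᵀ) := by
  rw [conjTranspose_add, conjTranspose_smul, cplx_conjTranspose, cplx_conjTranspose, Matrix.add_mul,
    Matrix.mul_add, Matrix.mul_add, Matrix.smul_mul, Matrix.smul_mul, Matrix.mul_smul,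
    Matrix.mul_smul, ← cplx_mul, ← cplx_mul, ← cplx_mul, ← cplx_mul, h, smul_smul, cplx_add]
  simp only [Complex.star_def, Complex.conj_I, mul_neg, Complex.I_mul_I, neg_neg, one_smul, neg_smul]
  abel

/-- `|det (iC + D)|² = det (C ᵗC + D ᵗD)` for the lower half `(C, D)` of a symplectic matrix. -/
lemma norm_sq_det_smul_I_add {C D : Matrix l l ℝ} (h : C * Dᵀ = D * Cᵀ) :
    ‖(Complex.I • cplx C + cplx D).det‖ ^ 2 = (C * Cᵀ + D * Dᵀ).det := by
  have h1 := congrArg Matrix.det (smul_I_add_mul_conjTranspose h)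
  rw [det_mul, det_conjTranspose, cplx_det] at h1
  have h2 := (Complex.mul_conj' _).symm.trans h1
  exact_mod_cast h2

/-- On the maximal compact subgroup the automorphy factor at `i` is unitary: `C ᵗC + D ᵗD = 1`. -/
lemma norm_autFactor_of_orthogonal {κ : Matrix (l ⊕ l) (l ⊕ l) ℝ} (hκ : κ ∈ symplecticGroup l ℝ)
    (ho : κ * κᵀ = 1) : ‖autFactor κ (basePoint l)‖ = 1 := by
  have h1 : κ.toBlocks₂₁ * κ.toBlocks₂₁ᵀ + κ.toBlocks₂₂ * κ.toBlocks₂₂ᵀ = 1 := by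
    have h := toBlocks₂₂_mul κ κᵀ
    rw [ho, ← fromBlocks_one, toBlocks_fromBlocks₂₂] at h
    exact h.symm
  have h2 := norm_sq_det_smul_I_add ((isSimil_one_iff.2 hκ).blocks' isUnit_one).1
  rw [h1, det_one, ← denom_basePoint] at h2
  exact (pow_eq_one_iff_of_nonneg (norm_nonneg _) two_ne_zero).1 h2

/-- The Iwasawa decomposition: `κ` has lower rows `S⁻¹ (C, D)`, where `S ᵗS = C ᵗC + D ᵗD`. -/
lemma exists_iwasawa {g : Matrix (l ⊕ l) (l ⊕ l) ℝ} {v : ℝˣ} (hg : IsSimil g (v : ℝ)) :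
    ∃ (A : GL l ℝ) (X : Matrix l l ℝ) (κ : Matrix (l ⊕ l) (l ⊕ l) ℝ),
      (κ ∈ symplecticGroup l ℝ ∧ κ * κᵀ = 1) ∧ g = parabolicElt A X v * 1 * κ := by
  have hCD := (hg.blocks' v.isUnit).1
  have hu := isUnit_denom hg v.ne_zero basePoint_mem
  set C := g.toBlocks₂₁ with hC
  set D := g.toBlocks₂₂ with hD
  have hpos : (C * Cᵀ + D * Dᵀ).PosDef := by
    apply posDef_of_cplx
    rw [← smul_I_add_mul_conjTranspose hCD, hC, hD, ← denom_basePoint]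
    exact PosDef.mul_conjTranspose_self _
      (vecMul_injective_iff_isUnit.2 ((isUnit_iff_isUnit_det _).2 hu))
  obtain ⟨S, hS⟩ := exists_mul_transpose_eq hpos
  set T : Matrix l l ℝ := ((S⁻¹ : GL l ℝ) : Matrix l l ℝ) with hT
  have hTS : T * (S : Matrix l l ℝ) = 1 := by rw [hT, ← Units.val_mul]; simp
  have hST : (S : Matrix l l ℝ)ᵀ * Tᵀ = 1 := by rw [← transpose_mul, hTS, transpose_one]
  have e1 : T * C * (T * C)ᵀ + T * D * (T * D)ᵀ = 1 := by
    calc _ = T * (C * Cᵀ + D * Dᵀ) * Tᵀ := by rw [transpose_mul, transpose_mul]; noncomm_ring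
      _ = (T * (S : Matrix l l ℝ)) * ((S : Matrix l l ℝ)ᵀ * Tᵀ) := by rw [hS]; noncomm_ring
      _ = 1 := by rw [hTS, hST, Matrix.one_mul]
  have e2 : T * C * (T * D)ᵀ = T * D * (T * C)ᵀ := by
    calc _ = T * (C * Dᵀ) * Tᵀ := by rw [transpose_mul]; noncomm_ring
      _ = _ := by rw [hCD, transpose_mul]; noncomm_ring
  set κ := fromBlocks (T * D) (-(T * C)) (T * C) (T * D) with hκ
  have hκo : κ * κᵀ = 1 := by
    rw [hκ, fromBlocks_transpose, fromBlocks_multiply, ← fromBlocks_one, fromBlocks_inj]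
    simp only [transpose_neg, Matrix.neg_mul, Matrix.mul_neg, neg_neg]
    refine ⟨by rw [add_comm, e1], by rw [e2, add_neg_cancel], by rw [e2, add_neg_cancel], e1⟩
  have hκs : κ ∈ symplecticGroup l ℝ := by
    rw [SymplecticGroup.mem_iff]
    have : κ * J l ℝ = J l ℝ * κ := by
      rw [hκ, J, fromBlocks_multiply, fromBlocks_multiply]
      simp
    rw [this, Matrix.mul_assoc, hκo, Matrix.mul_one]
  have hp : IsSimil (g * κᵀ) (v : ℝ) := by
    have := hg.mul (isSimil_one_iff.2 (SymplecticGroup.transpose_mem hκs))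
    rwa [mul_one] at this
  have h0 : (g * κᵀ).toBlocks₂₁ = 0 := by
    rw [toBlocks₂₁_mul, hκ, fromBlocks_transpose, toBlocks_fromBlocks₁₁, toBlocks_fromBlocks₂₁,
      ← hC, ← hD, transpose_neg, Matrix.mul_neg, transpose_mul, transpose_mul, ← Matrix.mul_assoc,
      ← Matrix.mul_assoc, hCD, add_neg_cancel]
  obtain ⟨A, hA⟩ := exists_parabolicElt hp h0
  refine ⟨A, (g * κᵀ).toBlocks₁₂, κ, ⟨hκs, hκo⟩, ?_⟩
  rw [← hA, Matrix.mul_one, Matrix.mul_assoc, mul_eq_one_comm.1 hκo, Matrix.mul_one]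

/-- In `g = p k`, the determinant of the lower right block of `p` and the value `d(p)` are related
by `det (v ᵗA⁻¹) = v^n d(p)⁻¹`. -/
lemma det_parabolic_block {F : Type} [NormedField F] {n : ℕ} (A : GL (Idx n) F) (v : Fˣ) :
    ((v : F) • ((A⁻¹ : GL (Idx n) F) : Matrix (Idx n) (Idx n) F)ᵀ).det =
      (v : F) ^ n * ((v⁻¹ ^ n * Matrix.GeneralLinearGroup.det A : Fˣ) : F)⁻¹ := by
  have h1 : ((A⁻¹ : GL (Idx n) F) : Matrix (Idx n) (Idx n) F).det =
      ((Matrix.GeneralLinearGroup.det A : Fˣ) : F)⁻¹ := by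
    rw [← Units.val_inv_eq_inv_val, ← map_inv]; rfl
  have h2 : (v : F) ≠ 0 := v.ne_zero
  rw [det_smul, det_transpose, h1, Fintype.card_sum, Fintype.card_fin]
  push_cast
  rw [mul_inv, inv_pow, inv_inv, pow_add, mul_assoc]

variable {n k N : ℕ} {χ : IdeleClassChar} {s : ℂ}

lemma similitude_parabolicElt {l F : Type} [Fintype l] [DecidableEq l] [Nonempty l] [NormedField F]
    {A : GL l F} {X : Matrix l l F} {v : Fˣ} {w : F} (h : IsSimil (parabolicElt A X v) w) :
    (v : F) = w := by
  have h1 := h.blocks.2.2.1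
  have h2 : (A : Matrix l l F)ᵀ * ((A⁻¹ : GL l F) : Matrix l l F)ᵀ = 1 := by
    rw [← transpose_mul, ← Units.val_mul]; simp
  rw [parabolicElt, toBlocks_fromBlocks₁₁, toBlocks_fromBlocks₂₂, toBlocks_fromBlocks₂₁,
    transpose_zero, Matrix.zero_mul, sub_zero, Matrix.mul_smul, h2] at h1
  obtain ⟨i⟩ := ‹Nonempty l›
  simpa using congrFun (congrFun h1 i) i

instance nonempty_idx [NeZero n] : Nonempty (Idx n) := ⟨.inl 0⟩

/-- For `χ_∞ = sgn^k` the archimedean character `χ_∞(d) |d|^E` is `d^k |d|^{-2m}`, as `k = E + 2m`. -/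
lemma sign_pow_mul_abs_pow {d : ℝ} (hd : d ≠ 0) {k E m : ℕ} (hk : k = E + 2 * m) :
    (SignType.sign d : ℝ) ^ k * ‖d‖ ^ E = d ^ k * (‖d‖⁻¹) ^ (2 * m) := by
  have hsgn : (SignType.sign d : ℝ) * ‖d‖ = d := sign_mul_abs _
  have hnd : ‖d‖ ≠ 0 := norm_ne_zero_iff.2 hd
  conv_rhs => rw [← hsgn, norm_mul, norm_norm]
  have hsn : ‖(SignType.sign d : ℝ)‖ = 1 := by
    have := congrArg norm hsgn
    rw [norm_mul, norm_norm] at this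
    exact mul_right_cancel₀ hnd (this.trans (one_mul _).symm)
  rw [hsn, one_mul, mul_pow, mul_assoc, hk, pow_add ‖d‖ E, mul_assoc, ← mul_pow,
    mul_inv_cancel₀ hnd, one_pow, mul_one]

/-- An explicit formula for the archimedean section in terms of the automorphy factor and the
similitude. In particular its value does not depend on the decomposition `g = p κ`. -/
lemma sectionInfty_eq [NeZero n] (hχ : χ.HasTypeLevel k N) {E m : ℕ} (hk : k = E + 2 * m)
    (hs : modExponent n s = E) {g : Matrix (Idx n ⊕ Idx n) (Idx n ⊕ Idx n) ℝ} {v : ℝ}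
    (hv : v ≠ 0) (hg : IsSimil g v) :
    sectionInfty n k χ s g = ((v : ℂ) ^ n / autFactor g (basePoint (Idx n))) ^ k *
      (((‖autFactor g (basePoint (Idx n))‖ / |v| ^ n) ^ (2 * m) : ℝ) : ℂ) := by
  have hex : ∃ (q : GL (Idx n) ℝ × Matrix (Idx n) (Idx n) ℝ × ℝˣ ×
      Matrix (Idx n ⊕ Idx n) (Idx n ⊕ Idx n) ℝ),
      q.2.2.2 ∈ {κ | κ ∈ symplecticGroup (Idx n) ℝ ∧ κ * κᵀ = 1} ∧
        g = parabolicElt q.1 q.2.1 q.2.2.1 * 1 * q.2.2.2 := by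
    obtain ⟨A, X, κ, h1, h2⟩ := exists_iwasawa (v := Units.mk0 v hv) hg
    exact ⟨(A, X, Units.mk0 v hv, κ), h1, h2⟩
  rw [sectionInfty, localSection, dif_pos hex]
  obtain ⟨⟨hκs, hκo⟩, hgeq⟩ := hex.choose_spec
  set A := hex.choose.1
  set X := hex.choose.2.1
  set w := hex.choose.2.2.1
  set κ := hex.choose.2.2.2
  rw [Matrix.mul_one] at hgeq
  have hp : IsSimil (parabolicElt A X w) v := by
    have h1 := hg.mul (isSimil_one_iff.2 (SymplecticGroup.transpose_mem hκs))
    rwa [hgeq, Matrix.mul_assoc, hκo, Matrix.mul_one, mul_one] at h1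
  have hw : (w : ℝ) = v := similitude_parabolicElt hp
  have hjκ := norm_autFactor_of_orthogonal hκs hκo
  set jκ := autFactor κ (basePoint (Idx n)) with hjκ'
  simp only
  set d : ℝˣ := w⁻¹ ^ n * Matrix.GeneralLinearGroup.det A with hd
  have hj : autFactor g (basePoint (Idx n)) = (v : ℂ) ^ n * ((d : ℝ) : ℂ)⁻¹ * jκ := by
    have h1 : autFactor g (basePoint (Idx n)) =
        (cplx (parabolicElt A X w).toBlocks₂₂ * denom κ (basePoint (Idx n))).det := by
      conv_lhs => rw [hgeq]
      rw [autFactor, denom_mul, parabolicElt_toBlocks₂₁]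
      simp
    rw [h1, det_mul, cplx_det, parabolicElt_toBlocks₂₂, det_parabolic_block, hw, ← hd]
    push_cast
    rfl
  have hd0 : (d : ℝ) ≠ 0 := d.ne_zero
  have hdC : ((d : ℝ) : ℂ) ≠ 0 := by exact_mod_cast hd0
  have hvC : (v : ℂ) ≠ 0 := by exact_mod_cast hv
  have hjκ0 : jκ ≠ 0 := by
    intro h; rw [h, norm_zero] at hjκ; exact zero_ne_one hjκ
  have e1 : (v : ℂ) ^ n / autFactor g (basePoint (Idx n)) = ((d : ℝ) : ℂ) / jκ := by
    rw [hj]; field_simp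
  have e2 : ‖autFactor g (basePoint (Idx n))‖ / |v| ^ n = ‖(d : ℝ)‖⁻¹ := by
    rw [hj, norm_mul, norm_mul, hjκ, norm_pow, norm_inv, Complex.norm_real, Complex.norm_real,
      Real.norm_eq_abs]
    have : |v| ≠ 0 := abs_ne_zero.2 hv
    field_simp
  rw [e1, e2, hχ.arch_eq, hs, Complex.cpow_natCast]
  have h3 := sign_pow_mul_abs_pow hd0 hk
  have h4 : (((SignType.sign (d : ℝ) : ℝ)) : ℂ) ^ k * ((‖(d : ℝ)‖ : ℝ) : ℂ) ^ E =
      ((d : ℝ) : ℂ) ^ k * (((‖(d : ℝ)‖⁻¹) ^ (2 * m) : ℝ) : ℂ) := by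
    rw [← Complex.ofReal_pow, ← Complex.ofReal_pow, ← Complex.ofReal_pow, ← Complex.ofReal_mul,
      ← Complex.ofReal_mul, h3]
  rw [h4, div_pow]
  ring

end Arch

/-! ### The sections at the finite places -/

section Finite

variable {n k N : ℕ} {χ : IdeleClassChar} {s : ℂ}

/-- The compact open subgroup under which the section at `p` is right invariant. -/
def locK (n N : ℕ) (p : Nat.Primes) : Set (Matrix (Idx n ⊕ Idx n) (Idx n ⊕ Idx n) ℤ_[p]) :=
  {κ | if (p : ℕ) ∣ N then κ ∈ principalCongruence (Idx n) ℤ_[p] (((p : ℕ) : ℤ_[p]) ^ padicValNat p N)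
    else ∃ u : ℤ_[p]ˣ, IsSimil κ (u : ℤ_[p])}

/-- The representative of the double coset that supports the section at `p`. -/
def locX (n N : ℕ) (p : Nat.Primes) : Matrix (Idx n ⊕ Idx n) (Idx n ⊕ Idx n) ℤ_[p] :=
  if (p : ℕ) ∣ N then Qmat n ℤ_[p] else 1

/-- `p`-adically integral matrices, regarded as matrices over `ℚ_p`. -/
abbrev toQp {p : Nat.Primes} {m m' : Type} (M : Matrix m m' ℤ_[p]) : Matrix m m' ℚ_[p] :=
  M.map (algebraMap ℤ_[p] ℚ_[p])

lemma toQp_mul {p : Nat.Primes} {m m' m'' : Type} [Fintype m'] (M : Matrix m m' ℤ_[p])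
    (M' : Matrix m' m'' ℤ_[p]) : toQp (M * M') = toQp M * toQp M' :=
  Matrix.map_mul

lemma toQp_injective {p : Nat.Primes} {m m' : Type} :
    Function.Injective (toQp : Matrix m m' ℤ_[p] → Matrix m m' ℚ_[p]) :=
  Matrix.map_injective (IsFractionRing.injective ℤ_[p] ℚ_[p])

lemma toQp_one {p : Nat.Primes} {m : Type} [DecidableEq m] :
    toQp (1 : Matrix m m ℤ_[p]) = 1 := Matrix.map_one _ (map_zero _) (map_one _)

lemma isSimil_Qmat (n : ℕ) (R : Type) [CommRing R] : IsSimil (Qmat n R) 1 := by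
  refine isSimil_of_blocks ?_ ?_ ?_
  · simp [fromBlocks_transpose, fromBlocks_multiply]
  · simp [fromBlocks_transpose, fromBlocks_multiply]
  · rw [one_smul, sub_eq_iff_eq_add, ← fromBlocks_one, fromBlocks_transpose, fromBlocks_transpose,
      fromBlocks_multiply, fromBlocks_multiply, fromBlocks_add]
    simp

lemma isSimil_locX (n N : ℕ) (p : Nat.Primes) : IsSimil (locX n N p) 1 := by
  unfold locX
  split_ifs
  · exact isSimil_Qmat n _
  · exact isSimil_one

lemma dvd_sub_one_iff {m R : Type} [DecidableEq m] [CommRing R] (a : R) (γ : Matrix m m R) :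
    (∀ i j, a ∣ (γ - 1) i j) ↔ γ.map (Ideal.Quotient.mk (Ideal.span {a})) = 1 := by
  have h1 : (1 : Matrix m m (R ⧸ Ideal.span {a})) =
      (1 : Matrix m m R).map (Ideal.Quotient.mk (Ideal.span {a})) :=
    (Matrix.map_one _ (map_zero _) (map_one _)).symm
  rw [h1, ← Matrix.ext_iff]
  refine forall_congr' fun i => forall_congr' fun j => ?_
  rw [Matrix.map_apply, Matrix.map_apply, Ideal.Quotient.eq, Ideal.mem_span_singleton,
    Matrix.sub_apply]

lemma mem_locK_of_dvd {p : Nat.Primes} (h : (p : ℕ) ∣ N)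
    {κ : Matrix (Idx n ⊕ Idx n) (Idx n ⊕ Idx n) ℤ_[p]} :
    κ ∈ locK n N p ↔ IsSimil κ 1 ∧
      κ.map (Ideal.Quotient.mk (Ideal.span {((p : ℕ) : ℤ_[p]) ^ padicValNat p N})) = 1 := by
  rw [isSimil_one_iff, ← dvd_sub_one_iff]
  change (if _ then _ else _) ↔ _
  rw [if_pos h]
  rfl

lemma mem_locK_of_not_dvd {p : Nat.Primes} (h : ¬ (p : ℕ) ∣ N)
    {κ : Matrix (Idx n ⊕ Idx n) (Idx n ⊕ Idx n) ℤ_[p]} :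
    κ ∈ locK n N p ↔ ∃ u : ℤ_[p]ˣ, IsSimil κ (u : ℤ_[p]) := by
  change (if _ then _ else _) ↔ _
  rw [if_neg h]

lemma isSimil_of_mem_locK {p : Nat.Primes} {κ : Matrix (Idx n ⊕ Idx n) (Idx n ⊕ Idx n) ℤ_[p]}
    (hκ : κ ∈ locK n N p) : ∃ u : ℤ_[p]ˣ, IsSimil κ (u : ℤ_[p]) := by
  by_cases h : (p : ℕ) ∣ N
  · exact ⟨1, ((mem_locK_of_dvd h).1 hκ).1⟩
  · exact (mem_locK_of_not_dvd h).1 hκ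

lemma mul_mem_locK {p : Nat.Primes} {κ κ' : Matrix (Idx n ⊕ Idx n) (Idx n ⊕ Idx n) ℤ_[p]}
    (hκ : κ ∈ locK n N p) (hκ' : κ' ∈ locK n N p) : κ * κ' ∈ locK n N p := by
  by_cases h : (p : ℕ) ∣ N
  · rw [mem_locK_of_dvd h] at *
    refine ⟨by simpa using hκ.1.mul hκ'.1, ?_⟩
    rw [Matrix.map_mul, hκ.2, hκ'.2, Matrix.one_mul]
  · rw [mem_locK_of_not_dvd h] at *
    obtain ⟨u, hu⟩ := hκ
    obtain ⟨u', hu'⟩ := hκ'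
    exact ⟨u * u', by simpa using hu.mul hu'⟩

lemma IsSimil.exists_inv {l R : Type} [Fintype l] [DecidableEq l] [CommRing R]
    {g : Matrix (l ⊕ l) (l ⊕ l) R} {u : Rˣ} (hg : IsSimil g (u : R)) :
    ∃ g', IsSimil g' ((u⁻¹ : Rˣ) : R) ∧ g * g' = 1 ∧ g' * g = 1 := by
  have h1 : g * (((u⁻¹ : Rˣ) : R) • SiegelEis.simAdj g) = 1 := by
    rw [Matrix.mul_smul, hg.mul_simAdj u.isUnit, smul_smul, Units.inv_mul, one_smul]
  refine ⟨((u⁻¹ : Rˣ) : R) • SiegelEis.simAdj g, ?_, h1, mul_eq_one_comm.1 h1⟩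
  have h2 := hg.simAdj u.isUnit
  unfold IsSimil at *
  rw [transpose_smul, Matrix.smul_mul, Matrix.smul_mul, Matrix.mul_smul, h2, smul_smul, smul_smul,
    mul_assoc, Units.inv_mul, mul_one]

lemma exists_inv_mem_locK {p : Nat.Primes} {κ : Matrix (Idx n ⊕ Idx n) (Idx n ⊕ Idx n) ℤ_[p]}
    (hκ : κ ∈ locK n N p) : ∃ κ' ∈ locK n N p, κ * κ' = 1 ∧ κ' * κ = 1 := by
  by_cases h : (p : ℕ) ∣ N
  · rw [mem_locK_of_dvd h] at hκ
    obtain ⟨κ', h1, h2, h3⟩ := IsSimil.exists_inv (u := 1) hκ.1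
    refine ⟨κ', ?_, h2, h3⟩
    rw [mem_locK_of_dvd h]
    refine ⟨by simpa using h1, ?_⟩
    have h4 := congrArg (fun M : Matrix (Idx n ⊕ Idx n) (Idx n ⊕ Idx n) ℤ_[p] =>
      M.map (Ideal.Quotient.mk (Ideal.span {((p : ℕ) : ℤ_[p]) ^ padicValNat p N}))) h2
    simp only [Matrix.map_mul, hκ.2, Matrix.one_mul] at h4
    rw [h4]
    exact Matrix.map_one _ (map_zero _) (map_one _)
  · rw [mem_locK_of_not_dvd h] at hκ
    obtain ⟨u, hu⟩ := hκ
    obtain ⟨κ', h1, h2, h3⟩ := hu.exists_inv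
    exact ⟨κ', (mem_locK_of_not_dvd h).2 ⟨_, h1⟩, h2, h3⟩

/-- The restriction of `χ_p ∘ d` to `P(ℚ_p) ∩ x K_p x⁻¹` is trivial, which makes the section at
`p` well defined. -/
lemma loc_eq_one (hχ : χ.HasTypeLevel k N) {p : Nat.Primes}
    {κ k₀ : Matrix (Idx n ⊕ Idx n) (Idx n ⊕ Idx n) ℤ_[p]} (hκ : κ ∈ locK n N p)
    (hk : k₀ * locX n N p = locX n N p * κ) (h0 : k₀.toBlocks₂₁ = 0) :
    ∃ u a : ℤ_[p]ˣ, IsSimil k₀ (u : ℤ_[p]) ∧ k₀.toBlocks₁₁.det = a ∧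
      χ.loc p (Units.map (algebraMap ℤ_[p] ℚ_[p]).toMonoidHom (u⁻¹ ^ n * a)) = 1 := by
  obtain ⟨x', hx1, hx2, hx3⟩ := IsSimil.exists_inv (u := 1) (isSimil_locX n N p)
  have hk' : k₀ = locX n N p * κ * x' := by
    rw [← hk, Matrix.mul_assoc, hx2, Matrix.mul_one]
  have hx1' : IsSimil x' 1 := by simpa using hx1
  obtain ⟨u, hu, hu1⟩ : ∃ u : ℤ_[p]ˣ, IsSimil κ (u : ℤ_[p]) ∧ ((p : ℕ) ∣ N → u = 1) := by
    by_cases h : (p : ℕ) ∣ N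
    · exact ⟨1, ((mem_locK_of_dvd h).1 hκ).1, fun _ => rfl⟩
    · obtain ⟨u, hu⟩ := (mem_locK_of_not_dvd h).1 hκ
      exact ⟨u, hu, fun h' => absurd h' h⟩
  have hk0 : IsSimil k₀ (u : ℤ_[p]) := by
    have := ((isSimil_locX n N p).mul hu).mul hx1'
    rwa [← hk', one_mul, mul_one] at this
  have hdet := congrArg Matrix.det hk0.blocks.2.2.1
  rw [h0, transpose_zero, Matrix.zero_mul, sub_zero, det_mul, det_transpose, det_smul, det_one,
    mul_one] at hdet
  have hunit : IsUnit k₀.toBlocks₁₁.det :=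
    isUnit_of_mul_isUnit_left (hdet ▸ (u.isUnit.pow _))
  obtain ⟨a, ha⟩ := hunit
  refine ⟨u, a, hk0, ha.symm, ?_⟩
  have hnorm : ∀ w : ℤ_[p]ˣ,
      ‖((Units.map (algebraMap ℤ_[p] ℚ_[p]).toMonoidHom w : ℚ_[p]ˣ) : ℚ_[p])‖ = 1 :=
    fun w => PadicInt.norm_units w
  by_cases h : (p : ℕ) ∣ N
  · refine hχ.ram p h _ (hnorm _) ?_
    rw [hu1 h, inv_one, one_pow, one_mul]
    have h2 : k₀.map (Ideal.Quotient.mk (Ideal.span {((p : ℕ) : ℤ_[p]) ^ padicValNat p N})) = 1 := by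
      rw [hk', Matrix.map_mul, Matrix.map_mul, ((mem_locK_of_dvd h).1 hκ).2, Matrix.mul_one,
        ← Matrix.map_mul, hx2]
      exact Matrix.map_one _ (map_zero _) (map_one _)
    have h3 : k₀.toBlocks₁₁.map
        (Ideal.Quotient.mk (Ideal.span {((p : ℕ) : ℤ_[p]) ^ padicValNat p N})) = 1 := by
      have := congrArg Matrix.toBlocks₁₁ h2
      rw [← fromBlocks_one, toBlocks_fromBlocks₁₁] at this
      exact this
    have h4 : Ideal.Quotient.mk (Ideal.span {((p : ℕ) : ℤ_[p]) ^ padicValNat p N}) (a : ℤ_[p]) =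
        Ideal.Quotient.mk _ 1 := by
      rw [ha, RingHom.map_det, RingHom.mapMatrix_apply, h3, det_one, map_one]
    rw [Ideal.Quotient.eq, ← PadicInt.norm_le_pow_iff_mem_span_pow] at h4
    exact h4
  · exact hχ.unram p h _ (hnorm _)

/-- `(A, X, v, κ)` is a decomposition `g = [A, X; 0, v ᵗA⁻¹] x κ` with `κ ∈ K_p`. -/
def IsLocDecomp (n N : ℕ) (p : Nat.Primes) (g : Matrix (Idx n ⊕ Idx n) (Idx n ⊕ Idx n) ℚ_[p])
    (A : GL (Idx n) ℚ_[p]) (X : Matrix (Idx n) (Idx n) ℚ_[p]) (v : ℚ_[p]ˣ)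
    (κ : Matrix (Idx n ⊕ Idx n) (Idx n ⊕ Idx n) ℤ_[p]) : Prop :=
  κ ∈ locK n N p ∧ g = parabolicElt A X v * toQp (locX n N p) * toQp κ

/-- The character `p ↦ χ(d) |d|^e` evaluated at `d`. -/
def locChar (χ : IdeleClassChar) (e : ℂ) (p : Nat.Primes) (d : ℚ_[p]ˣ) : ℂ :=
  (χ.loc p d : ℂ) * ((‖(d : ℚ_[p])‖ : ℝ) : ℂ) ^ e

lemma locChar_mul (χ : IdeleClassChar) (e : ℂ) (p : Nat.Primes) (d d' : ℚ_[p]ˣ) :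
    locChar χ e p (d * d') = locChar χ e p d * locChar χ e p d' := by
  simp only [locChar, map_mul, Units.val_mul, norm_mul, Complex.ofReal_mul]
  rw [Complex.mul_cpow_ofReal_nonneg (norm_nonneg _) (norm_nonneg _)]
  ring

/-- The invariant `d = v⁻ⁿ det A` of a parabolic element, as a unit. -/
abbrev dInv {F : Type} [NormedField F] (n : ℕ) (A : GL (Idx n) F) (v : Fˣ) : Fˣ :=
  v⁻¹ ^ n * Matrix.GeneralLinearGroup.det A

lemma mul_rearrange {G : Type} [CommGroup G] (a b c d : G) : a * b * (c * d) = b * c * (a * d) := by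
  rw [mul_comm a b, mul_mul_mul_comm]

/-- The value `χ_p(d) |d|^e` does not depend on the decomposition of `g`. -/
lemma locDecomp_unique [NeZero n] (hχ : χ.HasTypeLevel k N) {p : Nat.Primes} (e : ℂ)
    {g : Matrix (Idx n ⊕ Idx n) (Idx n ⊕ Idx n) ℚ_[p]} {A₁ A₂ : GL (Idx n) ℚ_[p]}
    {X₁ X₂ : Matrix (Idx n) (Idx n) ℚ_[p]} {v₁ v₂ : ℚ_[p]ˣ}
    {κ₁ κ₂ : Matrix (Idx n ⊕ Idx n) (Idx n ⊕ Idx n) ℤ_[p]}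
    (h₁ : IsLocDecomp n N p g A₁ X₁ v₁ κ₁) (h₂ : IsLocDecomp n N p g A₂ X₂ v₂ κ₂) :
    locChar χ e p (dInv n A₁ v₁) = locChar χ e p (dInv n A₂ v₂) := by
  obtain ⟨κ', hκ', hκ1, hκ2⟩ := exists_inv_mem_locK h₁.1
  obtain ⟨x', hx1, hx2, hx3⟩ := IsSimil.exists_inv (u := 1) (isSimil_locX n N p)
  set k₀ := locX n N p * (κ₂ * κ') * x' with hk₀
  have hk : k₀ * locX n N p = locX n N p * (κ₂ * κ') := by
    rw [hk₀, Matrix.mul_assoc, hx3, Matrix.mul_one]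
  have hpp : parabolicElt A₁ X₁ v₁ = parabolicElt A₂ X₂ v₂ * toQp k₀ := by
    have e1 : toQp (locX n N p) * toQp κ₁ * (toQp κ' * toQp x') = 1 := by
      rw [← toQp_mul, ← toQp_mul, ← toQp_mul, ← toQp_one]
      congr 1
      rw [Matrix.mul_assoc, ← Matrix.mul_assoc κ₁, hκ1, Matrix.one_mul, hx2]
    calc parabolicElt A₁ X₁ v₁ = g * (toQp κ' * toQp x') := by
          rw [h₁.2, Matrix.mul_assoc (parabolicElt A₁ X₁ v₁), Matrix.mul_assoc, e1, Matrix.mul_one]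
      _ = _ := by
          rw [h₂.2, hk₀, toQp_mul, toQp_mul, toQp_mul]
          simp only [Matrix.mul_assoc]
  have hinv : ∀ A : GL (Idx n) ℚ_[p],
      (A : Matrix (Idx n) (Idx n) ℚ_[p])ᵀ * ((A⁻¹ : GL (Idx n) ℚ_[p]) :
        Matrix (Idx n) (Idx n) ℚ_[p])ᵀ = 1 := fun A => by
    rw [← transpose_mul, ← Units.val_mul]; simp
  have h0 : k₀.toBlocks₂₁ = 0 := by
    have h := congrArg Matrix.toBlocks₂₁ hpp
    rw [toBlocks₂₁_mul, parabolicElt_toBlocks₂₁, parabolicElt_toBlocks₂₁, Matrix.zero_mul, zero_add,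
      parabolicElt_toBlocks₂₂, Matrix.smul_mul] at h
    have h2 := congrArg (fun M => (A₂ : Matrix (Idx n) (Idx n) ℚ_[p])ᵀ * M) h
    simp only [Matrix.mul_zero, Matrix.mul_smul, ← Matrix.mul_assoc, hinv, Matrix.one_mul] at h2
    have h3 := (smul_eq_zero.1 h2.symm).resolve_left v₂.ne_zero
    apply toQp_injective
    exact h3.trans (Matrix.map_zero _ (map_zero _)).symm
  obtain ⟨u, a, hu, ha, h1⟩ := loc_eq_one hχ (mul_mem_locK h₂.1 hκ') hk h0
  have h0' : (toQp k₀).toBlocks₂₁ = 0 := by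
    change toQp k₀.toBlocks₂₁ = 0
    rw [h0]; exact Matrix.map_zero _ (map_zero _)
  have h11 : (A₁ : Matrix (Idx n) (Idx n) ℚ_[p]) = A₂ * toQp k₀.toBlocks₁₁ := by
    have h := congrArg Matrix.toBlocks₁₁ hpp
    rw [toBlocks₁₁_mul, h0', Matrix.mul_zero, add_zero] at h
    exact h
  have h22 : (v₁ : ℚ_[p]) • ((A₁⁻¹ : GL (Idx n) ℚ_[p]) : Matrix (Idx n) (Idx n) ℚ_[p])ᵀ =
      (v₂ : ℚ_[p]) • (((A₂⁻¹ : GL (Idx n) ℚ_[p]) : Matrix (Idx n) (Idx n) ℚ_[p])ᵀ *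
        (toQp k₀).toBlocks₂₂) := by
    have h := congrArg Matrix.toBlocks₂₂ hpp
    rw [toBlocks₂₂_mul, parabolicElt_toBlocks₂₁, Matrix.zero_mul, zero_add,
      parabolicElt_toBlocks₂₂, parabolicElt_toBlocks₂₂, Matrix.smul_mul] at h
    exact h
  have hdet : Matrix.GeneralLinearGroup.det A₁ = Matrix.GeneralLinearGroup.det A₂ *
      Units.map (algebraMap ℤ_[p] ℚ_[p]).toMonoidHom a := by
    ext
    change (A₁ : Matrix (Idx n) (Idx n) ℚ_[p]).det =
      (A₂ : Matrix (Idx n) (Idx n) ℚ_[p]).det * algebraMap ℤ_[p] ℚ_[p] (a : ℤ_[p])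
    rw [h11, det_mul, ← ha, RingHom.map_det]
    rfl
  have hv : v₁ = v₂ * Units.map (algebraMap ℤ_[p] ℚ_[p]).toMonoidHom u := by
    have h := congrArg (fun M => (A₁ : Matrix (Idx n) (Idx n) ℚ_[p])ᵀ * M) h22
    simp only [Matrix.mul_smul, hinv] at h
    rw [h11, transpose_mul, Matrix.mul_assoc, ← Matrix.mul_assoc _ _ (toQp k₀).toBlocks₂₂, hinv,
      Matrix.one_mul] at h
    have h3 := (hu.map (algebraMap ℤ_[p] ℚ_[p])).blocks.2.2.1
    change (toQp k₀).toBlocks₁₁ᵀ * (toQp k₀).toBlocks₂₂ - (toQp k₀).toBlocks₂₁ᵀ * _ = _ at h3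
    rw [h0', transpose_zero, Matrix.zero_mul, sub_zero] at h3
    change _ = (v₂ : ℚ_[p]) • ((toQp k₀).toBlocks₁₁ᵀ * _) at h
    rw [h3, smul_smul] at h
    have h4 := congrFun (congrFun h (.inl 0)) (.inl 0)
    ext
    simpa using h4
  have hd : dInv n A₁ v₁ = dInv n A₂ v₂ *
      Units.map (algebraMap ℤ_[p] ℚ_[p]).toMonoidHom (u⁻¹ ^ n * a) := by
    rw [dInv, dInv, hdet, hv, map_mul, map_pow, map_inv, _root_.mul_inv_rev, mul_pow]
    exact mul_rearrange _ _ _ _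
  rw [hd, locChar_mul]
  have h5 : ‖((Units.map (algebraMap ℤ_[p] ℚ_[p]).toMonoidHom (u⁻¹ ^ n * a) : ℚ_[p]ˣ) : ℚ_[p])‖ = 1 :=
    PadicInt.norm_units _
  conv_lhs => rw [locChar, locChar, h1, h5]
  simp [locChar]

lemma image_locK_eq (p : Nat.Primes) (h : ¬ (p : ℕ) ∣ N) :
    ((fun γ : GL (Idx n ⊕ Idx n) ℤ_[p] =>
          (γ : Matrix (Idx n ⊕ Idx n) (Idx n ⊕ Idx n) ℤ_[p]).map (algebraMap ℤ_[p] ℚ_[p])) ''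
        (GSp (Idx n) ℤ_[p] : Set (GL (Idx n ⊕ Idx n) ℤ_[p]))) = toQp '' locK n N p := by
  ext M
  constructor
  · rintro ⟨γ, ⟨u, hu⟩, rfl⟩
    exact ⟨γ, (mem_locK_of_not_dvd h).2 ⟨u, hu⟩, rfl⟩
  · rintro ⟨κ, hκ, rfl⟩
    obtain ⟨u, hu⟩ := (mem_locK_of_not_dvd h).1 hκ
    obtain ⟨κ', -, h1, h2⟩ := hu.exists_inv
    exact ⟨⟨κ, κ', h1, h2⟩, ⟨u, hu⟩, rfl⟩

/-- The two cases of the definition of the section at `p` in a uniform notation. -/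
lemma sectionP_eq_localSection (p : Nat.Primes) :
    sectionP n N χ s p = localSection n (χ.loc p) (modExponent n s) (toQp (locX n N p))
      (toQp '' locK n N p) (fun _ => 1) := by
  by_cases h : (p : ℕ) ∣ N
  · have h1 : toQp (locX n N p) = Qmat n ℚ_[p] := by
      have e0 : (0 : Matrix (Fin n) (Fin n) ℤ_[p]).map (algebraMap ℤ_[p] ℚ_[p]) = 0 :=
        Matrix.map_zero _ (map_zero _)
      have e1 : (1 : Matrix (Fin n) (Fin n) ℤ_[p]).map (algebraMap ℤ_[p] ℚ_[p]) = 1 := toQp_one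
      have e2 : (-1 : Matrix (Fin n) (Fin n) ℤ_[p]).map (algebraMap ℤ_[p] ℚ_[p]) = -1 := by
        rw [← e1]; ext i j; simp only [Matrix.map_apply, Matrix.neg_apply, map_neg]
      rw [locX, if_pos h, Qmat, Qmat, toQp, fromBlocks_map, fromBlocks_map, fromBlocks_map,
        fromBlocks_map, fromBlocks_map, e0, e1, e2]
    have h2 : locK n N p =
        principalCongruence (Idx n) ℤ_[p] (((p : ℕ) : ℤ_[p]) ^ padicValNat p N) := by
      ext κ
      change (if _ then _ else _) ↔ _
      rw [if_pos h]
    rw [sectionP, if_pos h, h1, h2]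
  · have h1 : toQp (locX n N p) = 1 := by
      rw [locX, if_neg h, toQp_one]
    rw [sectionP, if_neg h, h1, image_locK_eq p h]

/-- The section at `p` computed from any decomposition of its argument. -/
lemma sectionP_eq [NeZero n] (hχ : χ.HasTypeLevel k N) {p : Nat.Primes}
    {g : Matrix (Idx n ⊕ Idx n) (Idx n ⊕ Idx n) ℚ_[p]} {A : GL (Idx n) ℚ_[p]}
    {X : Matrix (Idx n) (Idx n) ℚ_[p]} {v : ℚ_[p]ˣ}
    {κ : Matrix (Idx n ⊕ Idx n) (Idx n ⊕ Idx n) ℤ_[p]} (h : IsLocDecomp n N p g A X v κ) :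
    sectionP n N χ s p g = locChar χ (modExponent n s) p (dInv n A v) := by
  have hex : ∃ (q : GL (Idx n) ℚ_[p] × Matrix (Idx n) (Idx n) ℚ_[p] × ℚ_[p]ˣ ×
      Matrix (Idx n ⊕ Idx n) (Idx n ⊕ Idx n) ℚ_[p]),
      q.2.2.2 ∈ toQp '' locK n N p ∧
        g = parabolicElt q.1 q.2.1 q.2.2.1 * toQp (locX n N p) * q.2.2.2 :=
    ⟨(A, X, v, toQp κ), ⟨κ, h.1, rfl⟩, h.2⟩
  rw [sectionP_eq_localSection, localSection, dif_pos hex]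
  obtain ⟨⟨κ', hκ', hκ''⟩, hg⟩ := hex.choose_spec
  rw [← hκ''] at hg
  have h' : IsLocDecomp n N p g _ _ _ κ' := ⟨hκ', hg⟩
  rw [locDecomp_unique hχ _ h h', mul_one]
  rfl

lemma sectionP_eq_zero {p : Nat.Primes}
    {g : Matrix (Idx n ⊕ Idx n) (Idx n ⊕ Idx n) ℚ_[p]}
    (h : ¬ ∃ A X v κ, IsLocDecomp n N p g A X v κ) : sectionP n N χ s p g = 0 := by
  rw [sectionP_eq_localSection, localSection, dif_neg]
  rintro ⟨⟨A, X, v, M⟩, ⟨κ, hκ, rfl⟩, hg⟩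
  exact h ⟨A, X, v, κ, hκ, hg⟩

lemma IsLocDecomp.mul_right {p : Nat.Primes}
    {g : Matrix (Idx n ⊕ Idx n) (Idx n ⊕ Idx n) ℚ_[p]} {A : GL (Idx n) ℚ_[p]}
    {X : Matrix (Idx n) (Idx n) ℚ_[p]} {v : ℚ_[p]ˣ}
    {κ κ' : Matrix (Idx n ⊕ Idx n) (Idx n ⊕ Idx n) ℤ_[p]} (h : IsLocDecomp n N p g A X v κ)
    (hκ' : κ' ∈ locK n N p) : IsLocDecomp n N p (g * toQp κ') A X v (κ * κ') :=
  ⟨mul_mem_locK h.1 hκ', by rw [h.2, toQp_mul, Matrix.mul_assoc]⟩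

lemma IsLocDecomp.mul_left {p : Nat.Primes}
    {g : Matrix (Idx n ⊕ Idx n) (Idx n ⊕ Idx n) ℚ_[p]} {A A' : GL (Idx n) ℚ_[p]}
    {X X' : Matrix (Idx n) (Idx n) ℚ_[p]} {v v' : ℚ_[p]ˣ}
    {κ : Matrix (Idx n ⊕ Idx n) (Idx n ⊕ Idx n) ℤ_[p]} (h : IsLocDecomp n N p g A X v κ) :
    ∃ X'', IsLocDecomp n N p (parabolicElt A' X' v' * g) (A' * A) X'' (v' * v) κ :=
  ⟨_, h.1, by rw [h.2, ← Matrix.mul_assoc, ← Matrix.mul_assoc, parabolicElt_mul]⟩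

/-- Right invariance of the section at `p`. -/
lemma sectionP_mul_right [NeZero n] (hχ : χ.HasTypeLevel k N) {p : Nat.Primes}
    (g : Matrix (Idx n ⊕ Idx n) (Idx n ⊕ Idx n) ℚ_[p])
    {κ : Matrix (Idx n ⊕ Idx n) (Idx n ⊕ Idx n) ℤ_[p]} (hκ : κ ∈ locK n N p) :
    sectionP n N χ s p (g * toQp κ) = sectionP n N χ s p g := by
  by_cases h : ∃ A X v κ, IsLocDecomp n N p g A X v κ
  · obtain ⟨A, X, v, κ₁, h⟩ := h
    rw [sectionP_eq hχ h, sectionP_eq hχ (h.mul_right hκ)]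
  · rw [sectionP_eq_zero h, sectionP_eq_zero]
    rintro ⟨A, X, v, κ₁, h1⟩
    obtain ⟨κ', hκ', h2, h3⟩ := exists_inv_mem_locK hκ
    refine h ⟨A, X, v, κ₁ * κ', ?_⟩
    have := h1.mul_right hκ'
    rwa [Matrix.mul_assoc, ← toQp_mul, h2, toQp_one, Matrix.mul_one] at this

/-- Left equivariance of the section at `p` under the Siegel parabolic. -/
lemma sectionP_mul_left [NeZero n] (hχ : χ.HasTypeLevel k N) {p : Nat.Primes}
    (g : Matrix (Idx n ⊕ Idx n) (Idx n ⊕ Idx n) ℚ_[p]) (A : GL (Idx n) ℚ_[p])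
    (X : Matrix (Idx n) (Idx n) ℚ_[p]) (v : ℚ_[p]ˣ) :
    sectionP n N χ s p (parabolicElt A X v * g) =
      locChar χ (modExponent n s) p (dInv n A v) * sectionP n N χ s p g := by
  by_cases h : ∃ A X v κ, IsLocDecomp n N p g A X v κ
  · obtain ⟨A', X', v', κ, h⟩ := h
    obtain ⟨X'', h2⟩ := h.mul_left (A' := A) (X' := X) (v' := v)
    rw [sectionP_eq hχ h, sectionP_eq hχ h2, ← locChar_mul]
    congr 1
    rw [dInv, dInv, dInv, map_mul, _root_.mul_inv_rev, mul_pow]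
    exact mul_rearrange _ _ _ _
  · rw [sectionP_eq_zero h, sectionP_eq_zero, mul_zero]
    rintro ⟨A', X', v', κ, h1⟩
    obtain ⟨X'', h2⟩ := h1.mul_left (A' := A⁻¹)
      (X' := -((v⁻¹ : ℚ_[p]ˣ) : ℚ_[p]) • (((A⁻¹ : GL (Idx n) ℚ_[p]) : Matrix (Idx n) (Idx n) ℚ_[p]) * X *
        (A : Matrix (Idx n) (Idx n) ℚ_[p])ᵀ)) (v' := v⁻¹)
    rw [← Matrix.mul_assoc, parabolicElt_inv_mul, Matrix.one_mul] at h2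
    exact h ⟨_, _, _, _, h2⟩

end Finite

/-! ### The product formula -/

section ProductFormula

open Filter

lemma eventually_not_dvd {N : ℕ} (hN : N ≠ 0) :
    ∀ᶠ p : Nat.Primes in cofinite, ¬ (p : ℕ) ∣ N := by
  rw [eventually_cofinite]
  simp only [not_not]
  exact ((Nat.divisors N).finite_toSet.preimage (Subtype.val_injective.injOn)).subset
    fun p hp => by
      have hp' : (p : ℕ) ∣ N := hp
      simpa [hN] using hp'

lemma eventually_norm_le_one (q : ℚ) :
    ∀ᶠ p : Nat.Primes in cofinite, ‖algebraMap ℚ ℚ_[p] q‖ ≤ 1 := by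
  filter_upwards [eventually_not_dvd q.den_nz] with p hp
  rw [eq_ratCast]
  exact Padic.norm_rat_le_one hp

lemma eventually_norm_eq_one {q : ℚ} (hq : q ≠ 0) :
    ∀ᶠ p : Nat.Primes in cofinite, ‖algebraMap ℚ ℚ_[p] q‖ = 1 := by
  filter_upwards [eventually_norm_le_one q, eventually_norm_le_one q⁻¹] with p h1 h2
  refine le_antisymm h1 ?_
  rw [map_inv₀, norm_inv] at h2
  exact (inv_le_one₀ (norm_pos_iff.2 ((map_ne_zero _).2 hq))).1 h2

lemma hasFiniteMulSupport_norm {q : ℚ} (hq : q ≠ 0) :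
    Function.HasFiniteMulSupport fun p : Nat.Primes => ‖algebraMap ℚ ℚ_[p] q‖ :=
  eventually_cofinite.1 (eventually_norm_eq_one hq)

lemma finprod_norm_mul {a b : ℚ} (ha : a ≠ 0) (hb : b ≠ 0) :
    ∏ᶠ p : Nat.Primes, ‖algebraMap ℚ ℚ_[p] (a * b)‖ =
      (∏ᶠ p : Nat.Primes, ‖algebraMap ℚ ℚ_[p] a‖) * ∏ᶠ p : Nat.Primes, ‖algebraMap ℚ ℚ_[p] b‖ := by
  rw [← finprod_mul_distrib (hasFiniteMulSupport_norm ha) (hasFiniteMulSupport_norm hb)]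
  exact finprod_congr fun p => by rw [map_mul, norm_mul]

lemma finprod_norm_prime (q : Nat.Primes) :
    ∏ᶠ p : Nat.Primes, ‖algebraMap ℚ ℚ_[p] ((q : ℕ) : ℚ)‖ = ((q : ℕ) : ℝ)⁻¹ := by
  refine (finprod_eq_single (fun p : Nat.Primes => ‖algebraMap ℚ ℚ_[p] ((q : ℕ) : ℚ)‖) q
    fun p hp => ?_).trans ?_
  · change ‖algebraMap ℚ ℚ_[p] ((q : ℕ) : ℚ)‖ = 1
    rw [map_natCast, Padic.norm_natCast_eq_one_iff]
    exact (Nat.coprime_primes p.2 q.2).2 fun h => hp (Subtype.ext h)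
  · rw [map_natCast]
    exact Padic.norm_p

lemma finprod_norm_natCast {m : ℕ} (hm : m ≠ 0) :
    ∏ᶠ p : Nat.Primes, ‖algebraMap ℚ ℚ_[p] (m : ℚ)‖ = (m : ℝ)⁻¹ := by
  induction m using induction_on_primes with
  | zero => exact absurd rfl hm
  | one => simp [finprod_one]
  | prime_mul q a hq ih =>
    have ha : a ≠ 0 := right_ne_zero_of_mul hm
    have h1 := finprod_norm_prime ⟨q, hq⟩
    rw [Nat.cast_mul, finprod_norm_mul (by exact_mod_cast hq.ne_zero) (by exact_mod_cast ha), ih ha,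
      h1, Nat.cast_mul, mul_inv]

/-- The product formula for `ℚ`. -/
lemma finprod_norm_eq {q : ℚ} (hq : q ≠ 0) :
    ∏ᶠ p : Nat.Primes, ‖algebraMap ℚ ℚ_[p] q‖ = (|(q : ℝ)|)⁻¹ := by
  have hden : (q.den : ℚ) ≠ 0 := by exact_mod_cast q.den_nz
  have hnum : (q.num.natAbs : ℚ) ≠ 0 := by
    exact_mod_cast Int.natAbs_ne_zero.2 (Rat.num_ne_zero.2 hq)
  have h1 : ∏ᶠ p : Nat.Primes, ‖algebraMap ℚ ℚ_[p] (q * q.den)‖ =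
      ∏ᶠ p : Nat.Primes, ‖algebraMap ℚ ℚ_[p] (q.num.natAbs : ℚ)‖ := by
    refine finprod_congr fun p => ?_
    rw [Rat.mul_den_eq_num]
    rcases Int.natAbs_eq q.num with h | h
    · conv_lhs => rw [h]
      simp
    · conv_lhs => rw [h]
      simp
  rw [finprod_norm_mul hq hden, finprod_norm_natCast q.den_nz,
    finprod_norm_natCast (by exact_mod_cast hnum)] at h1
  have hdenR : (q.den : ℝ) ≠ 0 := by exact_mod_cast q.den_nz
  have h2 : |(q : ℝ)| = (q.num.natAbs : ℝ) * (q.den : ℝ)⁻¹ := by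
    conv_lhs => rw [← Rat.num_div_den q]
    push_cast
    rw [abs_div, Nat.abs_cast, div_eq_mul_inv, Nat.cast_natAbs, Int.cast_abs]
  rw [h2, mul_inv, inv_inv, ← h1, mul_assoc, inv_mul_cancel₀ hdenR, mul_one]

end ProductFormula

/-! ### The global section -/

section GlobalSection

open Filter

variable {n k N : ℕ} {χ : IdeleClassChar} {s : ℂ}

/-- Rational matrices of size `4n`. -/
abbrev RatMat (n : ℕ) : Type := Matrix (Idx n ⊕ Idx n) (Idx n ⊕ Idx n) ℚ

/-- The section at infinity times the product of the sections at all primes, as a function of a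
rational matrix and a real one. -/
def matSection (n k N : ℕ) (χ : IdeleClassChar) (s : ℂ) (γ : RatMat n)
    (g : Matrix (Idx n ⊕ Idx n) (Idx n ⊕ Idx n) ℝ) : ℂ :=
  sectionInfty n k χ s (γ.map (algebraMap ℚ ℝ) * g) *
    ∏ᶠ p : Nat.Primes, sectionP n N χ s p (γ.map (algebraMap ℚ ℚ_[p]))

lemma exists_toQp_eq {p : Nat.Primes} {m : Type} {M : Matrix m m ℚ_[p]} (h : ∀ i j, ‖M i j‖ ≤ 1) :
    ∃ M₀ : Matrix m m ℤ_[p], toQp M₀ = M :=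
  ⟨fun i j => ⟨M i j, h i j⟩, rfl⟩

lemma IsSimil.of_toQp {p : Nat.Primes} {l : Type} [Fintype l] [DecidableEq l]
    {κ : Matrix (l ⊕ l) (l ⊕ l) ℤ_[p]} {u : ℤ_[p]} (h : IsSimil (toQp κ) (algebraMap ℤ_[p] ℚ_[p] u)) :
    IsSimil κ u := by
  unfold IsSimil at *
  apply toQp_injective
  rw [toQp_mul, toQp_mul]
  have h1 : toQp (J l ℤ_[p]) = J l ℚ_[p] := map_J l _
  rw [h1]
  refine Eq.trans h ?_
  rw [← h1]
  ext i j
  simp only [Matrix.map_apply, Matrix.smul_apply, smul_eq_mul, map_mul]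

lemma locDecomp_of_integral {p : Nat.Primes} (hp : ¬ (p : ℕ) ∣ N)
    {κ : Matrix (Idx n ⊕ Idx n) (Idx n ⊕ Idx n) ℤ_[p]} {u : ℤ_[p]ˣ} (hκ : IsSimil κ (u : ℤ_[p])) :
    IsLocDecomp n N p (toQp κ) 1 0 1 κ := by
  refine ⟨(mem_locK_of_not_dvd hp).2 ⟨u, hκ⟩, ?_⟩
  have h1 : parabolicElt (1 : GL (Idx n) ℚ_[p]) 0 1 = 1 := by
    rw [parabolicElt, ← fromBlocks_one]
    simp
  rw [h1, locX, if_neg hp, toQp_one, Matrix.one_mul, Matrix.one_mul]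

/-- For almost all `p` a rational similitude lies in `GSp(ℤ_p)`, where the section is one. Hence the
product over all primes is finite. -/
lemma eventually_sectionP_eq_one [NeZero n] (hχ : χ.HasTypeLevel k N) (hN : N ≠ 0) {γ : RatMat n}
    {v : ℚ} (hγ : IsSimil γ v) (hv : v ≠ 0) :
    ∀ᶠ p : Nat.Primes in cofinite, sectionP n N χ s p (γ.map (algebraMap ℚ ℚ_[p])) = 1 := by
  have h1 : ∀ᶠ p : Nat.Primes in cofinite, ∀ i j, ‖algebraMap ℚ ℚ_[p] (γ i j)‖ ≤ 1 :=
    eventually_all.2 fun i => eventually_all.2 fun j => eventually_norm_le_one _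
  filter_upwards [eventually_not_dvd hN, h1, eventually_norm_eq_one hv] with p hp h2 h3
  obtain ⟨κ, hκ⟩ := exists_toQp_eq (M := γ.map (algebraMap ℚ ℚ_[p])) h2
  let z : ℤ_[p] := ⟨algebraMap ℚ ℚ_[p] v, h3.le⟩
  have hz : ‖z‖ = 1 := h3
  obtain ⟨u, hu⟩ := PadicInt.isUnit_iff.2 hz
  have h4 : IsSimil κ (u : ℤ_[p]) := by
    apply IsSimil.of_toQp
    rw [hκ, hu]
    exact hγ.map (algebraMap ℚ ℚ_[p])
  rw [← hκ, sectionP_eq hχ (locDecomp_of_integral hp h4), locChar]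
  simp [dInv]

lemma hasFiniteMulSupport_sectionP [NeZero n] (hχ : χ.HasTypeLevel k N) (hN : N ≠ 0) {γ : RatMat n}
    {v : ℚ} (hγ : IsSimil γ v) (hv : v ≠ 0) :
    Function.HasFiniteMulSupport fun p : Nat.Primes =>
      sectionP n N χ s p (γ.map (algebraMap ℚ ℚ_[p])) :=
  eventually_cofinite.1 (eventually_sectionP_eq_one hχ hN hγ hv)

/-- Base change of a matrix in `GL`. -/
abbrev mapGL' {F F' : Type} [Field F] [Field F'] {l : Type} [Fintype l] [DecidableEq l]
    (f : F →+* F') (A : GL l F) : GL l F' := Matrix.GeneralLinearGroup.map f A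

lemma parabolicElt_map {F F' : Type} [NormedField F] [NormedField F'] {l : Type} [Fintype l]
    [DecidableEq l] (f : F →+* F') (A : GL l F) (X : Matrix l l F) (v : Fˣ) :
    (parabolicElt A X v).map f = parabolicElt (mapGL' f A) (X.map f) (Units.map f.toMonoidHom v) := by
  rw [parabolicElt, fromBlocks_map, parabolicElt]
  congr 1
  · exact Matrix.map_zero _ (map_zero _)
  · rw [mapGL', ← Matrix.GeneralLinearGroup.map_inv]
    ext i j
    simp only [Matrix.map_apply, Matrix.smul_apply, smul_eq_mul, map_mul, transpose_apply]
    rfl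

lemma dInv_map {F F' : Type} [NormedField F] [NormedField F'] (f : F →+* F') (A : GL (Idx n) F)
    (v : Fˣ) : dInv n (mapGL' f A) (Units.map f.toMonoidHom v) =
      Units.map f.toMonoidHom (dInv n A v) := by
  rw [dInv, dInv, map_mul, map_pow, map_inv]
  congr 1
  exact Matrix.GeneralLinearGroup.map_det f A

/-- Left equivariance of the archimedean section under the Siegel parabolic. -/
lemma sectionInfty_mul_left [NeZero n] (hχ : χ.HasTypeLevel k N) {E m : ℕ} (hk : k = E + 2 * m)
    (hs : modExponent n s = E) {g : Matrix (Idx n ⊕ Idx n) (Idx n ⊕ Idx n) ℝ} {v : ℝ}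
    (hv : v ≠ 0) (hg : IsSimil g v) {A : GL (Idx n) ℝ} {X : Matrix (Idx n) (Idx n) ℝ} {w : ℝˣ}
    (hP : IsSimil (parabolicElt A X w) (w : ℝ)) :
    sectionInfty n k χ s (parabolicElt A X w * g) =
      (χ.arch (dInv n A w) : ℂ) * ((‖((dInv n A w : ℝˣ) : ℝ)‖ : ℝ) : ℂ) ^ E *
        sectionInfty n k χ s g := by
  rw [sectionInfty_eq hχ hk hs (mul_ne_zero w.ne_zero hv) (hP.mul hg), sectionInfty_eq hχ hk hs hv hg]
  set d : ℝˣ := dInv n A w with hd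
  set j := autFactor g (basePoint (Idx n)) with hjdef
  have hj0 : j ≠ 0 := (isUnit_denom hg hv basePoint_mem).ne_zero
  have hj : autFactor (parabolicElt A X w * g) (basePoint (Idx n)) =
      ((w : ℝ) : ℂ) ^ n * ((d : ℝ) : ℂ)⁻¹ * j := by
    rw [autFactor, denom_mul, parabolicElt_toBlocks₂₁, hjdef, autFactor]
    have : cplx (0 : Matrix (Idx n) (Idx n) ℝ) * numer g (basePoint (Idx n)) = 0 := by simp
    rw [this, zero_add, det_mul, cplx_det, parabolicElt_toBlocks₂₂, det_parabolic_block]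
    rw [hd, dInv]
    push_cast
    rfl
  have hd0 : (d : ℝ) ≠ 0 := d.ne_zero
  have hw0 : (w : ℝ) ≠ 0 := w.ne_zero
  have hdC : ((d : ℝ) : ℂ) ≠ 0 := by exact_mod_cast hd0
  have hwC : ((w : ℝ) : ℂ) ≠ 0 := by exact_mod_cast hw0
  have e1 : (((w : ℝ) * v : ℝ) : ℂ) ^ n / autFactor (parabolicElt A X w * g) (basePoint (Idx n)) =
      ((d : ℝ) : ℂ) * ((v : ℂ) ^ n / j) := by
    rw [hj, Complex.ofReal_mul, mul_pow]; field_simp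
  have e2 : ‖autFactor (parabolicElt A X w * g) (basePoint (Idx n))‖ / |(w : ℝ) * v| ^ n =
      ‖(d : ℝ)‖⁻¹ * (‖j‖ / |v| ^ n) := by
    rw [hj, norm_mul, norm_mul, norm_pow, norm_inv, Complex.norm_real, Complex.norm_real,
      Real.norm_eq_abs, Real.norm_eq_abs, abs_mul, mul_pow]
    have h1 : |v| ≠ 0 := abs_ne_zero.2 hv
    have h2 : |(w : ℝ)| ≠ 0 := abs_ne_zero.2 hw0
    have h3 : |(d : ℝ)| ≠ 0 := abs_ne_zero.2 hd0
    field_simp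
  rw [e1, e2, hχ.arch_eq, mul_pow, mul_pow]
  have h4 : (((SignType.sign (d : ℝ) : ℝ)) : ℂ) ^ k * ((‖(d : ℝ)‖ : ℝ) : ℂ) ^ E =
      ((d : ℝ) : ℂ) ^ k * (((‖(d : ℝ)‖⁻¹) ^ (2 * m) : ℝ) : ℂ) := by
    rw [← Complex.ofReal_pow, ← Complex.ofReal_pow, ← Complex.ofReal_pow, ← Complex.ofReal_mul,
      ← Complex.ofReal_mul, sign_pow_mul_abs_pow hd0 hk]
  rw [h4, Complex.ofReal_mul]
  ring

/-- The local factors by which a rational element of the parabolic changes the sections multiply to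
one, by the triviality of `χ` on `ℚˣ` and the product formula. -/
lemma finprod_locChar (hN : N ≠ 0) (hχ : χ.HasTypeLevel k N) {E : ℕ} (d : ℚˣ) :
    Function.HasFiniteMulSupport (fun p : Nat.Primes =>
      locChar χ E p (Units.map (algebraMap ℚ ℚ_[p]).toMonoidHom d)) ∧
    (χ.arch (Units.map (algebraMap ℚ ℝ).toMonoidHom d) : ℂ) *
      ((‖((Units.map (algebraMap ℚ ℝ).toMonoidHom d : ℝˣ) : ℝ)‖ : ℝ) : ℂ) ^ E *
      ∏ᶠ p : Nat.Primes, locChar χ E p (Units.map (algebraMap ℚ ℚ_[p]).toMonoidHom d) = 1 := by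
  have hd0 : (d : ℚ) ≠ 0 := d.ne_zero
  have h1 : ∀ᶠ p : Nat.Primes in cofinite,
      χ.loc p (Units.map (algebraMap ℚ ℚ_[p]).toMonoidHom d) = 1 := by
    filter_upwards [eventually_not_dvd hN, eventually_norm_eq_one hd0] with p h1 h2
    exact hχ.unram p h1 _ h2
  have f1 : Function.HasFiniteMulSupport fun p : Nat.Primes =>
      χ.loc p (Units.map (algebraMap ℚ ℚ_[p]).toMonoidHom d) := eventually_cofinite.1 h1
  have f1' : Function.HasFiniteMulSupport fun p : Nat.Primes =>
      ((χ.loc p (Units.map (algebraMap ℚ ℚ_[p]).toMonoidHom d) : ℂˣ) : ℂ) :=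
    eventually_cofinite.1 (h1.mono fun p hp => by beta_reduce; rw [hp, Units.val_one])
  have f2 : Function.HasFiniteMulSupport fun p : Nat.Primes =>
      ((‖algebraMap ℚ ℚ_[p] (d : ℚ)‖ : ℝ) : ℂ) ^ E :=
    eventually_cofinite.1 ((eventually_norm_eq_one hd0).mono fun p hp => by
      beta_reduce
      rw [hp, Complex.ofReal_one, one_pow])
  have e0 : (fun p : Nat.Primes => locChar χ E p (Units.map (algebraMap ℚ ℚ_[p]).toMonoidHom d)) =
      fun p : Nat.Primes => ((χ.loc p (Units.map (algebraMap ℚ ℚ_[p]).toMonoidHom d) : ℂˣ) : ℂ) *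
        ((‖algebraMap ℚ ℚ_[p] (d : ℚ)‖ : ℝ) : ℂ) ^ E := by
    funext p
    rw [locChar, Complex.cpow_natCast]
    rfl
  rw [e0]
  refine ⟨?_, ?_⟩
  · refine eventually_cofinite.1 ?_
    filter_upwards [h1, eventually_norm_eq_one hd0] with p h1 h2
    rw [h1, h2]; simp
  · rw [finprod_mul_distrib f1' f2]
    have e1 : ∏ᶠ p : Nat.Primes, ((χ.loc p (Units.map (algebraMap ℚ ℚ_[p]).toMonoidHom d) : ℂˣ) : ℂ) =
        ((∏ᶠ p : Nat.Primes, χ.loc p (Units.map (algebraMap ℚ ℚ_[p]).toMonoidHom d) : ℂˣ) : ℂ) :=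
      ((Units.coeHom ℂ).map_finprod f1).symm
    have e2 : ∏ᶠ p : Nat.Primes, ((‖algebraMap ℚ ℚ_[p] (d : ℚ)‖ : ℝ) : ℂ) ^ E =
        (((|((d : ℚ) : ℝ)|)⁻¹ : ℝ) : ℂ) ^ E := by
      have f3 : Function.HasFiniteMulSupport fun p : Nat.Primes =>
          ((‖algebraMap ℚ ℚ_[p] (d : ℚ)‖ : ℝ) : ℂ) :=
        eventually_cofinite.1 ((eventually_norm_eq_one hd0).mono fun p hp => by
          beta_reduce
          rw [hp, Complex.ofReal_one])
      rw [← finprod_pow f3, ← finprod_norm_eq hd0]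
      congr 1
      exact (Complex.ofRealHom.toMonoidHom.map_finprod (hasFiniteMulSupport_norm hd0)).symm
    rw [e1, e2]
    have h3 := congrArg (Units.val) (χ.trivial_on_rat d)
    rw [Units.val_mul, Units.val_one] at h3
    have h4 : ‖((Units.map (algebraMap ℚ ℝ).toMonoidHom d : ℝˣ) : ℝ)‖ = |((d : ℚ) : ℝ)| := rfl
    rw [h4, mul_mul_mul_comm, h3, one_mul, ← mul_pow, ← Complex.ofReal_mul, mul_inv_cancel₀]
    · simp
    · rw [abs_ne_zero]; exact_mod_cast hd0

/-- The global section is left invariant under the rational points of the Siegel parabolic. -/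
lemma matSection_mul_left [NeZero n] (hχ : χ.HasTypeLevel k N) (hN : N ≠ 0) {E m : ℕ}
    (hk : k = E + 2 * m) (hs : modExponent n s = E) {γ : RatMat n} {v : ℚ} (hγ : IsSimil γ v)
    (hv : v ≠ 0) {g : Matrix (Idx n ⊕ Idx n) (Idx n ⊕ Idx n) ℝ} (hg : g ∈ symplecticGroup (Idx n) ℝ)
    {A : GL (Idx n) ℚ} {X : Matrix (Idx n) (Idx n) ℚ} {w : ℚˣ}
    (hP : IsSimil (parabolicElt A X w) (w : ℚ)) :
    matSection n k N χ s (parabolicElt A X w * γ) g = matSection n k N χ s γ g := by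
  rw [matSection, matSection]
  have hPR : IsSimil (parabolicElt (mapGL' (algebraMap ℚ ℝ) A) (X.map (algebraMap ℚ ℝ))
      (Units.map (algebraMap ℚ ℝ).toMonoidHom w))
      ((Units.map (algebraMap ℚ ℝ).toMonoidHom w : ℝˣ) : ℝ) := by
    rw [← parabolicElt_map]; exact hP.map (algebraMap ℚ ℝ)
  have hγR : IsSimil (γ.map (algebraMap ℚ ℝ) * g) (algebraMap ℚ ℝ v) := by
    have := (hγ.map (algebraMap ℚ ℝ)).mul (isSimil_one_iff.2 hg)
    rwa [mul_one] at this
  have hvR : algebraMap ℚ ℝ v ≠ 0 := (map_ne_zero _).2 hv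
  rw [Matrix.map_mul, parabolicElt_map, Matrix.mul_assoc,
    sectionInfty_mul_left hχ hk hs hvR hγR hPR, dInv_map]
  have e1 : ∀ p : Nat.Primes, sectionP n N χ s p ((parabolicElt A X w * γ).map (algebraMap ℚ ℚ_[p])) =
      locChar χ E p (Units.map (algebraMap ℚ ℚ_[p]).toMonoidHom (dInv n A w)) *
        sectionP n N χ s p (γ.map (algebraMap ℚ ℚ_[p])) := by
    intro p
    rw [Matrix.map_mul, parabolicElt_map, sectionP_mul_left hχ, hs, dInv_map]
  obtain ⟨f1, h1⟩ := finprod_locChar hN hχ (E := E) (dInv n A w)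
  rw [finprod_congr e1, finprod_mul_distrib f1 (hasFiniteMulSupport_sectionP hχ hN hγ hv)]
  rw [mul_mul_mul_comm, h1, one_mul]

/-- The global section is right invariant under `Γ(N)`, diagonally embedded at all places. -/
lemma matSection_mul_right [NeZero n] (hχ : χ.HasTypeLevel k N) (γ : RatMat n)
    {δ : Matrix (Idx n ⊕ Idx n) (Idx n ⊕ Idx n) ℤ}
    (hδ : δ ∈ principalCongruence (Idx n) ℤ (N : ℤ))
    (g : Matrix (Idx n ⊕ Idx n) (Idx n ⊕ Idx n) ℝ) :
    matSection n k N χ s (γ * δ.map (Int.cast : ℤ → ℚ)) g =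
      matSection n k N χ s γ (δ.map (Int.cast : ℤ → ℝ) * g) := by
  rw [matSection, matSection]
  congr 1
  · congr 1
    rw [Matrix.map_mul, Matrix.mul_assoc]
    congr 2
  · refine finprod_congr fun p => ?_
    have h1 : (δ.map (Int.cast : ℤ → ℚ)).map (algebraMap ℚ ℚ_[p]) =
        toQp (δ.map (Int.castRingHom ℤ_[p])) := by
      ext i j; simp
    rw [Matrix.map_mul, h1]
    refine sectionP_mul_right hχ _ ?_
    have h2 : IsSimil (δ.map (Int.castRingHom ℤ_[p])) 1 := by
      simpa using (isSimil_one_iff.2 hδ.1).map (Int.castRingHom ℤ_[p])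
    by_cases hp : (p : ℕ) ∣ N
    · rw [mem_locK_of_dvd hp, ← dvd_sub_one_iff]
      refine ⟨h2, fun i j => ?_⟩
      obtain ⟨c, hc⟩ := hδ.2 i j
      obtain ⟨e, he⟩ := pow_padicValNat_dvd (p := (p : ℕ)) (n := N)
      have h3 : (δ.map (Int.castRingHom ℤ_[p]) - 1) i j = Int.castRingHom ℤ_[p] ((δ - 1) i j) := by
        rw [Matrix.sub_apply, Matrix.sub_apply, map_sub, Matrix.map_apply]
        congr 1
        by_cases hij : i = j <;> simp [Matrix.one_apply, hij]
      refine ⟨(e : ℤ_[p]) * (c : ℤ_[p]), ?_⟩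
      rw [h3, hc, map_mul, eq_intCast, eq_intCast, Int.cast_natCast, ← mul_assoc]
      congr 1
      exact_mod_cast congrArg (Nat.cast : ℕ → ℤ_[p]) he
    · exact (mem_locK_of_not_dvd hp).2 ⟨1, h2⟩

end GlobalSection

/-! ### The Eisenstein series as a sum over cosets -/

section Cosets

variable {n k N : ℕ} {χ : IdeleClassChar} {s : ℂ}

/-- The matrix underlying an element of `GSp(ℚ)`. -/
abbrev ratMat (γ : GSp (Idx n) ℚ) : RatMat n := ((γ : GL (Idx n ⊕ Idx n) ℚ) : RatMat n)

lemma exists_isSimil (γ : GSp (Idx n) ℚ) : ∃ v : ℚˣ, IsSimil (ratMat γ) (v : ℚ) := γ.2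

/-- The global section only depends on the coset. -/
lemma matSection_eq_of_mk_eq [NeZero n] (hχ : χ.HasTypeLevel k N) (hN : N ≠ 0) {E m : ℕ}
    (hk : k = E + 2 * m) (hs : modExponent n s = E) {γ γ' : GSp (Idx n) ℚ}
    (h : (Quotient.mk _ γ : Cosets n) = Quotient.mk _ γ')
    {g : Matrix (Idx n ⊕ Idx n) (Idx n ⊕ Idx n) ℝ} (hg : g ∈ symplecticGroup (Idx n) ℝ) :
    matSection n k N χ s (ratMat γ') g = matSection n k N χ s (ratMat γ) g := by
  have h1 : γ' * γ⁻¹ ∈ siegelParabolic (Idx n) ℚ := QuotientGroup.rightRel_apply.1 (Quotient.exact h)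
  obtain ⟨w, hw⟩ := exists_isSimil (γ' * γ⁻¹)
  obtain ⟨v, hv⟩ := exists_isSimil γ
  obtain ⟨A, hA⟩ := exists_parabolicElt hw h1
  have h2 : ratMat γ' = ratMat (γ' * γ⁻¹) * ratMat γ := by
    rw [ratMat, ratMat, ratMat, ← Units.val_mul, ← Subgroup.coe_mul, inv_mul_cancel_right]
  rw [h2, hA]
  rw [hA] at hw
  exact matSection_mul_left hχ hN hk hs hv v.ne_zero hg hw

/-- Right multiplication on the coset space. -/
def cosetMulRight (δ : GSp (Idx n) ℚ) : Cosets n ≃ Cosets n :=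
  Quotient.congr (Equiv.mulRight δ) fun a b => by
    rw [QuotientGroup.rightRel_apply, QuotientGroup.rightRel_apply]
    simp [mul_assoc]

lemma cosetMulRight_mk (δ γ : GSp (Idx n) ℚ) :
    cosetMulRight δ (Quotient.mk _ γ) = Quotient.mk _ (γ * δ) := rfl

lemma eisTerm_eq (g : Matrix (Idx n ⊕ Idx n) (Idx n ⊕ Idx n) ℝ) (c : Cosets n) :
    eisTerm n k N χ s g c = matSection n k N χ s (ratMat c.out) g := rfl

lemma isSimil_map_intCast {δ : Matrix (Idx n ⊕ Idx n) (Idx n ⊕ Idx n) ℤ}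
    (hδ : δ ∈ symplecticGroup (Idx n) ℤ) (R : Type) [CommRing R] :
    IsSimil (δ.map (Int.cast : ℤ → R)) 1 := by
  simpa using (isSimil_one_iff.2 hδ).map (Int.castRingHom R)

lemma exists_ratMat_eq {δ : Matrix (Idx n ⊕ Idx n) (Idx n ⊕ Idx n) ℤ}
    (hδ : δ ∈ symplecticGroup (Idx n) ℤ) :
    ∃ γ : GSp (Idx n) ℚ, ratMat γ = δ.map (Int.cast : ℤ → ℚ) := by
  have h1 := isSimil_map_intCast hδ ℚ
  obtain ⟨δ', -, h2, h3⟩ := IsSimil.exists_inv (u := 1) h1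
  exact ⟨⟨⟨δ.map (Int.cast : ℤ → ℚ), δ', h2, h3⟩, ⟨1, h1⟩⟩, rfl⟩

/-- The adelic Eisenstein series is left invariant under `Γ(N)` as a function of its real
argument. -/
lemma eisSeries_mul_left [NeZero n] (hχ : χ.HasTypeLevel k N) (hN : N ≠ 0) {E m : ℕ}
    (hk : k = E + 2 * m) (hs : modExponent n s = E)
    {δ : Matrix (Idx n ⊕ Idx n) (Idx n ⊕ Idx n) ℤ}
    (hδ : δ ∈ principalCongruence (Idx n) ℤ (N : ℤ))
    {g : Matrix (Idx n ⊕ Idx n) (Idx n ⊕ Idx n) ℝ} (hg : g ∈ symplecticGroup (Idx n) ℝ) :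
    eisSeries n k N χ s (δ.map (Int.cast : ℤ → ℝ) * g) = eisSeries n k N χ s g := by
  obtain ⟨δ', hδ'⟩ := exists_ratMat_eq hδ.1
  rw [eisSeries, eisSeries, ← (cosetMulRight δ').tsum_eq (eisTerm n k N χ s g)]
  refine tsum_congr fun c => ?_
  rw [eisTerm_eq, eisTerm_eq, ← matSection_mul_right hχ _ hδ, ← hδ']
  have h1 : ratMat c.out * ratMat δ' = ratMat (c.out * δ') := by
    rw [ratMat, ratMat, ratMat, ← Units.val_mul, ← Subgroup.coe_mul]
  rw [h1]
  refine matSection_eq_of_mk_eq hχ hN hk hs ?_ hg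
  rw [Quotient.out_eq, ← cosetMulRight_mk, Quotient.out_eq]

end Cosets

/-! ### Denominators of rational symmetric matrices -/

section Denominator

variable {l : Type} [Fintype l] [DecidableEq l]

/-- Every lattice in `ℚ^l`, i.e. finitely generated subgroup containing `ℤ^l`, has a basis
indexed by `l`. -/
lemma exists_basis_closure_eq (L : Submodule ℤ (l → ℚ)) [Module.Finite ℤ L]
    (hL : ∀ i, Pi.single i (1 : ℚ) ∈ L) :
    ∃ b : Module.Basis l ℚ (l → ℚ), L.toAddSubgroup = AddSubgroup.closure (Set.range b) := by
  have : Module.IsTorsionFree ℤ L := inferInstance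
  have : Module.Free ℤ L := inferInstance
  let b := Module.Free.chooseBasis ℤ L
  let v : Module.Free.ChooseBasisIndex ℤ L → (l → ℚ) := L.subtype ∘ b
  have hspan : Submodule.span ℤ (Set.range v) = L := by
    rw [Set.range_comp, Submodule.span_image, b.span_eq, Submodule.map_top, Submodule.range_subtype]
  have hli : LinearIndependent ℚ v := by
    rw [← LinearIndependent.iff_fractionRing ℤ ℚ]
    exact b.linearIndependent.map' L.subtype (Submodule.ker_subtype _)
  have htop : ⊤ ≤ Submodule.span ℚ (Set.range v) := by
    rw [← (Pi.basisFun ℚ l).span_eq, Submodule.span_le]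
    rintro _ ⟨i, rfl⟩
    have h1 : Pi.single i (1 : ℚ) ∈ Submodule.span ℤ (Set.range v) := by
      rw [hspan]; exact hL i
    rw [Pi.basisFun_apply]
    exact Submodule.span_le_restrictScalars ℤ ℚ _ h1
  let b' := Module.Basis.mk hli htop
  refine ⟨b'.reindex (b'.indexEquiv (Pi.basisFun ℚ l)), ?_⟩
  rw [Module.Basis.range_reindex]
  have h3 : Set.range b' = Set.range v := by rw [Module.Basis.coe_mk]
  rw [h3, ← Submodule.span_int_eq_addSubgroupClosure]
  exact congrArg Submodule.toAddSubgroup hspan.symm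

/-- Reduction modulo `ℤ`. -/
def modZ (R : Matrix l l ℚ) : l → l → QmodZ := fun i j => (R i j : QmodZ)

/-- A rational symmetric matrix `R` has a denominator `M⁻¹`: the columns of `M` span the lattice
`ℤ^l + R ℤ^l`, whose index over `ℤ^l` is `|det M|⁻¹` and at least the order of the subgroup of
`(ℚ/ℤ)^l` generated by the rows of `R`. -/
lemma exists_denominator {R : Matrix l l ℚ} (hR : Rᵀ = R) :
    ∃ (M : Matrix l l ℚ) (X Y : Matrix l l ℤ),
      M = X.map (Int.cast : ℤ → ℚ) + R * Y.map (Int.cast : ℤ → ℚ) ∧ M.det ≠ 0 ∧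
      (rowDenom (modZ R) : ℚ) ≤ |M.det|⁻¹ := by
  let φ : (l → ℤ) × (l → ℤ) →ₗ[ℤ] (l → ℚ) := AddMonoidHom.toIntLinearMap
    (AddMonoidHom.mk' (fun z => (fun i => (z.1 i : ℚ)) + R *ᵥ fun i => (z.2 i : ℚ)) fun z w => by
      ext i
      simp only [Prod.fst_add, Prod.snd_add, Pi.add_apply, Int.cast_add, mulVec, dotProduct,
        mul_add, Finset.sum_add_distrib]
      ring)
  let L : AddSubgroup (l → ℚ) := (LinearMap.range φ).toAddSubgroup
  have hL : ∀ x : l → ℤ, (fun i => (x i : ℚ)) ∈ LinearMap.range φ := fun x => ⟨(x, 0), by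
    ext i
    change (x i : ℚ) + (R *ᵥ fun i => (((0 : l → ℤ) i : ℤ) : ℚ)) i = x i
    simp [mulVec, dotProduct]⟩
  have hL1 : ∀ i, Pi.single i (1 : ℚ) ∈ LinearMap.range φ := fun i => by
    have := hL (Pi.single i 1)
    convert this using 1
    ext j
    by_cases h : j = i
    · subst h; simp
    · simp [h]
  obtain ⟨b, hb⟩ := exists_basis_closure_eq (LinearMap.range φ) hL1
  let L₁ : AddSubgroup (l → ℚ) := AddSubgroup.closure (Set.range (Pi.basisFun ℚ l))
  have hle : L₁ ≤ L := by
    rw [AddSubgroup.closure_le]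
    rintro _ ⟨i, rfl⟩
    rw [Pi.basisFun_apply]
    exact hL1 i
  have hidx := AddSubgroup.relIndex_eq_abs_det L₁ L hle (Pi.basisFun ℚ l) b rfl hb
  let M : Matrix l l ℚ := fun i j => b j i
  have hM : M = (Pi.basisFun ℚ l).toMatrix b := by
    ext i j; simp [M, Module.Basis.toMatrix_apply]
  have hMdet : b.det (Pi.basisFun ℚ l) * M.det = 1 := by
    rw [Module.Basis.det_apply, hM, ← det_mul, Module.Basis.toMatrix_mul_toMatrix_flip, det_one]
  have hMem : ∀ j, ∃ z, φ z = b j := fun j => by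
    have : b j ∈ L := by
      change b j ∈ (LinearMap.range φ).toAddSubgroup
      rw [hb]
      exact AddSubgroup.subset_closure ⟨j, rfl⟩
    exact this
  choose z hz using hMem
  refine ⟨M, fun i j => (z j).1 i, fun i j => (z j).2 i, ?_, right_ne_zero_of_mul_eq_one hMdet, ?_⟩
  · ext i j
    have := congrFun (hz j) i
    rw [Matrix.add_apply, Matrix.mul_apply]
    exact this.symm
  · rw [← eq_inv_of_mul_eq_one_left hMdet |> congrArg abs |>.trans (abs_inv _), ← hidx]
    let π : (l → ℚ) →+ (l → QmodZ) :=
      { toFun := fun x i => (x i : QmodZ)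
        map_zero' := rfl
        map_add' := fun _ _ => rfl }
    have hker : L₁ ≤ π.ker := by
      rw [AddSubgroup.closure_le]
      rintro _ ⟨i, rfl⟩
      rw [Pi.basisFun_apply]
      change π _ = 0
      ext j
      by_cases h : j = i
      · subst h
        change ((Pi.single j (1 : ℚ) : l → ℚ) j : QmodZ) = 0
        rw [Pi.single_eq_same]
        exact AddCircle.coe_period 1
      · change ((Pi.single i (1 : ℚ) : l → ℚ) j : QmodZ) = 0
        rw [Pi.single_eq_of_ne h]
        rfl
    have hne : L₁.relIndex L ≠ 0 := by
      intro h0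
      rw [h0, Nat.cast_zero, eq_comm, abs_eq_zero] at hidx
      rw [hidx, zero_mul] at hMdet
      exact zero_ne_one hMdet
    have h1 : π.ker.relIndex L ∣ L₁.relIndex L := AddSubgroup.relIndex_dvd_of_le_left L hker
    rw [AddSubgroup.relIndex_ker] at h1
    have h2 : rowGroup (modZ R) ≤ L.map π := by
      rw [rowGroup, AddSubgroup.closure_le]
      rintro _ ⟨i, rfl⟩
      refine ⟨φ (0, Pi.single i 1), ⟨_, rfl⟩, ?_⟩
      ext j
      change ((((0 : l → ℤ) j : ℤ) : ℚ) + (R *ᵥ fun a => ((Pi.single i (1 : ℤ) : l → ℤ) a : ℚ)) j :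
        ℚ) = ((R i j : ℚ) : QmodZ)
      have h3 : (fun a => (((Pi.single i (1 : ℤ) : l → ℤ) a : ℤ) : ℚ)) = Pi.single i (1 : ℚ) := by
        ext a
        by_cases h : a = i
        · subst h; simp
        · simp [h]
      rw [h3, mulVec_single_one, col_apply]
      have h4 : R j i = R i j := congrFun (congrFun hR i) j
      simp [h4]
    have h5 : Nat.card (L.map π) ≠ 0 := fun h => hne (by rw [h] at h1; exact zero_dvd_iff.1 h1)
    have : Finite (L.map π) := Nat.finite_of_card_ne_zero h5
    have h6 : rowDenom (modZ R) ≤ Nat.card (L.map π) :=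
      Nat.card_le_card_of_injective _ (AddSubgroup.inclusion_injective h2)
    exact_mod_cast h6.trans (Nat.le_of_dvd (Nat.pos_of_ne_zero hne) h1)

end Denominator

/-! ### Unitarity of the character -/

section Unitary

variable {k N : ℕ} {χ : IdeleClassChar}

/-- The restriction of `χ_p` to the units of `ℤ_p` has finite order. -/
lemma norm_loc_of_norm_eq_one (hχ : χ.HasTypeLevel k N) (p : Nat.Primes) {u : ℚ_[p]ˣ}
    (hu : ‖(u : ℚ_[p])‖ = 1) : ‖(χ.loc p u : ℂ)‖ = 1 := by
  by_cases hp : (p : ℕ) ∣ N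
  · -- The unit group of `ℤ/p^m` is finite, so a power of `u` is congruent to one.
    set m := padicValNat p N
    let z : ℤ_[p] := ⟨u, hu.le⟩
    obtain ⟨w, hw⟩ := PadicInt.isUnit_iff.2 (show ‖z‖ = 1 from hu)
    have hpos : 0 < (p : ℕ) ^ m := pow_pos p.2.pos _
    have : NeZero ((p : ℕ) ^ m) := ⟨hpos.ne'⟩
    obtain ⟨t, ht, h1⟩ : ∃ t : ℕ, t ≠ 0 ∧
        (Units.map (PadicInt.toZModPow (p := p) m).toMonoidHom w) ^ t = 1 :=
      ⟨orderOf _, (orderOf_pos _).ne', pow_orderOf_eq_one _⟩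
    have h2 : PadicInt.toZModPow (p := p) m (z ^ t - 1) = 0 := by
      have := congrArg Units.val h1
      rw [map_sub, map_one, sub_eq_zero, map_pow, ← hw]
      simpa using this
    have h3 : ‖z ^ t - 1‖ ≤ ((p : ℕ) : ℝ) ^ (-(m : ℤ)) := by
      rw [PadicInt.norm_le_pow_iff_mem_span_pow, ← PadicInt.ker_toZModPow]
      exact h2
    have h4 : χ.loc p (u ^ t) = 1 := by
      refine hχ.ram p hp _ ?_ ?_
      · rw [Units.val_pow_eq_pow_val, norm_pow, hu, one_pow]
      · have : ((z ^ t - 1 : ℤ_[p]) : ℚ_[p]) = ((u ^ t : ℚ_[p]ˣ) : ℚ_[p]) - 1 := by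
          rw [Units.val_pow_eq_pow_val]; push_cast; rfl
        rw [← this]; exact h3
    rw [map_pow] at h4
    have h5 : ‖(χ.loc p u : ℂ)‖ ^ t = 1 := by
      rw [← norm_pow, ← Units.val_pow_eq_pow_val, h4, Units.val_one, norm_one]
    exact (pow_eq_one_iff_of_nonneg (norm_nonneg _) ht).1 h5
  · rw [hχ.unram p hp u hu, Units.val_one, norm_one]

/-- At the rational idele `p` all components of `χ` other than `χ_p` are evaluated at units, or at a
positive real number. -/
lemma norm_loc_prime (hχ : χ.HasTypeLevel k N) (p : Nat.Primes) {u : ℚ_[p]ˣ}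
    (hu : (u : ℚ_[p]) = ((p : ℕ) : ℚ_[p])) : ‖(χ.loc p u : ℂ)‖ = 1 := by
  let a : ℚˣ := Units.mk0 ((p : ℕ) : ℚ) (by exact_mod_cast p.2.ne_zero)
  have h := congrArg (fun x : ℂˣ => ‖(x : ℂ)‖) (χ.trivial_on_rat a)
  have hne : ∀ q : Nat.Primes, q ≠ p →
      ‖((χ.loc q (Units.map (algebraMap ℚ ℚ_[q]).toMonoidHom a) : ℂˣ) : ℂ)‖ = 1 := by
    intro q hq
    refine norm_loc_of_norm_eq_one hχ q ?_
    change ‖algebraMap ℚ ℚ_[q] ((p : ℕ) : ℚ)‖ = 1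
    rw [map_natCast, Padic.norm_natCast_eq_one_iff]
    exact (Nat.coprime_primes q.2 p.2).2 fun h => hq (Subtype.ext h)
  have hfin : Function.HasFiniteMulSupport fun q : Nat.Primes =>
      χ.loc q (Units.map (algebraMap ℚ ℚ_[q]).toMonoidHom a) := by
    refine Filter.eventually_cofinite.1 ?_
    filter_upwards [χ.unramified, eventually_norm_eq_one a.ne_zero] with q h1 h2
    exact h1 _ h2
  let nrm : ℂˣ →* ℝ := (normHom : ℂ →*₀ ℝ).toMonoidHom.comp (Units.coeHom ℂ)
  have h2 : ‖((∏ᶠ q : Nat.Primes, χ.loc q (Units.map (algebraMap ℚ ℚ_[q]).toMonoidHom a) : ℂˣ) : ℂ)‖ =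
      ‖((χ.loc p (Units.map (algebraMap ℚ ℚ_[p]).toMonoidHom a) : ℂˣ) : ℂ)‖ :=
    (nrm.map_finprod hfin).trans (finprod_eq_single _ p hne)
  have h3 : ‖((χ.arch (Units.map (algebraMap ℚ ℝ).toMonoidHom a) : ℂˣ) : ℂ)‖ = 1 := by
    rw [hχ.arch_eq]
    have : SignType.sign ((Units.map (algebraMap ℚ ℝ).toMonoidHom a : ℝˣ) : ℝ) = 1 := by
      rw [sign_eq_one_iff]
      change 0 < algebraMap ℚ ℝ ((p : ℕ) : ℚ)
      rw [map_natCast]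
      exact_mod_cast p.2.pos
    rw [this]; simp
  simp only [Units.val_mul, norm_mul, Units.val_one, norm_one] at h
  rw [h2, h3, one_mul] at h
  rw [← h]
  congr 3
  refine Units.ext ?_
  rw [hu]
  exact (map_natCast (algebraMap ℚ ℚ_[p]) (p : ℕ)).symm

/-- The local components of `χ` are unitary: `d` is a power of `p` times a unit. -/
lemma norm_loc (hχ : χ.HasTypeLevel k N) (p : Nat.Primes) (d : ℚ_[p]ˣ) :
    ‖(χ.loc p d : ℂ)‖ = 1 := by
  let π : ℚ_[p]ˣ := Units.mk0 ((p : ℕ) : ℚ_[p]) (by exact_mod_cast p.2.ne_zero)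
  obtain ⟨a, ha⟩ : ∃ a : ℤ, ‖(d : ℚ_[p])‖ = ((p : ℕ) : ℝ) ^ (-a) :=
    ⟨_, Padic.norm_eq_zpow_neg_valuation d.ne_zero⟩
  have hp0 : ((p : ℕ) : ℝ) ≠ 0 := by exact_mod_cast p.2.ne_zero
  have h1 : ‖((d * (π ^ a)⁻¹ : ℚ_[p]ˣ) : ℚ_[p])‖ = 1 := by
    rw [Units.val_mul, norm_mul, ha, Units.val_inv_eq_inv_val, Units.val_zpow_eq_zpow_val, norm_inv,
      norm_zpow]
    have : ‖(π : ℚ_[p])‖ = ((p : ℕ) : ℝ)⁻¹ := Padic.norm_p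
    rw [this, _root_.inv_zpow, inv_inv, ← zpow_add₀ hp0, neg_add_cancel, zpow_zero]
  have h2 := norm_loc_of_norm_eq_one hχ p h1
  have h3 := norm_loc_prime hχ p (u := π) rfl
  rw [map_mul, map_inv, map_zpow, Units.val_mul, norm_mul, Units.val_inv_eq_inv_val,
    Units.val_zpow_eq_zpow_val, norm_inv, norm_zpow, h3, _root_.one_zpow, inv_one, mul_one] at h2
  exact h2

lemma norm_locChar (hχ : χ.HasTypeLevel k N) {p : Nat.Primes} (E : ℕ) (d : ℚ_[p]ˣ) :
    ‖locChar χ E p d‖ = ‖(d : ℚ_[p])‖ ^ E := by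
  rw [locChar, norm_mul, norm_loc hχ, one_mul, Complex.cpow_natCast, norm_pow, Complex.norm_real,
    norm_norm]

end Unitary

/-! ### Moving the lower left block into general position -/

section Swap

variable {l : Type} [Fintype l] [DecidableEq l] {R S : Type} [CommRing R] [CommRing S]

/-- The diagonal matrix with ones at the places in `s`. -/
def indic (R : Type) [CommRing R] (s : Finset l) : Matrix l l R :=
  diagonal fun i => if i ∈ s then 1 else 0

lemma indic_transpose (s : Finset l) : (indic R s)ᵀ = indic R s := diagonal_transpose _

lemma indic_map (f : R →+* S) (s : Finset l) : (indic R s).map f = indic S s := by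
  rw [indic, diagonal_map (map_zero f), indic]
  congr 1
  funext i
  by_cases h : i ∈ s <;> simp [h]

lemma indic_mul_self (s : Finset l) : indic R s * indic R s = indic R s := by
  rw [indic, diagonal_mul_diagonal]
  congr 1
  funext i
  by_cases h : i ∈ s <;> simp [h]

lemma indic_mul_compl (s : Finset l) : indic R s * indic R sᶜ = 0 := by
  rw [indic, indic, diagonal_mul_diagonal, ← diagonal_zero]
  congr 1
  funext i
  by_cases h : i ∈ s <;> simp [h]

lemma indic_compl_mul (s : Finset l) : indic R sᶜ * indic R s = 0 := by
  simpa using indic_mul_compl (R := R) sᶜ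

lemma indic_add_compl (s : Finset l) : indic R s + indic R sᶜ = 1 := by
  rw [indic, indic, diagonal_add, ← diagonal_one]
  congr 1
  funext i
  by_cases h : i ∈ s <;> simp [h]

/-- The symplectic matrix that exchanges, up to sign, the coordinates outside `s` in the two
halves. -/
def swapMat (R : Type) [CommRing R] (s : Finset l) : Matrix (l ⊕ l) (l ⊕ l) R :=
  fromBlocks (indic R s) (-indic R sᶜ) (indic R sᶜ) (indic R s)

lemma swapMat_map (f : R →+* S) (s : Finset l) : (swapMat R s).map f = swapMat S s := by
  rw [swapMat, fromBlocks_map, indic_map, indic_map, swapMat]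
  congr 1
  rw [Matrix.map_neg _ (map_neg f), indic_map]

lemma isSimil_swapMat (s : Finset l) : IsSimil (swapMat R s) 1 := by
  refine isSimil_of_blocks ?_ ?_ ?_
  · rw [indic_transpose, indic_transpose, indic_mul_compl, indic_compl_mul]
  · rw [transpose_neg, indic_transpose, indic_transpose, Matrix.neg_mul, Matrix.mul_neg,
      indic_mul_compl, indic_compl_mul]
  · rw [indic_transpose, indic_transpose, Matrix.mul_neg, indic_mul_self, indic_mul_self,
      sub_neg_eq_add, indic_add_compl, one_smul]

lemma swapMat_mul_transpose (s : Finset l) : swapMat R s * (swapMat R s)ᵀ = 1 := by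
  rw [swapMat, fromBlocks_transpose, fromBlocks_multiply, ← fromBlocks_one]
  simp only [transpose_neg, indic_transpose, Matrix.mul_neg, Matrix.neg_mul, neg_neg,
    indic_mul_self, indic_mul_compl, indic_compl_mul, indic_add_compl, neg_zero, add_zero]
  rw [add_comm, indic_add_compl]

lemma norm_autFactor_mul_swapMat (g : Matrix (l ⊕ l) (l ⊕ l) ℝ) (s : Finset l) :
    ‖autFactor (g * swapMat ℝ s) (basePoint l)‖ = ‖autFactor g (basePoint l)‖ := by
  have h1 : IsUnit (denom (swapMat ℝ s) (basePoint l)).det :=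
    isUnit_denom (isSimil_swapMat s) one_ne_zero basePoint_mem
  have hI : ∀ t : Finset l, cplx (indic ℝ t) = indic ℂ t := fun t => indic_map Complex.ofRealHom t
  have h2 : moebius (swapMat ℝ s) (basePoint l) = basePoint l := by
    have h3 : numer (swapMat ℝ s) (basePoint l) =
        Complex.I • denom (swapMat ℝ s) (basePoint l) := by
      rw [denom_basePoint, numer, basePoint, swapMat, toBlocks_fromBlocks₁₁, toBlocks_fromBlocks₁₂,
        toBlocks_fromBlocks₂₁, toBlocks_fromBlocks₂₂, Matrix.mul_smul, Matrix.mul_one, smul_add,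
        smul_smul, Complex.I_mul_I, neg_one_smul, add_comm]
      congr 1
      ext i j
      simp
    change numer (swapMat ℝ s) (basePoint l) * _ = _
    rw [h3, Matrix.smul_mul, mul_nonsing_inv _ h1, basePoint]
  rw [autFactor_mul g h1, h2, norm_mul,
    norm_autFactor_of_orthogonal (isSimil_one_iff.1 (isSimil_swapMat s)) (swapMat_mul_transpose s),
    mul_one]

lemma mul_swapMat_toBlocks₂₁ (g : Matrix (l ⊕ l) (l ⊕ l) R) (s : Finset l) :
    (g * swapMat R s).toBlocks₂₁ = g.toBlocks₂₁ * indic R s + g.toBlocks₂₂ * indic R sᶜ := by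
  rw [toBlocks₂₁_mul, swapMat, toBlocks_fromBlocks₁₁, toBlocks_fromBlocks₂₁]

/-- Multilinear expansion of `det (iC + D)` in the columns: for one of the `2^d` choices of
columns of `C` and `D`, the resulting determinant is comparable with `det (iC + D)`. -/
lemma exists_swap_norm_le (g : Matrix (l ⊕ l) (l ⊕ l) ℝ) :
    ∃ s : Finset l, ‖autFactor g (basePoint l)‖ ≤
      2 ^ Fintype.card l * |((g * swapMat ℝ s).toBlocks₂₁).det| := by
  set C := g.toBlocks₂₁ with hC
  set D := g.toBlocks₂₂ with hD
  have h1 : autFactor g (basePoint l) = ∑ s : Finset l,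
      (∏ i, if i ∈ s then Complex.I else 1) * (((g * swapMat ℝ s).toBlocks₂₁).det : ℂ) := by
    rw [autFactor, denom_basePoint, ← det_transpose]
    have h2 := (detRowAlternating (n := l) (R := ℂ)).toMultilinearMap.map_add_univ
      (fun i j => Complex.I * cplx C j i) (fun i j => cplx D j i)
    refine Eq.trans (Eq.trans ?_ h2) (Finset.sum_congr rfl fun s _ => ?_)
    · change _ = Matrix.det _
      congr 1
    · rw [← cplx_det, ← det_transpose, ← det_mul_column]
      change Matrix.det _ = _
      congr 1
      ext i j
      rw [mul_swapMat_toBlocks₂₁]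
      by_cases hi : i ∈ s
      · simp [Finset.piecewise, hi, indic, mul_diagonal, ← hC]
      · simp [Finset.piecewise, hi, indic, mul_diagonal, ← hD]
  obtain ⟨s, -, hs⟩ := Finset.exists_max_image (Finset.univ : Finset (Finset l))
    (fun s => |((g * swapMat ℝ s).toBlocks₂₁).det|) Finset.univ_nonempty
  refine ⟨s, ?_⟩
  rw [h1]
  refine (norm_sum_le _ _).trans ((Finset.sum_le_card_nsmul _ _
    |((g * swapMat ℝ s).toBlocks₂₁).det| fun t ht => ?_).trans ?_)
  · rw [norm_mul, norm_prod, Complex.norm_real, Real.norm_eq_abs, Finset.prod_eq_one, one_mul]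
    · exact hs t (Finset.mem_univ _)
    · intro i _
      split_ifs <;> simp
  · rw [Finset.card_univ, Fintype.card_finset, nsmul_eq_mul]
    push_cast
    rfl

end Swap

/-! ### Entries of a matrix in terms of the determinant of `1 + R Rᵗ` -/

section DetBound

variable {l : Type} [Fintype l] [DecidableEq l]

lemma one_add_sum_le_prod {ι : Type} (s : Finset ι) {f : ι → ℝ} (hf : ∀ i ∈ s, 0 ≤ f i) :
    1 + ∑ i ∈ s, f i ≤ ∏ i ∈ s, (1 + f i) := by
  classical
  induction s using Finset.induction_on with
  | empty => simp
  | insert a s ha ih =>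
    rw [Finset.sum_insert ha, Finset.prod_insert ha]
    have h1 := ih fun i hi => hf i (Finset.mem_insert_of_mem hi)
    have h2 := hf a (Finset.mem_insert_self _ _)
    have h3 : 0 ≤ ∑ i ∈ s, f i :=
      Finset.sum_nonneg fun i hi => hf i (Finset.mem_insert_of_mem hi)
    nlinarith

/-- `1 + ∑ λ_i ≤ ∏ (1 + λ_i)` for the eigenvalues of `S`. -/
lemma one_add_trace_le_det {S : Matrix l l ℝ} (hS : S.PosSemidef) : 1 + S.trace ≤ (1 + S).det := by
  have h1 := S.eval_charpoly (-1)
  rw [hS.1.charpoly_eq, Polynomial.eval_prod] at h1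
  have h2 : (Matrix.scalar l (-1 : ℝ) - S) = -(1 + S) := by
    rw [neg_add, sub_eq_add_neg, map_neg, map_one]
  rw [h2, det_neg] at h1
  have h3 : (1 + S).det = ∏ i, (1 + hS.1.eigenvalues i) := by
    have h4 : ((-1 : ℝ) ^ Fintype.card l) * ((-1 : ℝ) ^ Fintype.card l) = 1 := by
      rw [← mul_pow]; simp
    have h5 : ∏ i, Polynomial.eval (-1) (Polynomial.X - Polynomial.C (hS.1.eigenvalues i : ℝ)) =
        (-1 : ℝ) ^ Fintype.card l * ∏ i, (1 + hS.1.eigenvalues i) := by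
      rw [Fintype.card, ← Finset.prod_const, ← Finset.prod_mul_distrib]
      refine Finset.prod_congr rfl fun i _ => ?_
      rw [Polynomial.eval_sub, Polynomial.eval_X, Polynomial.eval_C]
      ring
    have h6 := h5.symm.trans h1
    have h7 := congrArg (fun x => (-1 : ℝ) ^ Fintype.card l * x) h6
    simp only [← mul_assoc, h4, one_mul] at h7
    exact h7.symm
  rw [h3, hS.1.trace_eq_sum_eigenvalues]
  exact one_add_sum_le_prod _ fun i _ => hS.eigenvalues_nonneg i

lemma one_add_sq_le_det (R : Matrix l l ℝ) (i j : l) :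
    1 + R i j ^ 2 ≤ (1 + R * Rᵀ).det := by
  have h1 : (R * Rᵀ).PosSemidef := by
    have := posSemidef_self_mul_conjTranspose R
    rwa [conjTranspose_eq_transpose_of_trivial] at this
  refine le_trans ?_ (one_add_trace_le_det h1)
  have h2 : (R * Rᵀ).trace = ∑ a, ∑ b, R a b ^ 2 := by
    simp only [trace, diag_apply, Matrix.mul_apply, transpose_apply, sq]
  rw [h2]
  have h3 : R i j ^ 2 ≤ ∑ b, R i b ^ 2 :=
    Finset.single_le_sum (f := fun b => R i b ^ 2) (fun b _ => sq_nonneg _) (Finset.mem_univ j)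
  have h4 : ∑ b, R i b ^ 2 ≤ ∑ a, ∑ b, R a b ^ 2 :=
    Finset.single_le_sum (f := fun a => ∑ b, R a b ^ 2)
      (fun a _ => Finset.sum_nonneg fun b _ => sq_nonneg _) (Finset.mem_univ i)
  linarith

lemma one_le_det_one_add (R : Matrix l l ℝ) : 1 ≤ (1 + R * Rᵀ).det := by
  have h1 : (R * Rᵀ).PosSemidef := by
    have := posSemidef_self_mul_conjTranspose R
    rwa [conjTranspose_eq_transpose_of_trivial] at this
  have := one_add_trace_le_det h1
  linarith [h1.trace_nonneg]

end DetBound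

/-! ### Coordinates on the coset space -/

section Coordinates

variable {n : ℕ}

/-- The data `s`, `R = C⁻¹D` attached to a similitude `γ`, where `(C, D)` is the lower half of
`γ w` with `w` the element that swaps the coordinates outside `s`. -/
structure IsCoord (γ : RatMat n) (s : Finset (Idx n)) (R : Matrix (Idx n) (Idx n) ℚ) : Prop where
  det_ne : (γ * swapMat ℚ s).toBlocks₂₁.det ≠ 0
  mul_eq : (γ * swapMat ℚ s).toBlocks₂₁ * R = (γ * swapMat ℚ s).toBlocks₂₂
  symm : Rᵀ = R
  abs_le : ∀ i j, |R i j| ≤ 2 ^ (2 * n)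
  det_le : |(((γ * swapMat ℚ s).toBlocks₂₁.det : ℚ) : ℝ)| ≤
    ‖autFactor (γ.map (algebraMap ℚ ℝ)) (basePoint (Idx n))‖

/-- For the choice of `s` from `exists_swap_norm_le`, the identity
`|j(γ, i)|² = (det C)² det (1 + R ᵗR)` bounds the entries of `R`. -/
lemma exists_isCoord {γ : RatMat n} {v : ℚ} (hγ : IsSimil γ v) (hv : v ≠ 0) :
    ∃ s R, IsCoord γ s R := by
  set f := algebraMap ℚ ℝ with hf
  have hγR : IsSimil (γ.map f) (f v) := hγ.map f
  have hvR : f v ≠ 0 := (map_ne_zero f).2 hv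
  obtain ⟨s, hs⟩ := exists_swap_norm_le (γ.map f)
  have hj : 0 < ‖autFactor (γ.map f) (basePoint (Idx n))‖ :=
    norm_pos_iff.2 (isUnit_denom hγR hvR basePoint_mem).ne_zero
  set G := γ * swapMat ℚ s with hG
  have hGmap : G.map f = γ.map f * swapMat ℝ s := by rw [hG, Matrix.map_mul, swapMat_map]
  set C := G.toBlocks₂₁ with hC
  set D := G.toBlocks₂₂ with hD
  have hCmap : (γ.map f * swapMat ℝ s).toBlocks₂₁ = C.map f := by rw [← hGmap]; rfl
  have hDmap : (γ.map f * swapMat ℝ s).toBlocks₂₂ = D.map f := by rw [← hGmap]; rfl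
  have hdet : (C.map f).det = f C.det := (RingHom.map_det f C).symm
  rw [hCmap, hdet] at hs
  have hC0 : C.det ≠ 0 := by
    intro h0
    rw [h0, map_zero, abs_zero, mul_zero] at hs
    exact absurd hs (not_le.2 hj)
  have hCu : IsUnit C.det := isUnit_iff_ne_zero.2 hC0
  have hCu' : IsUnit Cᵀ.det := by rwa [det_transpose]
  have hGs : IsSimil G v := by simpa using hγ.mul (isSimil_swapMat s)
  have hCD : C * Dᵀ = D * Cᵀ := (hGs.blocks' (isUnit_iff_ne_zero.2 hv)).1
  set R := C⁻¹ * D with hR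
  have hCR : C * R = D := by rw [hR, ← Matrix.mul_assoc, mul_nonsing_inv _ hCu, Matrix.one_mul]
  have hsymm : Rᵀ = R := by
    rw [← hCR, transpose_mul, Matrix.mul_assoc] at hCD
    have h1 := congrArg (fun M => C⁻¹ * M * Cᵀ⁻¹) hCD
    simp only [← Matrix.mul_assoc, nonsing_inv_mul _ hCu, Matrix.one_mul] at h1
    rwa [Matrix.mul_assoc, Matrix.mul_assoc, mul_nonsing_inv _ hCu', Matrix.mul_one,
      Matrix.mul_one] at h1
  have hCDR : C.map f * (D.map f)ᵀ = D.map f * (C.map f)ᵀ := by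
    have := congrArg (fun M : Matrix (Idx n) (Idx n) ℚ => M.map f) hCD
    simpa only [Matrix.map_mul, transpose_map] using this
  have hDR : D.map f = C.map f * R.map f := by rw [← Matrix.map_mul, hCR]
  have hnorm : ‖autFactor (γ.map f) (basePoint (Idx n))‖ ^ 2 =
      (f C.det) ^ 2 * (1 + R.map f * (R.map f)ᵀ).det := by
    rw [← norm_autFactor_mul_swapMat _ s, autFactor, denom_basePoint, hCmap, hDmap,
      norm_sq_det_smul_I_add hCDR, hDR, ← hdet]
    have : C.map f * (C.map f)ᵀ + C.map f * R.map f * (C.map f * R.map f)ᵀ =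
        C.map f * (1 + R.map f * (R.map f)ᵀ) * (C.map f)ᵀ := by
      rw [transpose_mul]; noncomm_ring
    rw [this, det_mul, det_mul, det_transpose]
    ring
  have hc2 : 0 < (f C.det) ^ 2 := by
    have : f C.det ≠ 0 := (map_ne_zero f).2 hC0
    positivity
  refine ⟨s, R, hC0, hCR, hsymm, fun i j => ?_, ?_⟩
  · have h1 : ‖autFactor (γ.map f) (basePoint (Idx n))‖ ^ 2 ≤ (2 ^ (2 * n)) ^ 2 * (f C.det) ^ 2 := by
      rw [← sq_abs (f C.det), ← mul_pow]
      have : Fintype.card (Idx n) = 2 * n := by simp; ring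
      rw [this] at hs
      exact pow_le_pow_left₀ hj.le hs 2
    rw [hnorm, mul_comm] at h1
    have h2 := le_of_mul_le_mul_right h1 hc2
    have h3 := one_add_sq_le_det (R.map f) i j
    have h4 : (f (R i j)) ^ 2 ≤ (2 ^ (2 * n)) ^ 2 := by
      rw [Matrix.map_apply] at h3; linarith
    have h5 := abs_le_of_sq_le_sq h4 (by positivity)
    rw [hf, eq_ratCast] at h5
    exact_mod_cast h5
  · refine abs_le_of_sq_le_sq' ?_ (norm_nonneg _) |> abs_le.2
    rw [hnorm]
    exact le_mul_of_one_le_right hc2.le (one_le_det_one_add _)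

lemma exists_ratMat_eq_swap (s : Finset (Idx n)) :
    ∃ w : GSp (Idx n) ℚ, ratMat w = swapMat ℚ s := by
  have h1 : IsSimil (swapMat ℚ s) 1 := isSimil_swapMat s
  obtain ⟨δ', -, h2, h3⟩ := IsSimil.exists_inv (u := 1) h1
  exact ⟨⟨⟨swapMat ℚ s, δ', h2, h3⟩, ⟨1, h1⟩⟩, rfl⟩

/-- The pair `(s, R)` determines the coset of `γ`. -/
lemma IsCoord.mk_eq {γ γ' : GSp (Idx n) ℚ} {s : Finset (Idx n)} {R : Matrix (Idx n) (Idx n) ℚ}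
    (h : IsCoord (ratMat γ) s R) (h' : IsCoord (ratMat γ') s R) :
    (Quotient.mk _ γ : Cosets n) = Quotient.mk _ γ' := by
  obtain ⟨w, hw⟩ := exists_ratMat_eq_swap s
  refine (cosetMulRight w).injective ?_
  rw [cosetMulRight_mk, cosetMulRight_mk]
  refine Quotient.sound (QuotientGroup.rightRel_apply.2 ?_)
  set a := γ * w
  set b := γ' * w
  obtain ⟨v, hv⟩ := exists_isSimil a
  have ha : ratMat a = ratMat γ * swapMat ℚ s := by rw [← hw]; rfl
  have hb : ratMat b = ratMat γ' * swapMat ℚ s := by rw [← hw]; rfl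
  change (ratMat (b * a⁻¹)).toBlocks₂₁ = 0
  have h1 : ratMat (b * a⁻¹) * ratMat a = ratMat b := by
    have : b * a⁻¹ * a = b := inv_mul_cancel_right _ _
    exact congrArg ratMat this
  have h2 : ratMat (b * a⁻¹) = ((v⁻¹ : ℚˣ) : ℚ) • (ratMat b * simAdj (ratMat a)) := by
    rw [← h1, Matrix.mul_assoc, hv.mul_simAdj v.isUnit, Matrix.mul_smul, smul_smul, Units.inv_mul,
      one_smul, Matrix.mul_one]
  have h3 : (ratMat b * simAdj (ratMat a)).toBlocks₂₁ = 0 := by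
    rw [toBlocks₂₁_mul, simAdj, toBlocks_fromBlocks₁₁, toBlocks_fromBlocks₂₁, ha, hb, ← h.mul_eq,
      ← h'.mul_eq, transpose_mul, h.symm, Matrix.mul_neg, Matrix.mul_assoc, add_neg_cancel]
  rw [h2]
  ext i j
  have := congrFun (congrFun h3 i) j
  change ((v⁻¹ : ℚˣ) : ℚ) * (ratMat b * simAdj (ratMat a)).toBlocks₂₁ i j = 0
  rw [this, Matrix.zero_apply, mul_zero]

end Coordinates

/-! ### Absolute convergence -/

section Bounds

variable {n k N : ℕ} {χ : IdeleClassChar} {s : ℂ}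

/-- The exponent drops from `k` to `E = k - 2m` in absolute value. -/
lemma norm_sectionInfty [NeZero n] (hχ : χ.HasTypeLevel k N) {E m : ℕ} (hk : k = E + 2 * m)
    (hs : modExponent n s = E) {g : Matrix (Idx n ⊕ Idx n) (Idx n ⊕ Idx n) ℝ} {v : ℝ}
    (hv : v ≠ 0) (hg : IsSimil g v) :
    ‖sectionInfty n k χ s g‖ = (|v| ^ n / ‖autFactor g (basePoint (Idx n))‖) ^ E := by
  rw [sectionInfty_eq hχ hk hs hv hg, norm_mul, norm_pow, norm_div, norm_pow, Complex.norm_real,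
    Complex.norm_real, Real.norm_eq_abs, Real.norm_eq_abs, abs_pow, abs_div, abs_norm, abs_pow,
    abs_abs, hk, pow_add, mul_assoc, ← mul_pow]
  have h1 : ‖autFactor g (basePoint (Idx n))‖ ≠ 0 :=
    norm_ne_zero_iff.2 (isUnit_denom hg hv basePoint_mem).ne_zero
  have h2 : |v| ≠ 0 := abs_ne_zero.2 hv
  rw [div_mul_div_comm, mul_comm (|v| ^ n), div_self (mul_ne_zero h1 (pow_ne_zero _ h2)), one_pow,
    mul_one]

/-- The matrix `M = X + R Y` with integral `X`, `Y` and `R = C⁻¹D` bounds the section at `p`: as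
`C M = C X + D Y`, the matrix `C M` is integral when `(C, D)` is. -/
lemma norm_sectionP_le [NeZero n] (hχ : χ.HasTypeLevel k N) {E : ℕ}
    (hs : modExponent n s = E) {γ : RatMat n} {v : ℚ} (hγ : IsSimil γ v)
    {t : Finset (Idx n)} {R M : Matrix (Idx n) (Idx n) ℚ} (h : IsCoord γ t R)
    {X Y : Matrix (Idx n) (Idx n) ℤ}
    (hM : M = X.map (Int.cast : ℤ → ℚ) + R * Y.map (Int.cast : ℤ → ℚ)) (hM0 : M.det ≠ 0)
    (p : Nat.Primes) :
    ‖sectionP n N χ s p (γ.map (algebraMap ℚ ℚ_[p]))‖ ≤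
      ‖algebraMap ℚ ℚ_[p] (v ^ n * ((γ * swapMat ℚ t).toBlocks₂₁.det * M.det)⁻¹)‖ ^ E := by
  by_cases hdec : ∃ A X v κ, IsLocDecomp n N p (γ.map (algebraMap ℚ ℚ_[p])) A X v κ
  swap
  · rw [sectionP_eq_zero hdec, norm_zero]
    positivity
  obtain ⟨A, X', w, κ, hd⟩ := hdec
  rw [sectionP_eq hχ hd, hs, norm_locChar hχ]
  refine pow_le_pow_left₀ (norm_nonneg _) ?_ E
  set f := algebraMap ℚ ℚ_[p] with hf
  set C := (γ * swapMat ℚ t).toBlocks₂₁ with hC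
  set D := (γ * swapMat ℚ t).toBlocks₂₂ with hD
  have hC0 : C.det ≠ 0 := h.det_ne
  obtain ⟨u, hu⟩ := isSimil_of_mem_locK hd.1
  set k₀ := locX n N p * κ with hk₀
  have hk₀s : IsSimil k₀ (u : ℤ_[p]) := by simpa using (isSimil_locX n N p).mul hu
  have hγk : γ.map f = parabolicElt A X' w * toQp k₀ := by
    rw [hd.2, Matrix.mul_assoc, ← toQp_mul]
  -- The similitude factor of the parabolic part differs from `v` by a unit.
  have hw : ‖(w : ℚ_[p])‖ = ‖f v‖ := by
    obtain ⟨k₁, h1, h2, -⟩ := hk₀s.exists_inv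
    have h3 : parabolicElt A X' w = γ.map f * toQp k₁ := by
      rw [hγk, Matrix.mul_assoc, ← toQp_mul, h2, toQp_one, Matrix.mul_one]
    have h4 : IsSimil (parabolicElt A X' w) (f v * algebraMap ℤ_[p] ℚ_[p] ((u⁻¹ : ℤ_[p]ˣ) : ℤ_[p])) := by
      rw [h3]; exact (hγ.map f).mul (h1.map (algebraMap ℤ_[p] ℚ_[p]))
    rw [similitude_parabolicElt h4, norm_mul]
    have h5 : ‖algebraMap ℤ_[p] ℚ_[p] ((u⁻¹ : ℤ_[p]ˣ) : ℤ_[p])‖ = 1 := PadicInt.norm_units u⁻¹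
    rw [h5, mul_one]
  set U : Matrix (Idx n) (Idx n) ℚ_[p] :=
    (w : ℚ_[p]) • ((A⁻¹ : GL (Idx n) ℚ_[p]) : Matrix (Idx n) (Idx n) ℚ_[p])ᵀ with hU
  set k' := k₀ * swapMat ℤ_[p] t with hk'
  have hG : (γ * swapMat ℚ t).map f = parabolicElt A X' w * toQp k' := by
    rw [hk', toQp_mul, ← Matrix.mul_assoc, ← hγk, Matrix.map_mul, swapMat_map]
    congr 1
    exact (swapMat_map (algebraMap ℤ_[p] ℚ_[p]) t).symm
  have hCk : C.map f = U * toQp k'.toBlocks₂₁ := by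
    have := congrArg toBlocks₂₁ hG
    rw [toBlocks₂₁_mul, parabolicElt_toBlocks₂₁, Matrix.zero_mul, zero_add,
      parabolicElt_toBlocks₂₂] at this
    exact this
  have hDk : D.map f = U * toQp k'.toBlocks₂₂ := by
    have := congrArg toBlocks₂₂ hG
    rw [toBlocks₂₂_mul, parabolicElt_toBlocks₂₁, Matrix.zero_mul, zero_add,
      parabolicElt_toBlocks₂₂] at this
    exact this
  have hint : ∀ Z : Matrix (Idx n) (Idx n) ℤ,
      (Z.map (Int.cast : ℤ → ℚ)).map f = toQp (Z.map (Int.castRingHom ℤ_[p])) := by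
    intro Z; ext i j; simp [hf]
  set T := k'.toBlocks₂₁ * X.map (Int.castRingHom ℤ_[p]) +
    k'.toBlocks₂₂ * Y.map (Int.castRingHom ℤ_[p]) with hT
  have hCM : C.map f * M.map f = U * toQp T := by
    have h1 : C * M = C * X.map (Int.cast : ℤ → ℚ) + D * Y.map (Int.cast : ℤ → ℚ) := by
      rw [hM, Matrix.mul_add, ← Matrix.mul_assoc, h.mul_eq]
    rw [← Matrix.map_mul, h1, Matrix.map_add _ (map_add f), Matrix.map_mul, Matrix.map_mul, hCk, hDk,
      hint, hint, Matrix.mul_assoc, Matrix.mul_assoc, ← Matrix.mul_add, ← toQp_mul, ← toQp_mul]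
    congr 1
  have hdet : f (C.det * M.det) = (w : ℚ_[p]) ^ n * ((dInv n A w : ℚ_[p]ˣ) : ℚ_[p])⁻¹ *
      algebraMap ℤ_[p] ℚ_[p] T.det := by
    have h1 := congrArg Matrix.det hCM
    rw [det_mul, det_mul, hU, det_parabolic_block] at h1
    rw [map_mul, RingHom.map_det, RingHom.map_det, RingHom.map_det]
    exact h1
  have hT1 : ‖algebraMap ℤ_[p] ℚ_[p] T.det‖ ≤ 1 := T.det.2
  have hd0 : 0 < ‖((dInv n A w : ℚ_[p]ˣ) : ℚ_[p])‖ := norm_pos_iff.2 (Units.ne_zero _)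
  have hq0 : 0 < ‖f (C.det * M.det)‖ :=
    norm_pos_iff.2 ((map_ne_zero f).2 (mul_ne_zero hC0 hM0))
  have hle : ‖f (C.det * M.det)‖ * ‖((dInv n A w : ℚ_[p]ˣ) : ℚ_[p])‖ ≤ ‖f v‖ ^ n := by
    rw [hdet, norm_mul, norm_mul, norm_inv, norm_pow, hw]
    calc ‖f v‖ ^ n * ‖((dInv n A w : ℚ_[p]ˣ) : ℚ_[p])‖⁻¹ * ‖algebraMap ℤ_[p] ℚ_[p] T.det‖ *
          ‖((dInv n A w : ℚ_[p]ˣ) : ℚ_[p])‖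
        = ‖f v‖ ^ n * ‖algebraMap ℤ_[p] ℚ_[p] T.det‖ := by field_simp
      _ ≤ ‖f v‖ ^ n * 1 := by gcongr
      _ = _ := mul_one _
  rw [map_mul, map_pow, map_inv₀, norm_mul, norm_pow, norm_inv, ← div_eq_mul_inv, le_div_iff₀ hq0,
    mul_comm]
  exact hle

/-- The value at the identity of the global section is bounded by the denominator of `R`. -/
lemma norm_matSection_one_le [NeZero n] (hχ : χ.HasTypeLevel k N) (hN : N ≠ 0) {E m : ℕ}
    (hk : k = E + 2 * m) (hs : modExponent n s = E) {γ : RatMat n} {v : ℚ} (hγ : IsSimil γ v)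
    (hv : v ≠ 0) {t : Finset (Idx n)} {R : Matrix (Idx n) (Idx n) ℚ} (h : IsCoord γ t R) :
    ‖matSection n k N χ s γ 1‖ ≤ ((rowDenom (modZ R) : ℝ)⁻¹) ^ E := by
  obtain ⟨M, X, Y, hM, hM0, hle⟩ := exists_denominator h.symm
  set C := (γ * swapMat ℚ t).toBlocks₂₁ with hC
  have hC0 : C.det ≠ 0 := h.det_ne
  set q : ℚ := v ^ n * (C.det * M.det)⁻¹ with hq
  have hq0 : q ≠ 0 := mul_ne_zero (pow_ne_zero _ hv) (inv_ne_zero (mul_ne_zero hC0 hM0))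
  have hfin : ‖∏ᶠ p : Nat.Primes, sectionP n N χ s p (γ.map (algebraMap ℚ ℚ_[p]))‖ ≤
      (|(q : ℝ)|⁻¹) ^ E := by
    have h1 : ‖∏ᶠ p : Nat.Primes, sectionP n N χ s p (γ.map (algebraMap ℚ ℚ_[p]))‖ =
        ∏ᶠ p : Nat.Primes, ‖sectionP n N χ s p (γ.map (algebraMap ℚ ℚ_[p]))‖ :=
      (normHom : ℂ →*₀ ℝ).toMonoidHom.map_finprod (hasFiniteMulSupport_sectionP hχ hN hγ hv)
    rw [h1, ← finprod_norm_eq hq0]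
    refine le_of_le_of_eq ?_ (finprod_pow (hasFiniteMulSupport_norm hq0) E).symm
    refine finprod_le_finprod ?_ (fun p => norm_nonneg _) ?_
      (fun p => norm_sectionP_le hχ hs hγ h hM hM0 p)
    · refine Filter.eventually_cofinite.1 ?_
      filter_upwards [eventually_sectionP_eq_one (s := s) hχ hN hγ hv] with p hp
      rw [hp, norm_one]
    · refine Filter.eventually_cofinite.1 ?_
      filter_upwards [eventually_norm_eq_one hq0] with p hp
      rw [hp, one_pow]
  have hγR : IsSimil (γ.map (algebraMap ℚ ℝ)) (algebraMap ℚ ℝ v) := hγ.map _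
  have hvR : algebraMap ℚ ℝ v ≠ 0 := (map_ne_zero _).2 hv
  rw [matSection, norm_mul, Matrix.mul_one, norm_sectionInfty hχ hk hs hvR hγR]
  refine (mul_le_mul_of_nonneg_left hfin (by positivity)).trans ?_
  rw [← mul_pow]
  refine pow_le_pow_left₀ (by positivity) ?_ E
  have hj0 : 0 < ‖autFactor (γ.map (algebraMap ℚ ℝ)) (basePoint (Idx n))‖ :=
    norm_pos_iff.2 (isUnit_denom hγR hvR basePoint_mem).ne_zero
  have hdet := h.det_le
  rw [← hC] at hdet
  have hr0 : (0 : ℝ) < rowDenom (modZ R) := by exact_mod_cast rowDenom_pos _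
  have hMr : |((M.det : ℚ) : ℝ)| ≤ (rowDenom (modZ R) : ℝ)⁻¹ := by
    have h2 : (rowDenom (modZ R) : ℝ) ≤ |((M.det : ℚ) : ℝ)|⁻¹ := by exact_mod_cast hle
    have h3 := inv_anti₀ hr0 h2
    rwa [inv_inv] at h3
  have hv' : |algebraMap ℚ ℝ v| ≠ 0 := abs_ne_zero.2 hvR
  have e1 : |(q : ℝ)|⁻¹ = (|algebraMap ℚ ℝ v| ^ n)⁻¹ * (|((C.det : ℚ) : ℝ)| * |((M.det : ℚ) : ℝ)|) := by
    rw [hq, Rat.cast_mul, Rat.cast_pow, Rat.cast_inv, Rat.cast_mul, abs_mul, abs_pow, abs_inv,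
      abs_mul, mul_inv, inv_inv]
    rfl
  rw [e1]
  calc |algebraMap ℚ ℝ v| ^ n / ‖autFactor (γ.map (algebraMap ℚ ℝ)) (basePoint (Idx n))‖ *
        ((|algebraMap ℚ ℝ v| ^ n)⁻¹ * (|((C.det : ℚ) : ℝ)| * |((M.det : ℚ) : ℝ)|))
      = |((C.det : ℚ) : ℝ)| / ‖autFactor (γ.map (algebraMap ℚ ℝ)) (basePoint (Idx n))‖ *
        |((M.det : ℚ) : ℝ)| := by field_simp
    _ ≤ 1 * (rowDenom (modZ R) : ℝ)⁻¹ := by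
        gcongr
        exact (div_le_one hj0).2 hdet
    _ = _ := one_mul _

end Bounds

section Summability

open ENNReal

variable {n k N : ℕ} {χ : IdeleClassChar} {s : ℂ}

/-- The integers of absolute value at most `2^{2n}`. -/
abbrev Box (n : ℕ) : Type := Finset.Icc (-(2 ^ (2 * n)) : ℤ) (2 ^ (2 * n))

lemma exists_coords (c : Cosets n) :
    ∃ (t : Finset (Idx n)) (R : Matrix (Idx n) (Idx n) ℚ), IsCoord (ratMat c.out) t R := by
  obtain ⟨v, hv⟩ := exists_isSimil c.out
  exact exists_isCoord hv v.ne_zero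

/-- The swapped coordinates, the integral parts of the entries of `R`, and `R` modulo one. -/
lemma exists_coordMap (n : ℕ) :
    ∃ Φ : Cosets n → (Finset (Idx n) × (Idx n → Idx n → Box n)) × SymQmodZ (Idx n),
      Function.Injective Φ ∧ ∀ c, ∃ (t : Finset (Idx n)) (R : Matrix (Idx n) (Idx n) ℚ),
        IsCoord (ratMat c.out) t R ∧ (Φ c).2.1 = modZ R := by
  choose t R h using exists_coords (n := n)
  have hbox : ∀ c i j, ⌊R c i j⌋ ∈ Finset.Icc (-(2 ^ (2 * n)) : ℤ) (2 ^ (2 * n)) := by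
    intro c i j
    obtain ⟨h1, h2⟩ := abs_le.1 ((h c).abs_le i j)
    rw [Finset.mem_Icc]
    refine ⟨Int.le_floor.2 (by push_cast; exact h1), ?_⟩
    have := (Int.floor_le (R c i j)).trans h2
    exact_mod_cast this
  refine ⟨fun c => ((t c, fun i j => ⟨⌊R c i j⌋, hbox c i j⟩),
    ⟨modZ (R c), fun i j => ?_⟩), ?_, fun c => ⟨t c, R c, h c, rfl⟩⟩
  · have : R c i j = R c j i := congrFun (congrFun (h c).symm j) i
    rw [modZ, modZ, this]
  · intro c c' hcc
    simp only [Prod.mk.injEq, Subtype.mk.injEq] at hcc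
    obtain ⟨⟨h1, h2⟩, h3⟩ := hcc
    have hR : R c = R c' := by
      ext i j
      have h4 : ⌊R c i j⌋ = ⌊R c' i j⌋ := congrArg Subtype.val (congrFun (congrFun h2 i) j)
      have h5 : ((R c i j : ℚ) : QmodZ) = ((R c' i j : ℚ) : QmodZ) := congrFun (congrFun h3 i) j
      obtain ⟨z, hz⟩ := (QuotientAddGroup.eq_iff_sub_mem.1 h5)
      have hz' : R c i j = R c' i j + z := by
        have : (z : ℚ) = R c i j - R c' i j := by simpa using hz
        rw [this]; ring
      rw [hz', Int.floor_add_intCast] at h4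
      have : z = 0 := by omega
      rw [hz', this]; simp
    have h6 := h c
    rw [h1, hR] at h6
    have h7 := h6.mk_eq (h c')
    rwa [Quotient.out_eq, Quotient.out_eq] at h7

/-- Absolute convergence at the base point, by comparison with the Siegel series. -/
lemma summable_norm_matSection_one [NeZero n] (hχ : χ.HasTypeLevel k N) (hN : N ≠ 0) {E m : ℕ}
    (hk : k = E + 2 * m) (hs : modExponent n s = E) (hE : 2 * n + 2 ≤ E) :
    Summable fun c : Cosets n => ‖matSection n k N χ s (ratMat c.out) 1‖ := by
  obtain ⟨Φ, hΦ, hc⟩ := exists_coordMap n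
  have hfin : siegelSeries (Idx n) E < ∞ := by
    refine siegelSeries_lt_top ?_
    simp only [Fintype.card_sum, Fintype.card_fin]
    omega
  have key : ∑' c : Cosets n, ‖matSection n k N χ s (ratMat c.out) 1‖ₑ ≠ ∞ := by
    have h1 : ∀ c : Cosets n, ‖matSection n k N χ s (ratMat c.out) 1‖ₑ ≤
        ((rowDenom (Φ c).2.1 : ℝ≥0∞)⁻¹) ^ E := by
      intro c
      obtain ⟨t, R, h, hR⟩ := hc c
      obtain ⟨v, hv⟩ := exists_isSimil c.out
      have h2 := norm_matSection_one_le (s := s) hχ hN hk hs hv v.ne_zero h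
      rw [hR, ← ofReal_norm]
      refine (ENNReal.ofReal_le_ofReal h2).trans (le_of_eq ?_)
      have hr0 : (0 : ℝ) < rowDenom (modZ R) := by exact_mod_cast rowDenom_pos _
      rw [ENNReal.ofReal_pow (by positivity), ENNReal.ofReal_inv_of_pos hr0, ENNReal.ofReal_natCast]
    refine ne_of_lt (lt_of_le_of_lt (ENNReal.tsum_le_tsum h1) ?_)
    refine lt_of_le_of_lt (ENNReal.tsum_comp_le_tsum_of_injective hΦ
      fun z => ((rowDenom z.2.1 : ℝ≥0∞)⁻¹) ^ E) ?_
    rw [ENNReal.tsum_prod (f := fun (_ : Finset (Idx n) × (Idx n → Idx n → Box n))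
      (z : SymQmodZ (Idx n)) => ((rowDenom z.1 : ℝ≥0∞)⁻¹) ^ E)]
    change ∑' _, siegelSeries (Idx n) E < ∞
    rw [tsum_fintype, Finset.sum_const, nsmul_eq_mul]
    exact ENNReal.mul_lt_top (ENNReal.natCast_lt_top _) hfin
  have := ENNReal.summable_toReal key
  simpa using this

end Summability

/-! ### Normally convergent series of holomorphic functions -/

section Series

open Metric

variable {E : Type} [NormedAddCommGroup E] [NormedSpace ℂ E]

/-- The Cauchy estimate for the derivative of a bounded holomorphic function on a ball. -/
lemma norm_fderiv_le_of_bounded {f : E → ℂ} {x : E} {r u : ℝ} (hr : 0 < r)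
    (hf : DifferentiableOn ℂ f (ball x r)) (hu : ∀ y ∈ ball x r, ‖f y‖ ≤ u) :
    ‖fderiv ℂ f x‖ ≤ 2 * u / r := by
  have hu0 : 0 ≤ u := (norm_nonneg _).trans (hu x (mem_ball_self hr))
  refine ContinuousLinearMap.opNorm_le_bound _ (by positivity) fun w => ?_
  rcases eq_or_ne w 0 with rfl | hw
  · simp
  have hw' : 0 < ‖w‖ := norm_pos_iff.2 hw
  set ρ := r / (2 * ‖w‖) with hρ
  have hρ0 : 0 < ρ := by positivity
  have hmem : ∀ t : ℂ, t ∈ closedBall (0 : ℂ) ρ → x + t • w ∈ ball x r := by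
    intro t ht
    rw [mem_closedBall_zero_iff] at ht
    rw [mem_ball, dist_eq_norm, add_sub_cancel_left, norm_smul]
    calc ‖t‖ * ‖w‖ ≤ ρ * ‖w‖ := by gcongr
      _ = r / 2 := by rw [hρ]; field_simp
      _ < r := by linarith
  have hfx : DifferentiableAt ℂ f x := hf.differentiableAt (ball_mem_nhds x hr)
  have hg : ∀ t ∈ closedBall (0 : ℂ) ρ, DifferentiableAt ℂ (fun t : ℂ => f (x + t • w)) t := by
    intro t ht
    have h1 : DifferentiableAt ℂ f (x + t • w) :=
      hf.differentiableAt (isOpen_ball.mem_nhds (hmem t ht))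
    exact h1.comp t (by fun_prop)
  have hder : deriv (fun t : ℂ => f (x + t • w)) 0 = fderiv ℂ f x w := by
    have h1 : HasFDerivAt f (fderiv ℂ f x) (x + (0 : ℂ) • w) := by
      rw [zero_smul, add_zero]; exact hfx.hasFDerivAt
    have h2 : HasDerivAt (fun t : ℂ => x + t • w) w 0 := by
      simpa using ((hasDerivAt_id (0 : ℂ)).smul_const w).const_add x
    exact (h1.comp_hasDerivAt (0 : ℂ) h2).deriv
  rw [← hder]
  have h3 : ‖deriv (fun t : ℂ => f (x + t • w)) 0‖ ≤ u / ρ := by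
    refine Complex.norm_deriv_le_of_forall_mem_sphere_norm_le hρ0 ?_ fun t ht =>
      hu _ (hmem t (sphere_subset_closedBall ht))
    refine DifferentiableOn.diffContOnCl_ball (U := closedBall 0 ρ)
      (fun t ht => (hg t ht).differentiableWithinAt) subset_rfl
  refine h3.trans (le_of_eq ?_)
  rw [hρ]
  field_simp

/-- A series of holomorphic functions that is dominated by a summable sequence near a point
is holomorphic there. -/
lemma differentiableAt_tsum_of_bounded {ι : Type} {f : ι → E → ℂ} {u : ι → ℝ} (hu : Summable u)
    {x : E} (h : ∀ᶠ y in nhds x, ∀ i, DifferentiableAt ℂ (f i) y ∧ ‖f i y‖ ≤ u i) :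
    DifferentiableAt ℂ (fun y => ∑' i, f i y) x := by
  obtain ⟨r, hr, hball⟩ := Metric.eventually_nhds_iff_ball.1 h
  have hr2 : 0 < r / 2 := by linarith
  have hsub : ∀ y ∈ ball x (r / 2), ball y (r / 2) ⊆ ball x r := by
    intro y hy
    refine ball_subset_ball' ?_
    rw [mem_ball] at hy
    linarith
  let : NormedSpace ℝ E := NormedSpace.restrictScalars ℝ ℂ E
  refine (hasFDerivAt_tsum_of_isPreconnected (u := fun i => 2 * u i / (r / 2))
    (f' := fun i y => fderiv ℂ (f i) y) ?_ (isOpen_ball (x := x) (ε := r / 2))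
    (convex_ball x (r / 2)).isPreconnected ?_ ?_ (mem_ball_self hr2) ?_
    (mem_ball_self hr2)).differentiableAt
  · exact (hu.mul_left 2).div_const _
  · intro i y hy
    exact (hball y (ball_subset_ball (by linarith) hy) i).1.hasFDerivAt
  · intro i y hy
    refine norm_fderiv_le_of_bounded hr2 (fun z hz => ?_) fun z hz => ?_
    · exact (hball z (hsub y hy hz) i).1.differentiableWithinAt
    · exact (hball z (hsub y hy hz) i).2
  · exact Summable.of_norm_bounded hu fun i => (hball x (mem_ball_self hr) i).2

end Series

/-! ### Neighbourhoods in the half space -/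

section Neighbourhoods

open Filter Topology

variable {l : Type} [Fintype l] [DecidableEq l]

attribute [local instance] Matrix.normedAddCommGroup Matrix.normedSpace

/-- A small symmetric perturbation of the identity is positive semidefinite. -/
lemma posSemidef_one_add {M : Matrix l l ℝ} (hM : Mᵀ = M)
    (h : ∀ i j, |M i j| * Fintype.card l ≤ 1) : (1 + M).PosSemidef := by
  refine PosSemidef.of_dotProduct_mulVec_nonneg ?_ fun x => ?_
  · rw [IsHermitian, conjTranspose_eq_transpose_of_trivial, transpose_add, hM, transpose_one]
  rw [star_trivial, Matrix.add_mulVec, Matrix.one_mulVec, dotProduct_add]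
  have h1 : ∀ i j, -(x i ^ 2 + x j ^ 2) / (2 * Fintype.card l) ≤ x i * (M i j * x j) := by
    intro i j
    have hc : (0 : ℝ) < Fintype.card l := by
      have : Nonempty l := ⟨i⟩
      exact_mod_cast Fintype.card_pos
    rw [div_le_iff₀ (by positivity)]
    have h2 := h i j
    have h3 : |x i * (M i j * x j) * (2 * Fintype.card l)| ≤ x i ^ 2 + x j ^ 2 := by
      have : |x i * (M i j * x j) * (2 * Fintype.card l)| =
          (|M i j| * Fintype.card l) * (2 * (|x i| * |x j|)) := by
        rw [abs_mul, abs_mul, abs_mul, abs_mul, abs_two, Nat.abs_cast]; ring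
      rw [this]
      calc _ ≤ 1 * (2 * (|x i| * |x j|)) := by gcongr
        _ ≤ _ := by
          rw [← sq_abs (x i), ← sq_abs (x j)]
          nlinarith [sq_nonneg (|x i| - |x j|)]
    linarith [neg_le_of_abs_le h3]
  have h4 : x ⬝ᵥ M *ᵥ x = ∑ i, ∑ j, x i * (M i j * x j) := by
    simp only [dotProduct, mulVec, Finset.mul_sum]
  rcases isEmpty_or_nonempty l with hl | hl
  · simp [dotProduct]
  have hc : (Fintype.card l : ℝ) ≠ 0 := by exact_mod_cast Fintype.card_ne_zero
  have h5 : ∑ i, ∑ j, -(x i ^ 2 + x j ^ 2) / (2 * Fintype.card l) = -(x ⬝ᵥ x) := by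
    simp only [← Finset.sum_div, Finset.sum_neg_distrib, Finset.sum_add_distrib, Finset.sum_const,
      Finset.card_univ, nsmul_eq_mul, ← Finset.mul_sum, dotProduct, ← sq]
    field_simp
    ring
  have h6 : ∑ i, ∑ j, -(x i ^ 2 + x j ^ 2) / (2 * Fintype.card l) ≤
      ∑ i, ∑ j, x i * (M i j * x j) :=
    Finset.sum_le_sum fun i _ => Finset.sum_le_sum fun j _ => h1 i j
  rw [h4]
  linarith

/-- Every point of the half space has a neighbourhood in the symmetric matrices on which the
imaginary part is bounded below. -/
lemma eventually_mem_halfSpaceGE {Z₀ : Matrix l l ℂ} (hZ₀ : Z₀ ∈ upperHalfSpace l) :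
    ∃ lam : ℝ, 0 < lam ∧ ∀ᶠ Z in 𝓝 Z₀, Zᵀ = Z → Z ∈ halfSpaceGE l lam := by
  obtain ⟨B, hB⟩ := exists_mul_transpose_eq hZ₀.2
  set B' : Matrix l l ℝ := ((B⁻¹ : GL l ℝ) : Matrix l l ℝ) with hB'
  have hBB : (B : Matrix l l ℝ) * B' = 1 := by rw [hB', ← Units.val_mul]; simp
  have hBB' : B'ᵀ * (B : Matrix l l ℝ)ᵀ = 1 := by rw [← transpose_mul, hBB, transpose_one]
  let Θ : Matrix l l ℂ × ℝ → Matrix l l ℝ := fun q =>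
    B' * (q.1.map Complex.im - Z₀.map Complex.im - q.2 • (1 : Matrix l l ℝ)) * B'ᵀ
  have hcont : ∀ i j, Continuous fun q => |Θ q i j| * Fintype.card l := by
    intro i j
    have : Continuous fun q : Matrix l l ℂ × ℝ => q.1.map Complex.im :=
      continuous_fst.matrix_map Complex.continuous_im
    simp only [Θ]
    fun_prop
  have hev : ∀ᶠ q in 𝓝 ((Z₀, 0) : Matrix l l ℂ × ℝ), ∀ i j, |Θ q i j| * Fintype.card l < 1 := by
    refine eventually_all.2 fun i => eventually_all.2 fun j => ?_
    refine (hcont i j).tendsto _ |>.eventually_lt_const ?_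
    simp [Θ]
  rw [nhds_prod_eq, eventually_prod_iff] at hev
  obtain ⟨pa, hpa, pb, hpb, hab⟩ := hev
  have hpb' : ∀ᶠ lam : ℝ in 𝓝[>] 0, pb lam := hpb.filter_mono nhdsWithin_le_nhds
  obtain ⟨lam, hlam, hlam0⟩ := (hpb'.and self_mem_nhdsWithin).exists
  refine ⟨lam, hlam0, hpa.mono fun Z hZ hsym => ⟨hsym, ?_⟩⟩
  have h1 : (1 + Θ (Z, lam)).PosSemidef := by
    refine posSemidef_one_add ?_ fun i j => (hab hZ hlam i j).le
    simp only [Θ]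
    rw [transpose_mul, transpose_mul, transpose_transpose, transpose_sub, transpose_sub,
      transpose_smul, transpose_one, ← transpose_map, ← transpose_map, hsym, hZ₀.1,
      Matrix.mul_assoc]
  have h2 := h1.mul_mul_conjTranspose_same (B : Matrix l l ℝ)
  rw [conjTranspose_eq_transpose_of_trivial] at h2
  have h3 : Z.map Complex.im - lam • (1 : Matrix l l ℝ) =
      (B : Matrix l l ℝ) * (1 + Θ (Z, lam)) * (B : Matrix l l ℝ)ᵀ := by
    simp only [Θ]
    rw [Matrix.mul_add, Matrix.mul_one, Matrix.add_mul, ← hB, ← Matrix.mul_assoc, ← Matrix.mul_assoc,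
      hBB, Matrix.one_mul, Matrix.mul_assoc, hBB', Matrix.mul_one]
    abel
  rw [h3]
  exact h2

lemma norm_det_le {M : Matrix l l ℂ} {x : ℝ} (h : ∀ i j, ‖M i j‖ ≤ x) :
    ‖M.det‖ ≤ (Fintype.card l).factorial * x ^ Fintype.card l := by
  have := det_le (abv := NormedField.toAbsoluteValue ℂ) h
  rwa [nsmul_eq_mul] at this

/-- Locally uniform control of the automorphy factors and their logarithmic derivatives. -/
lemma eventually_norm_autFactor_le {Z₀ : Matrix l l ℂ} (hZ₀ : Z₀ ∈ upperHalfSpace l) :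
    ∃ K : ℝ, 0 < K ∧ ∀ᶠ Z in 𝓝 Z₀, Zᵀ = Z → Z ∈ upperHalfSpace l ∧
      ∀ (g : Matrix (l ⊕ l) (l ⊕ l) ℝ) (v : ℝ), v ≠ 0 → IsSimil g v →
        ‖autFactor g (basePoint l)‖ ≤ K * ‖autFactor g Z‖ ∧ ∀ i j, ‖logDenom g Z i j‖ ≤ K := by
  obtain ⟨lam, hlam, hev⟩ := eventually_mem_halfSpaceGE hZ₀
  set ρ : ℝ := ‖basePoint l - Z₀‖ + 1 with hρ
  have hρ0 : 0 < ρ := by positivity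
  have hev2 : ∀ᶠ Z in 𝓝 Z₀, ‖basePoint l - Z‖ < ρ := by
    have : Continuous fun Z : Matrix l l ℂ => ‖basePoint l - Z‖ := by fun_prop
    exact this.tendsto _ |>.eventually_lt_const (by rw [hρ]; linarith)
  set d : ℝ := (Fintype.card l : ℝ) with hd
  set K₁ : ℝ := (Fintype.card l).factorial * (1 + d * (lam⁻¹ * ρ)) ^ Fintype.card l with hK₁
  refine ⟨K₁ + lam⁻¹, by positivity, ?_⟩
  filter_upwards [hev, hev2] with Z h1 h2 hsym
  have hZ := h1 hsym
  have hZH := halfSpaceGE_subset hlam hZ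
  refine ⟨hZH, fun g v hv hg => ⟨?_, fun i j => ?_⟩⟩
  · have hu := isUnit_denom hg hv hZH
    rw [autFactor, denom_add (basePoint l) hu, det_mul, norm_mul, mul_comm]
    have h3 : ‖(1 + logDenom g Z * (basePoint l - Z)).det‖ ≤ K₁ := by
      refine norm_det_le fun i j => ?_
      rw [Matrix.add_apply]
      refine (norm_add_le _ _).trans (add_le_add ?_ ?_)
      · rw [one_apply]; split_ifs <;> simp
      · rw [Matrix.mul_apply]
        refine (norm_sum_le _ _).trans ((Finset.sum_le_card_nsmul _ _ (lam⁻¹ * ρ)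
          fun a _ => ?_).trans (by rw [nsmul_eq_mul, Finset.card_univ]))
        rw [norm_mul]
        exact mul_le_mul (norm_logDenom_apply_le hg hv hlam hZ i a)
          ((norm_entry_le_entrywise_sup_norm _).trans h2.le) (norm_nonneg _) (by positivity)
    refine (mul_le_mul_of_nonneg_right h3 (norm_nonneg _)).trans ?_
    refine mul_le_mul_of_nonneg_right ?_ (norm_nonneg _)
    have : 0 < lam⁻¹ := by positivity
    linarith
  · refine (norm_logDenom_apply_le hg hv hlam hZ i j).trans ?_
    have : 0 ≤ K₁ := by positivity
    linarith

end Neighbourhoods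

/-! ### Holomorphy of automorphy factors -/

section Differentiability

variable {l : Type} [Fintype l] [DecidableEq l] {E : Type} [NormedAddCommGroup E] [NormedSpace ℂ E]

lemma differentiableAt_det {A : E → Matrix l l ℂ} {x : E}
    (h : ∀ i j, DifferentiableAt ℂ (fun y => A y i j) x) :
    DifferentiableAt ℂ (fun y => (A y).det) x := by
  simp only [det_apply']
  fun_prop

lemma differentiableAt_inv {A : E → Matrix l l ℂ} {x : E}
    (h : ∀ i j, DifferentiableAt ℂ (fun y => A y i j) x) (h0 : (A x).det ≠ 0) (i j : l) :
    DifferentiableAt ℂ (fun y => (A y)⁻¹ i j) x := by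
  simp only [Matrix.inv_def, Ring.inverse_eq_inv', Matrix.smul_apply, smul_eq_mul]
  refine ((differentiableAt_det h).inv h0).mul ?_
  simp only [adjugate_apply]
  refine differentiableAt_det fun a b => ?_
  by_cases ha : a = j
  · subst ha; simp
  · simp only [updateRow_ne ha]; exact h a b

lemma differentiableAt_denom (g : Matrix (l ⊕ l) (l ⊕ l) ℝ) {A : E → Matrix l l ℂ} {x : E}
    (h : ∀ i j, DifferentiableAt ℂ (fun y => A y i j) x) (i j : l) :
    DifferentiableAt ℂ (fun y => denom g (A y) i j) x := by
  simp only [denom, Matrix.add_apply, Matrix.mul_apply]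
  exact (DifferentiableAt.fun_sum fun a _ => (h a j).const_mul _).add (differentiableAt_const _)

lemma differentiableAt_logDenom (g : Matrix (l ⊕ l) (l ⊕ l) ℝ) {A : E → Matrix l l ℂ} {x : E}
    (h : ∀ i j, DifferentiableAt ℂ (fun y => A y i j) x) (h0 : (denom g (A x)).det ≠ 0) (i j : l) :
    DifferentiableAt ℂ (fun y => logDenom g (A y) i j) x := by
  simp only [logDenom, Matrix.mul_apply]
  exact DifferentiableAt.fun_sum fun a _ =>
    (differentiableAt_inv (differentiableAt_denom g h) h0 i a).mul_const _

lemma differentiableAt_mvPolynomial_eval {σ : Type} [Fintype σ] (Ψ : MvPolynomial σ ℂ)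
    {f : E → σ → ℂ} {x : E} (h : ∀ i, DifferentiableAt ℂ (fun y => f y i) x) :
    DifferentiableAt ℂ (fun y => MvPolynomial.eval (f y) Ψ) x := by
  simp only [MvPolynomial.eval_eq']
  fun_prop

lemma exists_norm_eval_le {σ : Type} [Fintype σ] (Ψ : MvPolynomial σ ℂ) (K : ℝ) :
    ∃ K' : ℝ, 0 ≤ K' ∧ ∀ w : σ → ℂ, (∀ i, ‖w i‖ ≤ K) → ‖MvPolynomial.eval w Ψ‖ ≤ K' := by
  refine ⟨∑ d ∈ Ψ.support, ‖Ψ.coeff d‖ * ∏ i, |K| ^ d i, by positivity, fun w hw => ?_⟩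
  rw [MvPolynomial.eval_eq']
  refine (norm_sum_le _ _).trans (Finset.sum_le_sum fun d _ => ?_)
  rw [norm_mul, norm_prod]
  gcongr with i
  rw [norm_pow]
  exact pow_le_pow_left₀ (norm_nonneg _) ((hw i).trans (le_abs_self K)) _

end Differentiability

/-! ### The classical form of the terms -/

section Terms

variable {l : Type} [Fintype l] [DecidableEq l]

/-- The non-holomorphic factor `|j(g, Z)|² det(Im Z)⁻¹ / j(g, Z)²` is a polynomial in `(Im Z)⁻¹` and
the holomorphic matrix `(CZ + D)⁻¹C`. -/
lemma norm_sq_autFactor_mul_inv_det {g : Matrix (l ⊕ l) (l ⊕ l) ℝ} {v : ℝ} (hg : IsSimil g v)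
    (hv : v ≠ 0) {Z : Matrix l l ℂ} (hZ : Z ∈ upperHalfSpace l) :
    ((‖autFactor g Z‖ ^ 2 * ((Z.map Complex.im).det)⁻¹ : ℝ) : ℂ) =
      autFactor g Z ^ 2 *
        (cplx (Z.map Complex.im)⁻¹ + (-(2 * Complex.I)) • logDenom g Z).det := by
  set Y := Z.map Complex.im with hY
  have hu := isUnit_denom hg hv hZ
  have hYu : IsUnit Y.det := isUnit_iff_ne_zero.2 hZ.2.det_pos.ne'
  have hYY : cplx Y * cplx Y⁻¹ = 1 := by rw [← cplx_mul, mul_nonsing_inv _ hYu, cplx_one]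
  have hZZ : Zᴴ - Z = (-(2 * Complex.I)) • cplx Y := by
    rw [neg_smul, ← sub_conjTranspose_eq hZ.1, neg_sub]
  have h1 : cplx Y⁻¹ + (-(2 * Complex.I)) • logDenom g Z =
      (1 + logDenom g Z * (Zᴴ - Z)) * cplx Y⁻¹ := by
    rw [hZZ, Matrix.add_mul, Matrix.one_mul, Matrix.mul_smul, Matrix.smul_mul, Matrix.mul_assoc, hYY,
      Matrix.mul_one]
  have h2 : (starRingEnd ℂ) (autFactor g Z) =
      autFactor g Z * (1 + logDenom g Z * (Zᴴ - Z)).det := by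
    have h3 := congrArg Matrix.det (denom_add Zᴴ hu)
    rw [denom_conj_eq hZ.1, det_transpose, det_conjTranspose, det_mul] at h3
    exact h3
  have h4 : (Y⁻¹).det = (Y.det)⁻¹ := by rw [det_nonsing_inv, Ring.inverse_eq_inv']
  rw [h1, det_mul, cplx_det, h4, Complex.ofReal_mul, Complex.ofReal_pow, ← Complex.mul_conj', h2]
  ring

end Terms

section Coefficients

variable {n : ℕ}

/-- The chosen representative of a coset, as a real matrix. -/
def cosetMat (c : Cosets n) : Matrix (Idx n ⊕ Idx n) (Idx n ⊕ Idx n) ℝ :=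
  (ratMat c.out).map (algebraMap ℚ ℝ)

lemma exists_isSimil_cosetMat (c : Cosets n) : ∃ v : ℝ, v ≠ 0 ∧ IsSimil (cosetMat c) v := by
  obtain ⟨v, hv⟩ := exists_isSimil c.out
  exact ⟨_, (map_ne_zero (algebraMap ℚ ℝ)).2 v.ne_zero, hv.map (algebraMap ℚ ℝ)⟩

/-- The similitude factor of the chosen representative. -/
def cosetFactor (c : Cosets n) : ℝ := (exists_isSimil_cosetMat c).choose

lemma cosetFactor_ne_zero (c : Cosets n) : cosetFactor c ≠ 0 :=
  (exists_isSimil_cosetMat c).choose_spec.1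

lemma isSimil_cosetMat (c : Cosets n) : IsSimil (cosetMat c) (cosetFactor c) :=
  (exists_isSimil_cosetMat c).choose_spec.2

/-- The coefficient of `j(γ, Z)^{-E} det((Im Z)⁻¹ - 2i (CZ + D)⁻¹C)^m` in the term of the
Eisenstein series that belongs to the coset of `γ`. -/
def eisCoeff (n k N m : ℕ) (χ : IdeleClassChar) (s : ℂ) (c : Cosets n) : ℂ :=
  ((cosetFactor c : ℂ) ^ n) ^ k * ((((|cosetFactor c| ^ n) ^ (2 * m))⁻¹ : ℝ) : ℂ) *
    ∏ᶠ p : Nat.Primes, sectionP n N χ s p ((ratMat c.out).map (algebraMap ℚ ℚ_[p]))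

variable {k N : ℕ} {χ : IdeleClassChar} {s : ℂ}

/-- The coefficient is governed by the value of the global section at the identity, whose sum over
the cosets is already known to converge. -/
lemma norm_eisCoeff [NeZero n] (hχ : χ.HasTypeLevel k N) {E m : ℕ} (hk : k = E + 2 * m)
    (hs : modExponent n s = E) (c : Cosets n) :
    ‖matSection n k N χ s (ratMat c.out) 1‖ =
      ‖eisCoeff n k N m χ s c‖ * (‖autFactor (cosetMat c) (basePoint (Idx n))‖ ^ E)⁻¹ := by
  have hv := cosetFactor_ne_zero c
  have hv' : |cosetFactor c| ^ n ≠ 0 := pow_ne_zero _ (abs_ne_zero.2 hv)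
  have h1 : ‖eisCoeff n k N m χ s c‖ = (|cosetFactor c| ^ n) ^ E *
      ‖∏ᶠ p : Nat.Primes, sectionP n N χ s p ((ratMat c.out).map (algebraMap ℚ ℚ_[p]))‖ := by
    rw [eisCoeff, norm_mul, norm_mul, norm_pow, norm_pow, Complex.norm_real, Complex.norm_real,
      Real.norm_eq_abs, Real.norm_eq_abs, abs_inv, abs_pow, abs_pow, abs_abs]
    congr 1
    rw [hk, pow_add, mul_assoc, mul_inv_cancel₀ (pow_ne_zero _ hv'), mul_one]
  rw [matSection, norm_mul, Matrix.mul_one, h1]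
  change ‖sectionInfty n k χ s (cosetMat c)‖ * _ = _
  rw [norm_sectionInfty hχ hk hs hv (isSimil_cosetMat c), div_pow]
  ring

/-- The terms of the Eisenstein series in classical notation. -/
lemma autFactor_pow_mul_eisTerm [NeZero n] (hχ : χ.HasTypeLevel k N) {E m : ℕ} (hk : k = E + 2 * m)
    (hs : modExponent n s = E) {g : Matrix (Idx n ⊕ Idx n) (Idx n ⊕ Idx n) ℝ}
    (hg : g ∈ symplecticGroup (Idx n) ℝ) {Z : Matrix (Idx n) (Idx n) ℂ}
    (hgZ : moebius g (basePoint (Idx n)) = Z) (c : Cosets n) :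
    autFactor g (basePoint (Idx n)) ^ k * eisTerm n k N χ s g c =
      eisCoeff n k N m χ s c * (autFactor (cosetMat c) Z ^ E)⁻¹ *
        (cplx (Z.map Complex.im)⁻¹ + (-(2 * Complex.I)) • logDenom (cosetMat c) Z).det ^ m := by
  have hg1 := isSimil_one_iff.2 hg
  have hZ : Z ∈ upperHalfSpace (Idx n) := hgZ ▸ moebius_mem hg basePoint_mem
  have hv := cosetFactor_ne_zero c
  have hcs := isSimil_cosetMat c
  have hug := isUnit_denom hg1 one_ne_zero (basePoint_mem (l := Idx n))
  have hsim : IsSimil (cosetMat c * g) (cosetFactor c) := by simpa using hcs.mul hg1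
  set J := autFactor (cosetMat c) Z with hJ
  set j := autFactor g (basePoint (Idx n)) with hj
  set w := (cplx (Z.map Complex.im)⁻¹ + (-(2 * Complex.I)) • logDenom (cosetMat c) Z).det with hw
  have hJ0 : J ≠ 0 := (isUnit_denom hcs hv hZ).ne_zero
  have hj0 : j ≠ 0 := hug.ne_zero
  have hmul : autFactor (cosetMat c * g) (basePoint (Idx n)) = J * j := by
    rw [autFactor_mul _ hug, hgZ]
  have hdet : ‖j‖ ^ 2 = ((Z.map Complex.im).det)⁻¹ := by
    have h1 := norm_sq_autFactor_mul_det hg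
    rw [hgZ] at h1
    exact eq_inv_of_mul_eq_one_left h1
  have hkey : ((‖J * j‖ ^ 2 : ℝ) : ℂ) = J ^ 2 * w := by
    rw [norm_mul, mul_pow, hdet]
    exact norm_sq_autFactor_mul_inv_det hcs hv hZ
  rw [eisTerm_eq, matSection]
  change j ^ k * (sectionInfty n k χ s (cosetMat c * g) * _) = _
  rw [sectionInfty_eq hχ hk hs hv hsim, hmul, eisCoeff]
  have h2 : (((‖J * j‖ / |cosetFactor c| ^ n) ^ (2 * m) : ℝ) : ℂ) =
      J ^ (2 * m) * w ^ m * ((((|cosetFactor c| ^ n) ^ (2 * m))⁻¹ : ℝ) : ℂ) := by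
    rw [div_pow, div_eq_mul_inv, Complex.ofReal_mul, pow_mul ‖J * j‖, Complex.ofReal_pow, hkey,
      mul_pow, ← pow_mul]
  have h3 : j ^ k * ((cosetFactor c : ℂ) ^ n / (J * j)) ^ k * J ^ (2 * m) =
      ((cosetFactor c : ℂ) ^ n) ^ k * (J ^ E)⁻¹ := by
    rw [div_pow, mul_pow, hk, pow_add J]
    field_simp
  rw [h2]
  calc _ = (j ^ k * ((cosetFactor c : ℂ) ^ n / (J * j)) ^ k * J ^ (2 * m)) * w ^ m *
        ((((|cosetFactor c| ^ n) ^ (2 * m))⁻¹ : ℝ) : ℂ) *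
        ∏ᶠ p : Nat.Primes, sectionP n N χ s p ((ratMat c.out).map (algebraMap ℚ ℚ_[p])) := by ring
    _ = _ := by rw [h3]; ring

end Coefficients

/-! ### Holomorphy of the coefficients -/

section Holomorphy

open Filter Topology

variable {n k N : ℕ} {χ : IdeleClassChar} {s : ℂ}

attribute [local instance] Matrix.normedAddCommGroup Matrix.normedSpace

/-- The terms of the series of holomorphic functions that are the coefficients of the Eisenstein
series as a polynomial in `(Im Z)⁻¹`. -/
def coeffTerm (n k N m E : ℕ) (χ : IdeleClassChar) (s : ℂ) (Ψ : MvPolynomial (Idx n × Idx n) ℂ)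
    (c : Cosets n) (Z : Matrix (Idx n) (Idx n) ℂ) : ℂ :=
  eisCoeff n k N m χ s c * (autFactor (cosetMat c) Z ^ E)⁻¹ *
    MvPolynomial.eval (fun ij => -(2 * Complex.I) * logDenom (cosetMat c) Z ij.1 ij.2) Ψ

/-- Locally uniform domination of the coefficient series. -/
lemma exists_summable_bound [NeZero n] (hχ : χ.HasTypeLevel k N) (hN : N ≠ 0) {E m : ℕ}
    (hk : k = E + 2 * m) (hs : modExponent n s = E) (hE : 2 * n + 2 ≤ E)
    (Ψ : MvPolynomial (Idx n × Idx n) ℂ) {Z₀ : Matrix (Idx n) (Idx n) ℂ}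
    (hZ₀ : Z₀ ∈ upperHalfSpace (Idx n)) :
    ∃ u : Cosets n → ℝ, Summable u ∧ ∀ᶠ Z in 𝓝 Z₀, Zᵀ = Z →
      Z ∈ upperHalfSpace (Idx n) ∧ ∀ c, ‖coeffTerm n k N m E χ s Ψ c Z‖ ≤ u c := by
  obtain ⟨K, hK, hev⟩ := eventually_norm_autFactor_le hZ₀
  obtain ⟨K', hK', hΨ⟩ := exists_norm_eval_le Ψ (2 * K)
  refine ⟨fun c => ‖matSection n k N χ s (ratMat c.out) 1‖ * (K ^ E * K'),
    (summable_norm_matSection_one hχ hN hk hs hE).mul_right _, hev.mono fun Z hZ hsym => ?_⟩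
  obtain ⟨hZH, hb⟩ := hZ hsym
  refine ⟨hZH, fun c => ?_⟩
  have hv := cosetFactor_ne_zero c
  have hcs := isSimil_cosetMat c
  obtain ⟨h1, h2⟩ := hb _ _ hv hcs
  have hJ : 0 < ‖autFactor (cosetMat c) Z‖ := norm_pos_iff.2 (isUnit_denom hcs hv hZH).ne_zero
  have hi : 0 < ‖autFactor (cosetMat c) (basePoint (Idx n))‖ :=
    norm_pos_iff.2 (isUnit_denom hcs hv basePoint_mem).ne_zero
  have h3 : (‖autFactor (cosetMat c) Z‖ ^ E)⁻¹ ≤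
      (‖autFactor (cosetMat c) (basePoint (Idx n))‖ ^ E)⁻¹ * K ^ E := by
    rw [inv_le_iff_one_le_mul₀ (by positivity), mul_assoc, ← mul_pow, ← inv_pow, ← mul_pow]
    refine one_le_pow₀ ?_
    rw [inv_mul_eq_div, one_le_div hi]
    exact h1
  have h4 : ‖MvPolynomial.eval (fun ij => -(2 * Complex.I) * logDenom (cosetMat c) Z ij.1 ij.2) Ψ‖ ≤
      K' := by
    refine hΨ _ fun ij => ?_
    rw [norm_mul, norm_neg, norm_mul, Complex.norm_I, mul_one, Complex.norm_two]
    exact mul_le_mul_of_nonneg_left (h2 _ _) two_pos.le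
  calc ‖coeffTerm n k N m E χ s Ψ c Z‖
      = ‖eisCoeff n k N m χ s c‖ * ((‖autFactor (cosetMat c) Z‖ ^ E)⁻¹ *
        ‖MvPolynomial.eval (fun ij => -(2 * Complex.I) * logDenom (cosetMat c) Z ij.1 ij.2) Ψ‖) := by
        rw [coeffTerm, norm_mul, norm_mul, norm_inv, norm_pow, mul_assoc]
    _ ≤ ‖eisCoeff n k N m χ s c‖ *
        ((‖autFactor (cosetMat c) (basePoint (Idx n))‖ ^ E)⁻¹ * K ^ E * K') := by gcongr
    _ = _ := by
        beta_reduce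
        rw [norm_eisCoeff hχ hk hs c]
        ring

lemma summable_coeffTerm [NeZero n] (hχ : χ.HasTypeLevel k N) (hN : N ≠ 0) {E m : ℕ}
    (hk : k = E + 2 * m) (hs : modExponent n s = E) (hE : 2 * n + 2 ≤ E)
    (Ψ : MvPolynomial (Idx n × Idx n) ℂ) {Z : Matrix (Idx n) (Idx n) ℂ}
    (hZ : Z ∈ upperHalfSpace (Idx n)) :
    Summable fun c => ‖coeffTerm n k N m E χ s Ψ c Z‖ := by
  obtain ⟨u, hu, hev⟩ := exists_summable_bound hχ hN hk hs hE Ψ hZ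
  exact Summable.of_nonneg_of_le (fun _ => norm_nonneg _) (hev.self_of_nhds hZ.1).2 hu

lemma isHolomorphic_tsum_coeffTerm [NeZero n] (hχ : χ.HasTypeLevel k N) (hN : N ≠ 0) {E m : ℕ}
    (hk : k = E + 2 * m) (hs : modExponent n s = E) (hE : 2 * n + 2 ≤ E)
    (Ψ : MvPolynomial (Idx n × Idx n) ℂ) :
    IsHolomorphic fun Z => ∑' c, coeffTerm n k N m E χ s Ψ c Z := by
  intro Z₀ hZ₀
  -- The projection to symmetric matrices extends the series to a neighbourhood.
  let σ : Matrix (Idx n) (Idx n) ℂ → Matrix (Idx n) (Idx n) ℂ := fun Z => (1 / 2 : ℂ) • (Z + Zᵀ)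
  have hσsymm : ∀ Z, (σ Z)ᵀ = σ Z := fun Z => by
    simp only [σ]
    rw [transpose_smul, transpose_add, transpose_transpose, add_comm]
  have hσeq : ∀ Z ∈ upperHalfSpace (Idx n), σ Z = Z := fun Z hZ => by
    simp only [σ]
    rw [hZ.1, ← two_smul ℂ Z, smul_smul]
    norm_num
  have hσc : Continuous σ := by
    simp only [σ]
    fun_prop
  have hσd : ∀ Z i j, DifferentiableAt ℂ (fun Z => σ Z i j) Z := by
    intro Z i j
    simp only [σ, Matrix.smul_apply, Matrix.add_apply, transpose_apply]
    fun_prop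
  obtain ⟨u, hu, hev⟩ := exists_summable_bound hχ hN hk hs hE Ψ hZ₀
  have hev' := (hσc.tendsto' Z₀ Z₀ (hσeq Z₀ hZ₀)).eventually hev
  have hdiff : DifferentiableAt ℂ (fun Z => ∑' c, coeffTerm n k N m E χ s Ψ c (σ Z)) Z₀ := by
    refine differentiableAt_tsum_of_bounded hu (hev'.mono fun Z hZ c => ?_)
    obtain ⟨hZH, hb⟩ := hZ (hσsymm Z)
    refine ⟨?_, hb c⟩
    have h0 : (denom (cosetMat c) (σ Z)).det ≠ 0 :=
      (isUnit_denom (isSimil_cosetMat c) (cosetFactor_ne_zero c) hZH).ne_zero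
    have h1 : DifferentiableAt ℂ (fun Z => autFactor (cosetMat c) (σ Z)) Z :=
      differentiableAt_det (differentiableAt_denom _ (hσd Z))
    refine (((h1.pow E).inv (pow_ne_zero _ h0)).const_mul _).mul ?_
    refine differentiableAt_mvPolynomial_eval Ψ fun ij => ?_
    exact (differentiableAt_logDenom _ (hσd Z) h0 _ _).const_mul _
  refine hdiff.differentiableWithinAt.congr (fun Z hZ => ?_) ?_
  · rw [hσeq Z hZ]
  · rw [hσeq Z₀ hZ₀]

end Holomorphy

/-! ### Near holomorphy and modularity of the Eisenstein series -/

section Final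

variable {n k N : ℕ} {χ : IdeleClassChar} {s : ℂ}

/-- `det (P + W)^m` as a polynomial in the entries of `P` whose coefficients are polynomials in
the entries of `W`. -/
lemma exists_det_add_pow_eq (l : Type) [Fintype l] [DecidableEq l] (m : ℕ) :
    ∃ (S : Finset (l × l → ℕ)) (Ψ : (l × l → ℕ) → MvPolynomial (l × l) ℂ),
      ∀ P W : Matrix l l ℂ, (P + W).det ^ m =
        ∑ a ∈ S, MvPolynomial.eval (fun ij => W ij.1 ij.2) (Ψ a) * ∏ ij, P ij.1 ij.2 ^ a ij := by
  let p : MvPolynomial (l × l) (MvPolynomial (l × l) ℂ) :=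
    (Matrix.of fun i j => MvPolynomial.X (i, j) + MvPolynomial.C (MvPolynomial.X (i, j))).det ^ m
  refine ⟨p.support.map ⟨fun d : l × l →₀ ℕ => ⇑d, DFunLike.coe_injective⟩,
    fun a => p.coeff (Finsupp.equivFunOnFinite.symm a), fun P W => ?_⟩
  have h1 : MvPolynomial.eval₂ (MvPolynomial.eval fun ij => W ij.1 ij.2)
      (fun ij => P ij.1 ij.2) p = (P + W).det ^ m := by
    change MvPolynomial.eval₂Hom (MvPolynomial.eval fun ij => W ij.1 ij.2)
      (fun ij => P ij.1 ij.2) p = _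
    rw [map_pow, RingHom.map_det]
    congr 2
    ext i j
    simp
  rw [← h1, MvPolynomial.eval₂_eq', Finset.sum_map]
  refine Finset.sum_congr rfl fun d _ => ?_
  have h2 : Finsupp.equivFunOnFinite.symm (⇑d) = d := Finsupp.equivFunOnFinite_symm_coe d
  simp only [Function.Embedding.coeFn_mk, h2]

/-- The Eisenstein series converges absolutely, and it is a polynomial in the entries of `(Im Z)⁻¹`
whose coefficients are the sums of `coeffTerm`. -/
lemma hasSum_autFactor_pow_mul_eisTerm [NeZero n] (hχ : χ.HasTypeLevel k N) (hN : N ≠ 0) {E m : ℕ}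
    (hk : k = E + 2 * m) (hs : modExponent n s = E) (hE : 2 * n + 2 ≤ E)
    {S : Finset (Idx n × Idx n → ℕ)} {Ψ : (Idx n × Idx n → ℕ) → MvPolynomial (Idx n × Idx n) ℂ}
    (hΨ : ∀ P W : Matrix (Idx n) (Idx n) ℂ, (P + W).det ^ m =
        ∑ a ∈ S, MvPolynomial.eval (fun ij => W ij.1 ij.2) (Ψ a) * ∏ ij, P ij.1 ij.2 ^ a ij)
    {g : Matrix (Idx n ⊕ Idx n) (Idx n ⊕ Idx n) ℝ}
    (hg : g ∈ symplecticGroup (Idx n) ℝ) {Z : Matrix (Idx n) (Idx n) ℂ}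
    (hgZ : moebius g (basePoint (Idx n)) = Z) :
    (Summable fun c => ‖autFactor g (basePoint (Idx n)) ^ k * eisTerm n k N χ s g c‖) ∧
    ∑' c, autFactor g (basePoint (Idx n)) ^ k * eisTerm n k N χ s g c =
      ∑ a ∈ S, (∑' c, coeffTerm n k N m E χ s (Ψ a) c Z) *
        ∏ ij : Idx n × Idx n, (((Z.map Complex.im)⁻¹ ij.1 ij.2 : ℝ) : ℂ) ^ a ij := by
  have hZ : Z ∈ upperHalfSpace (Idx n) := hgZ ▸ moebius_mem hg basePoint_mem
  have h1 : ∀ c, autFactor g (basePoint (Idx n)) ^ k * eisTerm n k N χ s g c =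
      ∑ a ∈ S, coeffTerm n k N m E χ s (Ψ a) c Z *
        ∏ ij : Idx n × Idx n, (((Z.map Complex.im)⁻¹ ij.1 ij.2 : ℝ) : ℂ) ^ a ij := by
    intro c
    rw [autFactor_pow_mul_eisTerm hχ hk hs hg hgZ, hΨ, Finset.mul_sum]
    refine Finset.sum_congr rfl fun a _ => ?_
    rw [coeffTerm, ← mul_assoc]
    rfl
  have h2 : ∀ a ∈ S, Summable fun c => coeffTerm n k N m E χ s (Ψ a) c Z *
      ∏ ij : Idx n × Idx n, (((Z.map Complex.im)⁻¹ ij.1 ij.2 : ℝ) : ℂ) ^ a ij := fun a _ =>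
    (summable_coeffTerm hχ hN hk hs hE (Ψ a) hZ).of_norm.mul_right _
  simp only [h1]
  refine ⟨(summable_sum h2).norm, ?_⟩
  rw [Summable.tsum_finsetSum h2]
  exact Finset.sum_congr rfl fun a _ => tsum_mul_right

lemma summable_norm_eisTerm [NeZero n] (hχ : χ.HasTypeLevel k N) (hN : N ≠ 0) {E m : ℕ}
    (hk : k = E + 2 * m) (hs : modExponent n s = E) (hE : 2 * n + 2 ≤ E)
    {g : Matrix (Idx n ⊕ Idx n) (Idx n ⊕ Idx n) ℝ} (hg : g ∈ symplecticGroup (Idx n) ℝ) :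
    Summable fun c => ‖eisTerm n k N χ s g c‖ := by
  obtain ⟨S, Ψ, hΨ⟩ := exists_det_add_pow_eq (Idx n) m
  have h1 := (hasSum_autFactor_pow_mul_eisTerm hχ hN hk hs hE hΨ hg rfl).1
  have h0 : ‖autFactor g (basePoint (Idx n)) ^ k‖ ≠ 0 := norm_ne_zero_iff.2
    (pow_ne_zero _ (isUnit_denom (isSimil_one_iff.2 hg) one_ne_zero basePoint_mem).ne_zero)
  simp only [norm_mul] at h1
  exact (summable_mul_left_iff h0).1 h1

/-- At `s = -m` the exponent of `|d|` in the sections is the integer `E = k - 2m`. -/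
lemma modExponent_adelicParam {E m : ℕ} (hk : k = E + 2 * m) :
    modExponent n (adelicParam n k (-(m : ℂ))) = E := by
  have h : (2 * (n : ℂ) + 1) ≠ 0 := by exact_mod_cast (Nat.succ_ne_zero (2 * n))
  rw [modExponent, adelicParam, hk]
  push_cast
  field_simp
  ring

/-- The value of the classical Eisenstein series in terms of an arbitrary lift of the point. -/
lemma classicalEis_eq [NeZero n] (hχ : χ.HasTypeLevel k N) (hN : N ≠ 0) {E m : ℕ}
    (hk : k = E + 2 * m) (hE : 2 * n + 2 ≤ E)
    {S : Finset (Idx n × Idx n → ℕ)} {Ψ : (Idx n × Idx n → ℕ) → MvPolynomial (Idx n × Idx n) ℂ}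
    (hΨ : ∀ P W : Matrix (Idx n) (Idx n) ℂ, (P + W).det ^ m =
        ∑ a ∈ S, MvPolynomial.eval (fun ij => W ij.1 ij.2) (Ψ a) * ∏ ij, P ij.1 ij.2 ^ a ij)
    {g : Matrix (Idx n ⊕ Idx n) (Idx n ⊕ Idx n) ℝ}
    (hg : g ∈ symplecticGroup (Idx n) ℝ) {Z : Matrix (Idx n) (Idx n) ℂ}
    (hgZ : moebius g (basePoint (Idx n)) = Z) :
    autFactor g (basePoint (Idx n)) ^ k * eisSeries n k N χ (adelicParam n k (-(m : ℂ))) g =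
      ∑ a ∈ S, (∑' c, coeffTerm n k N m E χ (adelicParam n k (-(m : ℂ))) (Ψ a) c Z) *
        ∏ ij : Idx n × Idx n, (((Z.map Complex.im)⁻¹ ij.1 ij.2 : ℝ) : ℂ) ^ a ij := by
  rw [eisSeries, ← tsum_mul_left]
  exact (hasSum_autFactor_pow_mul_eisTerm hχ hN hk (modExponent_adelicParam hk) hE hΨ hg hgZ).2

lemma isNearlyHolomorphic_classicalEis [NeZero n] (hχ : χ.HasTypeLevel k N) (hN : N ≠ 0) {E m : ℕ}
    (hk : k = E + 2 * m) (hE : 2 * n + 2 ≤ E) :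
    IsNearlyHolomorphic (classicalEis n k N χ (-(m : ℂ))) := by
  obtain ⟨S, Ψ, hΨ⟩ := exists_det_add_pow_eq (Idx n) m
  refine ⟨S, fun a Z => ∑' c, coeffTerm n k N m E χ (adelicParam n k (-(m : ℂ))) (Ψ a) c Z,
    fun a _ => isHolomorphic_tsum_coeffTerm hχ hN hk (modExponent_adelicParam hk) hE _,
    fun Z hZ => ?_⟩
  obtain ⟨h1, h2⟩ := liftPoint_spec hZ
  exact classicalEis_eq hχ hN hk hE hΨ h1 h2

/-- For `m = 0` the polynomial in `(Im Z)⁻¹` is constant. -/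
lemma isHolomorphic_classicalEis [NeZero n] (hχ : χ.HasTypeLevel k N) (hN : N ≠ 0)
    (hk : 2 * n + 2 ≤ k) : IsHolomorphic (classicalEis n k N χ (-((0 : ℕ) : ℂ))) := by
  have hk' : k = k + 2 * 0 := rfl
  refine DifferentiableOn.congr
    (isHolomorphic_tsum_coeffTerm hχ hN hk' (modExponent_adelicParam hk') hk 1) fun Z hZ => ?_
  obtain ⟨h1, h2⟩ := liftPoint_spec hZ
  refine (classicalEis_eq hχ hN hk' hk (S := {0}) (Ψ := fun _ => 1) (fun P W => ?_) h1 h2).trans ?_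
  · simp
  · simp

/-- Both `γ g` and the chosen lift of `γ Z` map the base point to `γ Z`, so they give the same value of
the Eisenstein series; on `γ g` the invariance under `Γ(N)` and the cocycle relation apply. -/
lemma isModularOfWeight_classicalEis [NeZero n] (hχ : χ.HasTypeLevel k N) (hN : N ≠ 0) {E m : ℕ}
    (hk : k = E + 2 * m) (hE : 2 * n + 2 ≤ E) :
    IsModularOfWeight k (GammaN (Idx n) N) (classicalEis n k N χ (-(m : ℂ))) := by
  rintro _ ⟨δ, hδ, rfl⟩ Z hZ
  obtain ⟨S, Ψ, hΨ⟩ := exists_det_add_pow_eq (Idx n) m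
  change classicalEis n k N χ (-(m : ℂ)) (moebius (δ.map (Int.cast : ℤ → ℝ)) Z) =
    autFactor (δ.map (Int.cast : ℤ → ℝ)) Z ^ k * _
  set γ : Matrix (Idx n ⊕ Idx n) (Idx n ⊕ Idx n) ℝ := δ.map (Int.cast : ℤ → ℝ) with hγ
  have hγs : γ ∈ symplecticGroup (Idx n) ℝ := isSimil_one_iff.1 (isSimil_map_intCast hδ.1 ℝ)
  obtain ⟨h1, h2⟩ := liftPoint_spec hZ
  obtain ⟨h3, h4⟩ := liftPoint_spec (moebius_mem hγs hZ)
  have hu := isUnit_denom (isSimil_one_iff.2 h1) one_ne_zero (basePoint_mem (l := Idx n))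
  have h5 : moebius (γ * liftPoint Z) (basePoint (Idx n)) = moebius γ Z := by
    rw [moebius_mul _ hu, h2]
  have h6 : γ * liftPoint Z ∈ symplecticGroup (Idx n) ℝ := mul_mem hγs h1
  rw [classicalEis, classicalEis_eq hχ hN hk hE hΨ h3 h4,
    ← classicalEis_eq hχ hN hk hE hΨ h6 h5, hγ,
    eisSeries_mul_left hχ hN hk (modExponent_adelicParam hk) hδ h1, ← hγ, autFactor_mul _ hu, h2,
    mul_pow, mul_assoc]
  rfl

end Final

end SiegelEis

end

open SiegelEis in
theorem proposition6p4 (n k N : ℕ) (hn : 1 ≤ n) (hN : 1 ≤ N) (hk : 2 * n + 2 ≤ k)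
    (χ : IdeleClassChar) (hχ : χ.HasTypeLevel k N) :
    ((∀ g ∈ Matrix.symplecticGroup (Idx n) ℝ,
        Summable fun c : Cosets n => ‖eisTerm n k N χ (adelicParam n k 0) g c‖) ∧
      IsSiegelModularForm k (GammaN (Idx n) N) (classicalEis n k N χ 0)) ∧
    ∀ m : ℕ, (m : ℝ) ≤ (k : ℝ) / 2 - n - 1 →
      (∀ g ∈ Matrix.symplecticGroup (Idx n) ℝ,
        Summable fun c : Cosets n => ‖eisTerm n k N χ (adelicParam n k (-(m : ℂ))) g c‖) ∧
      IsNearlyHolomorphicModularForm k (GammaN (Idx n) N) (classicalEis n k N χ (-(m : ℂ))) := by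
  have : NeZero n := ⟨by omega⟩
  have hN' : N ≠ 0 := by omega
  have hk' : k = k + 2 * 0 := rfl
  have h0 : (0 : ℂ) = -((0 : ℕ) : ℂ) := by simp
  refine ⟨?_, fun m hm => ?_⟩
  · rw [h0]
    exact ⟨fun g hg => summable_norm_eisTerm hχ hN' hk' (modExponent_adelicParam hk') hk hg,
      isHolomorphic_classicalEis hχ hN' hk, isModularOfWeight_classicalEis hχ hN' hk' hk⟩
  · have hm' : 2 * m + (2 * n + 2) ≤ k := by
      have : (2 * m + (2 * n + 2) : ℝ) ≤ k := by linarith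
      exact_mod_cast this
    obtain ⟨E, hE⟩ := Nat.exists_eq_add_of_le hm'
    have hkE : k = (2 * n + 2 + E) + 2 * m := by omega
    exact ⟨fun g hg => summable_norm_eisTerm hχ hN' hkE (modExponent_adelicParam hkE) (by omega) hg,
      isNearlyHolomorphic_classicalEis hχ hN' hkE (by omega),
      isModularOfWeight_classicalEis hχ hN' hkE (by omega)⟩
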